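/- **Setting.** All algorithms are probabilistic polynomial time (PPT) in the security parameter $\kappa$; "negligible" means $o(\kappa^{-c})$ for every $c$. A *data request* is $\mathtt{Read}(a)$ or $\mathtt{Write}(a,d)$, with $a$ below the capacity and $d$ a block of the fixed length. An *operation trace* is a finite sequence of reads and writes of locations of a physical device, which is blank at first; $\mathsf{WOnly}$ deletes the reads from a trace. An *ORAM scheme* consists of a setup algorithm (output: a private state and a trace that initializes the device) and a stateful access algorithm that, given the private state, the device and a data request, outputs a new private state, a trace to be executed on the device, and an answer. It is a *write-only ORAM* if it is PPT (each access takes time polynomial in $\kappa$ and the length of all requests so far); if on every sequence of polynomially many requests all $\mathtt{Read}$s of previously written blocks return the content written last, except with negligible probability; and if it is *write-only oblivious*: for every polynomial $r$, no PPT adversary that first sees $\mathsf{WOnly}$ of the initialization trace, then in at most $r(\kappa)$ rounds adaptively submits two request sequences $\vec y_0,\vec y_1$ with equal numbers of $\mathtt{Write}$s and receives $\mathsf{WOnly}$ of the trace of executing $\vec y_b$, outputs $1$ with non-negligibly different probabilities for $b=0$ and $b=1$. A *PD scheme* serves *patterns*, i.e. finite sequences of requests to a public and a hidden volume, a request being a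 data request or a dummy request $R_{\mathsf{dummy}}$. It consists of a setup algorithm (output: keys $K_{pub},K_{hid}$, an internal state, an initializing trace), a stateful algorithm $\mathsf{Oper}$ that, given keys, internal state, device and pattern, outputs a new internal state, a trace to be executed on the device, and the answers to the reads, and scheme-specific rules $R^1$ (on $P^1_{pub}$, relative to $P_{hid}$) and $R^2$ (on $P^2_{pub}$, relative to $P_{hid}$). A triple $(P^1_{pub},P^2_{pub},P_{hid})$ is *valid* if its requests are legitimate, the first two patterns are public, the third is hidden, $P^2_{pub}=\varnothing$ if $P_{hid}=\varnothing$, and $R^1,R^2$ hold; the patterns $P^1_{pub}\cup P^2_{pub}$ and $P^1_{pub}\cup P_{hid}$ of valid triples are *allowed* ($\cup$ is concatenation). The scheme is a *trace-oriented PD scheme* if, on sequences of allowed patterns, it is PPT and answers reads correctly (in the same sense as above, for each volume); if the public dummy request, executed alone, writes nothing and keeps the internal state; and if for every polynomial $r$ and every PPT adversary $|\Pr[b^*=b]-\frac12|$ is negligible in this game: a uniform bit $b$ is drawn, the adversary gets $K_{pub}$ and $\mathsf{WOnly}$ of the initialization trace, then in at most $r(\kappa)$ rounds adaptively submits valid triples,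 $P^1_{pub}\cup P^2_{pub}$ (if $b=0$) or $P^1_{pub}\cup P_{hid}$ (if $b=1$) is executed, and it receives the device state and $\mathsf{WOnly}$ of the trace; finally it outputs $b^*$. *Universal patterns* for a PD scheme are polynomial-time computable $n(\kappa)\ge1$, $P^1(\kappa)$, $P^2(\kappa)$ such that for every legitimate hidden pattern $P_{hid}$ of length $n(\kappa)$ the triple $(P^1,P^2,P_{hid})$ is valid, and $(\{R_{\mathsf{dummy}}\},\varnothing,P_{hid})$ is valid if $P_{hid}$ contains no $\mathtt{Write}$. **Constructions.** *(HIVE.)* From an ORAM scheme $\Gamma$ with capacity $N$ form the PD scheme $\mathrm{HIVE}(\Gamma)$: the public volume (capacity $N$) and the hidden volume (capacity $\lfloor N/2\rfloor$) are kept in two independent instances of $\Gamma$ on two halves of the device, whose initial private states serve as $K_{pub}$ and $K_{hid}$. Given a pattern, the public data requests are served by the public instance, then the hidden instance is used as follows, the $i$-th public request being paired with the $i$-th hidden one (missing partners count as dummies): a hidden data request is served, with hidden block $a$ stored as block $2a+1$, and whenever the public partner is a data request and the hidden one is not a $\mathtt{Write}$, a zero block is written to the reserved block $0$. Rules: $R^1$: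 $P^1_{pub}$ and $P_{hid}$ have equal length, and no hidden $\mathtt{Write}$ is paired with a dummy; $R^2$: $P^2_{pub}=\varnothing$. *(ORAM from PD.)* From a PD scheme $\Sigma$ and universal patterns $n,P^1,P^2$ form the ORAM whose setup is that of $\Sigma$ and whose access, on a data request $\alpha$, lets $P_{hid}$ consist of the hidden request $\alpha$ and $n-1$ hidden dummy requests, runs $\mathsf{Oper}$ on $P^1\cup P_{hid}$ if $\alpha$ is a $\mathtt{Write}$ and on $\{R_{\mathsf{dummy}}\}\cup P_{hid}$ if $\alpha$ is a $\mathtt{Read}$, and returns the resulting trace and the answer to $\alpha$. **Lemma.** Write-only ORAMs are sufficient and necessary for trace-oriented PD: 1. (Sufficiency) For every write-only ORAM $\Gamma$, $\mathrm{HIVE}(\Gamma)$ is a trace-oriented PD scheme, and it has universal patterns. 2. (Necessity) For every trace-oriented PD scheme $\Sigma$ and all universal patterns $n,P^1,P^2$ for it, the ORAM formed from $\Sigma$, $n$, $P^1$ is a write-only ORAM. -/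

import Mathlib

open Filter

/-! ### A machine model with a step count

Programs act on binary trees, can toss fair coins, and pay for every elementary operation the size
of the tree they handle.  Loops are bounded by the length of a list held in the data, so every
program halts; a Turing machine with a polynomial clock is simulated with polynomial overhead (the
clock is computed by nested loops), and conversely a run of cost `t` is simulated by a probabilistic
Turing machine in time polynomial in `t`.  Hence "some program does it with polynomially bounded
cost" is probabilistic polynomial time. -/

/-- Binary trees, the data on which programs act. -/
inductive Data : Type
  | nil : Data
  | cons : Data → Data → Data

namespace Data

/-- Number of nodes. -/
def size : Data → ℕ
  | nil => 1
  | cons l r => l.size + r.size + 1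

/-- Left subtree. -/
def left : Data → Data
  | nil => nil
  | cons l _ => l

/-- Right subtree. -/
def right : Data → Data
  | nil => nil
  | cons _ r => r

/-- Length of a tree read as a list (its right spine). -/
def len : Data → ℕ
  | nil => 0
  | cons _ r => r.len + 1

/-- Selects by whether a tree is `nil`. -/
def select {β : Type} (x : Data) (ifNil ifCons : β) : β :=
  match x with
  | nil => ifNil
  | cons _ _ => ifCons

end Data

/-- Probabilistic programs. -/
inductive Prog : Type
  /-- return the input -/
  | id : Prog
  /-- return the constant `nil` -/
  | nil : Prog
  /-- return the left subtree of the input -/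
  | left : Prog
  /-- return the right subtree of the input -/
  | right : Prog
  /-- toss a fair coin -/
  | flip : Prog
  /-- run both programs on the input and return the pair of results -/
  | pair : Prog → Prog → Prog
  /-- `comp g f` runs `f` and then `g` on the result -/
  | comp : Prog → Prog → Prog
  /-- `cond c f g` runs `f` if the result of `c` is `nil`, and `g` otherwise -/
  | cond : Prog → Prog → Prog → Prog
  /-- on input `cons n x`, apply the body to `x` as many times as `n` has entries -/
  | loop : Prog → Prog

/-- The encoding of a bit as a tree. -/
def bitData (b : Bool) : Data := if b then Data.cons Data.nil Data.nil else Data.nil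

/-- Iterate a randomized step, adding up its costs. -/
noncomputable def iterCost (f : Data → PMF (Data × ℕ)) : ℕ → Data → PMF (Data × ℕ)
  | 0, x => PMF.pure (x, 0)
  | n + 1, x =>
      (f x).bind fun y => (iterCost f n y.1).bind fun z => PMF.pure (z.1, y.2 + z.2 + 1)

/-- The joint distribution of the result and the cost (number of steps) of a program. -/
noncomputable def Prog.run : Prog → Data → PMF (Data × ℕ)
  | .id, x => PMF.pure (x, x.size + 1)
  | .nil, x => PMF.pure (Data.nil, x.size + 1)
  | .left, x => PMF.pure (x.left, x.size + 1)
  | .right, x => PMF.pure (x.right, x.size + 1)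
  | .flip, x => (PMF.uniformOfFintype Bool).bind fun b => PMF.pure (bitData b, x.size + 1)
  | .pair f g, x =>
      (f.run x).bind fun y => (g.run x).bind fun z =>
        PMF.pure (Data.cons y.1 z.1, y.2 + z.2 + 1)
  | .comp g f, x =>
      (f.run x).bind fun y => (g.run y.1).bind fun z => PMF.pure (z.1, y.2 + z.2 + 1)
  | .cond c f g, x =>
      (c.run x).bind fun y => (y.1.select (f.run x) (g.run x)).bind fun z =>
        PMF.pure (z.1, y.2 + z.2 + 1)
  | .loop f, x =>
      (iterCost f.run x.left.len x.right).bind fun z => PMF.pure (z.1, x.size + z.2 + 1)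

/-! ### Encodings -/

/-- Types whose elements are presented to programs as trees. -/
class Enc (α : Type) where
  enc : α → Data

/-- The size of the encoding of an object. -/
def encSize {α : Type} [Enc α] (x : α) : ℕ := (Enc.enc x).size

/-- A natural number that is presented in unary, such as the security parameter `1^κ`. -/
structure Unary where
  val : ℕ

/-- A list as a right spine. -/
def encList {α : Type} (e : α → Data) : List α → Data
  | [] => Data.nil
  | a :: l => Data.cons (e a) (encList e l)

instance : Enc Data := ⟨fun x => x⟩
instance : Enc Bool := ⟨bitData⟩
instance : Enc Unary := ⟨fun n => encList bitData (List.replicate n.val false)⟩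
instance {α : Type} [Enc α] : Enc (List α) := ⟨encList Enc.enc⟩
instance {α β : Type} [Enc α] [Enc β] : Enc (α × β) := ⟨fun x => Data.cons (Enc.enc x.1) (Enc.enc x.2)⟩
instance {α : Type} [Enc α] : Enc (Option α) :=
  ⟨fun x => match x with
    | none => Data.nil
    | some a => Data.cons Data.nil (Enc.enc a)⟩
/-- Natural numbers (addresses) are presented in binary. -/
instance : Enc ℕ := ⟨fun n => Enc.enc (Nat.bits n)⟩

/-- On input `x`, the program `P` samples the distribution `f x` and never takes more than `t`
steps. -/
def RunsIn {α β : Type} [Enc α] [Enc β] (P : Prog) (f : α → PMF β) (x : α) (t : ℕ) : Prop :=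
  (P.run (Enc.enc x)).map Prod.fst = (f x).map Enc.enc ∧ ∀ o ∈ (P.run (Enc.enc x)).support, o.2 ≤ t

/-- `f` can be sampled in time polynomial in the security parameter. -/
def SamplableInPolyTime {β : Type} [Enc β] (f : ℕ → PMF β) : Prop :=
  ∃ (P : Prog) (p : Polynomial ℕ), ∀ κ : ℕ,
    RunsIn P (fun x : Unary => f x.val) ⟨κ⟩ (p.eval κ)

/-- `f` can be computed in time polynomial in the security parameter. -/
def ComputableInPolyTime {β : Type} [Enc β] (f : ℕ → β) : Prop :=
  SamplableInPolyTime fun κ => PMF.pure (f κ)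

/-- Negligible functions of the security parameter. -/
def Negligible (ε : ℕ → ℝ) : Prop :=
  Asymptotics.SuperpolynomialDecay atTop (fun κ : ℕ => (κ : ℝ)) ε

/-- The probability of an event. -/
noncomputable def prob {α : Type} (μ : PMF α) (E : α → Prop) : ℝ :=
  (μ.toOuterMeasure {x | E x}).toReal

/-! ### Requests, physical devices and traces -/

/-- The content of a block (logical or physical). -/
abbrev Block := List Bool

/-- A data request: read a block, or write a block. -/
inductive Op : Type
  | read (addr : ℕ) : Op
  | write (addr : ℕ) (d : Block) : Op

namespace Op

def isWrite : Op → Bool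
  | read _ => false
  | write _ _ => true

/-- The request addresses one of `cap` blocks, and writes blocks of `len` bits only. -/
def Legit (cap len : ℕ) : Op → Prop
  | read a => a < cap
  | write a d => a < cap ∧ d.length = len

end Op

instance : Enc Op :=
  ⟨fun o => match o with
    | .read a => Data.cons Data.nil (Enc.enc a)
    | .write a d => Data.cons (bitData true) (Data.cons (Enc.enc a) (Enc.enc d))⟩

/-- The number of `Write` requests in a sequence. -/
def writeCount (y : List Op) : ℕ := y.countP Op.isWrite

/-- An operation on the physical device; locations are bit strings. -/
inductive Access : Type
  | read (loc : List Bool) : Access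
  | write (loc : List Bool) (d : Block) : Access

instance : Enc Access :=
  ⟨fun o => match o with
    | .read l => Data.cons Data.nil (Enc.enc l)
    | .write l d => Data.cons (bitData true) (Data.cons (Enc.enc l) (Enc.enc d))⟩

def Access.isWrite : Access → Bool
  | .read _ => false
  | .write _ _ => true

/-- An operation trace: the operations performed on the physical device, in order. -/
abbrev Trace := List Access

/-- Filter out the `Read` operations of a trace. -/
def wOnly (t : Trace) : Trace := t.filter Access.isWrite

/-- The state of the physical device: the written locations with their contents.  The blank device
is `[]`. -/
abbrev Device := List (List Bool × Block)

/-- Overwrite one location. -/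
def Device.put (l : List Bool) (d : Block) : Device → Device
  | [] => [(l, d)]
  | e :: dev => if e.1 = l then (l, d) :: dev else e :: Device.put l d dev

/-- Perform one operation; reading does not modify the device. -/
def Device.perform (dev : Device) : Access → Device
  | .read _ => dev
  | .write l d => Device.put l d dev

/-- Execute a trace on a device. -/
def Device.exec (dev : Device) (t : Trace) : Device := t.foldl Device.perform dev

/-! ### What reads should return -/

/-- The logical memory after a sequence of requests (`none`: never written). -/
def memAfter (mem : ℕ → Option Block) : List Op → (ℕ → Option Block)
  | [] => mem
  | .read _ :: y => memAfter mem y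
  | .write a d :: y => memAfter (Function.update mem a (some d)) y

/-- `ans` lists one answer for every `Read` of `y`, in order, and every `Read` of a block that has
been written before is answered by the content written last. -/
def Consistent (mem : ℕ → Option Block) : List Op → List Block → Prop
  | [], ans => ans = []
  | .write a d :: y, ans => Consistent (Function.update mem a (some d)) y ans
  | .read _ :: _, [] => False
  | .read a :: y, v :: ans => (∀ d, mem a = some d → v = d) ∧ Consistent mem y ans

/-- `Consistent`, batch by batch. -/
def ConsistentSeq (mem : ℕ → Option Block) : List (List Op) → List (List Block) → Prop
  | [], anss => anss = []
  | _ :: _, [] => False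
  | y :: ys, ans :: anss => Consistent mem y ans ∧ ConsistentSeq (memAfter mem y) ys anss

/-! ### Interactive adversaries -/

/-- An adversary that receives an initial message and then, in every round, either passes or sends
a query and receives a reply; finally it outputs a bit.  All steps are randomized, depend on the
security parameter and on the adversary's private state. -/
structure Adversary (Init Query Reply : Type) where
  start : ℕ → Init → PMF Data
  ask : ℕ → Data → PMF (Option Query × Data)
  tell : ℕ → Data → Reply → PMF Data
  guess : ℕ → Data → PMF Bool

namespace Adversary

variable {Init Query Reply : Type}

/-- `A.Reach κ i n s`: with security parameter `κ`, the adversary can be in state `s` after `i`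
rounds in which it has received messages (whatever they were) of total length `n`. -/
inductive Reach [Enc Init] [Enc Reply] (A : Adversary Init Query Reply) (κ : ℕ) :
    ℕ → ℕ → Data → Prop
  | start (m : Init) (s : Data) (hs : s ∈ (A.start κ m).support) : Reach A κ 0 (encSize m) s
  | pass (i n : ℕ) (s s' : Data) (h : Reach A κ i n s) (ha : (none, s') ∈ (A.ask κ s).support) :
      Reach A κ (i + 1) n s'
  | round (i n : ℕ) (s s' s'' : Data) (q : Query) (m : Reply) (h : Reach A κ i n s)
      (ha : (some q, s') ∈ (A.ask κ s).support) (ht : s'' ∈ (A.tell κ s' m).support) :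
      Reach A κ (i + 1) (n + encSize m) s''

/-- `A` is a probabilistic polynomial-time adversary for a game of at most `r κ` rounds with valid
queries described by `Valid`: whatever it is told, its queries are valid and have length polynomial
in `κ`, and its steps take time polynomial in `κ` and the length of the messages received so far. -/
def IsPPT [Enc Init] [Enc Query] [Enc Reply] (A : Adversary Init Query Reply)
    (Valid : ℕ → Query → Prop) (r : Polynomial ℕ) : Prop :=
  ∃ (Pstart Pask Ptell Pguess : Prog) (p : Polynomial ℕ), ∀ κ : ℕ,
    (∀ m : Init,
      RunsIn Pstart (fun x : Unary × Init => A.start x.1.val x.2) (⟨κ⟩, m)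
        (p.eval (κ + encSize m))) ∧
    (∀ (i n : ℕ) (s : Data), i < r.eval κ → A.Reach κ i n s →
      RunsIn Pask (fun x : Unary × Data => A.ask x.1.val x.2) (⟨κ⟩, s) (p.eval (κ + n)) ∧
      ∀ (q : Query) (s' : Data), (some q, s') ∈ (A.ask κ s).support →
        Valid κ q ∧ encSize q ≤ p.eval κ ∧
        ∀ m : Reply,
          RunsIn Ptell (fun x : Unary × Data × Reply => A.tell x.1.val x.2.1 x.2.2) (⟨κ⟩, s', m)
            (p.eval (κ + n + encSize m))) ∧
    (∀ (n : ℕ) (s : Data), A.Reach κ (r.eval κ) n s →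
      RunsIn Pguess (fun x : Unary × Data => A.guess x.1.val x.2) (⟨κ⟩, s) (p.eval (κ + n)))

/-- Play the given number of rounds against a challenger with private state in `S`, and return the
bit that the adversary outputs. -/
noncomputable def play {S : Type} (A : Adversary Init Query Reply) (κ : ℕ)
    (respond : S → Query → PMF (S × Reply)) : ℕ → S → Data → PMF Bool
  | 0, _, a => A.guess κ a
  | k + 1, c, a =>
      (A.ask κ a).bind fun x =>
        match x.1 with
        | none => play A κ respond k c x.2
        | some q =>
            (respond c q).bind fun y =>
              (A.tell κ x.2 y.2).bind fun a' => play A κ respond k y.1 a'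

end Adversary

/-! ### Write-only oblivious RAM -/

/-- An ORAM scheme: a stateful randomized algorithm that serves data requests to `cap κ` logical
blocks of `blockLen κ` bits, by operations on a physical device.  `setup` returns the private state
(with the keys) and a trace that initializes the blank device; `access` takes the private state, the
device and a request and returns the new private state, the trace to be executed on the device, and
the value that answers the request (irrelevant for a `Write`). -/
structure ORAM where
  cap : ℕ → ℕ
  blockLen : ℕ → ℕ
  setup : ℕ → PMF (Data × Trace)
  access : ℕ → Data → Device → Op → PMF (Data × Trace × Block)

namespace ORAM

/-- Serve a sequence of requests: new state, new device, trace, and the answers to the `Read`s. -/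
noncomputable def exec (Γ : ORAM) (κ : ℕ) :
    Data → Device → List Op → PMF (Data × Device × Trace × List Block)
  | s, dev, [] => PMF.pure (s, dev, [], [])
  | s, dev, o :: y =>
      (Γ.access κ s dev o).bind fun (s₁, t₁, v) =>
        (exec Γ κ s₁ (dev.exec t₁) y).bind fun (s₂, dev₂, t₂, vs) =>
          PMF.pure (s₂, dev₂, t₁ ++ t₂, if o.isWrite then vs else v :: vs)

/-- Set up and serve a sequence of requests: state, device, and the answers to the `Read`s. -/
noncomputable def run (Γ : ORAM) (κ : ℕ) (y : List Op) : PMF (Data × Device × List Block) :=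
  (Γ.setup κ).bind fun (s, t) =>
    (Γ.exec κ s (Device.exec [] t) y).bind fun (s', dev', _, ans) => PMF.pure (s', dev', ans)

def LegitSeq (Γ : ORAM) (κ : ℕ) (y : List Op) : Prop :=
  ∀ o ∈ y, o.Legit (Γ.cap κ) (Γ.blockLen κ)

/-- All algorithms are probabilistic polynomial time: each access takes time polynomial in the
security parameter and the length of all requests so far. -/
def Efficient (Γ : ORAM) : Prop :=
  ComputableInPolyTime Γ.cap ∧
  ComputableInPolyTime (fun κ => Unary.mk (Γ.blockLen κ)) ∧
  SamplableInPolyTime Γ.setup ∧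
  ∃ (P : Prog) (p : Polynomial ℕ), ∀ (κ : ℕ) (y : List Op) (o : Op), Γ.LegitSeq κ (y ++ [o]) →
    ∀ c ∈ (Γ.run κ y).support,
      RunsIn P (fun x : Unary × Data × Device × Op => Γ.access x.1.val x.2.1 x.2.2.1 x.2.2.2)
        (⟨κ⟩, c.1, c.2.1, o) (p.eval (κ + encSize (y ++ [o])))

/-- On polynomially many requests, all `Read`s are answered correctly except with negligible
probability. -/
def Correct (Γ : ORAM) : Prop :=
  ∀ p : Polynomial ℕ, ∃ ε : ℕ → ℝ, Negligible ε ∧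
    ∀ (κ : ℕ) (y : List Op), Γ.LegitSeq κ y → y.length ≤ p.eval κ →
      prob (Γ.run κ y) (fun c => ¬ Consistent (fun _ => none) y c.2.2) ≤ ε κ

/-- The adversary is given the `Write` operations of the initialization, queries pairs of request
sequences, and receives the `Write` operations that the executed sequence causes. -/
abbrev Distinguisher := Adversary Trace (List Op × List Op) Trace

/-- The two sequences contain the same number of `Write` requests. -/
def ValidQuery (Γ : ORAM) (κ : ℕ) (q : List Op × List Op) : Prop :=
  Γ.LegitSeq κ q.1 ∧ Γ.LegitSeq κ q.2 ∧ writeCount q.1 = writeCount q.2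

/-- Execute the first (`b = false`) or the second (`b = true`) of the two sequences. -/
noncomputable def respond (Γ : ORAM) (κ : ℕ) (b : Bool) (c : Data × Device)
    (q : List Op × List Op) : PMF ((Data × Device) × Trace) :=
  (Γ.exec κ c.1 c.2 (if b then q.2 else q.1)).bind fun (s, dev, t, _) =>
    PMF.pure ((s, dev), wOnly t)

/-- The output of the adversary when the sequences number `b` are executed. -/
noncomputable def world (Γ : ORAM) (A : Distinguisher) (r : Polynomial ℕ) (b : Bool) (κ : ℕ) :
    PMF Bool :=
  (Γ.setup κ).bind fun (s, t) =>
    (A.start κ (wOnly t)).bind fun a =>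
      A.play κ (Γ.respond κ b) (r.eval κ) (s, Device.exec [] t) a

/-- The physical `Write` operations caused by two request sequences with the same number of `Write`
requests are computationally indistinguishable, where the adversary may choose the sequences
piecewise and adaptively. -/
def WriteOnlyOblivious (Γ : ORAM) : Prop :=
  ∀ (r : Polynomial ℕ) (A : Distinguisher), A.IsPPT Γ.ValidQuery r →
    Negligible fun κ =>
      |prob (Γ.world A r true κ) (· = true) - prob (Γ.world A r false κ) (· = true)|

/-- `Γ` is a (secure) write-only ORAM. -/
def IsWriteOnlyORAM (Γ : ORAM) : Prop :=
  Γ.Efficient ∧ Γ.Correct ∧ Γ.WriteOnlyOblivious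

end ORAM

/-! ### Plausibly deniable storage -/

/-- The public and the hidden volume. -/
inductive Volume : Type
  | pub : Volume
  | hid : Volume
  deriving DecidableEq

instance : Enc Volume :=
  ⟨fun v => match v with
    | .pub => bitData false
    | .hid => bitData true⟩

/-- A request to a volume: a data request, or the dummy request (`none`), which asks for nothing. -/
structure Request where
  vol : Volume
  op : Option Op

instance : Enc Request := ⟨fun r => Data.cons (Enc.enc r.vol) (Enc.enc r.op)⟩

abbrev Pattern := List Request

/-- The public dummy request. -/
def pubDummy : Request := ⟨.pub, none⟩

/-- The hidden dummy request. -/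
def hidDummy : Request := ⟨.hid, none⟩

/-- The requests of a pattern to one volume, in order (with dummies). -/
def slotsOf (v : Volume) (pat : Pattern) : List (Option Op) :=
  (pat.filter fun r => r.vol = v).map Request.op

/-- The data requests of a pattern to one volume, in order (without dummies). -/
def opsOf (v : Volume) (pat : Pattern) : List Op := (slotsOf v pat).filterMap fun o => o

/-- A PD scheme, with public and hidden capacity (in blocks), block length, and the scheme-specific
requirements `rule₁`, `rule₂` on the public patterns (given the hidden pattern).  `setup` returns
the public key, the hidden key, the internal state and a trace that initializes the blank device.
`oper` takes the keys, the internal state, the device and a pattern, and returns the new internal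
state, the trace to be executed on the device, and the answers to the public and to the hidden
`Read`s. -/
structure PDScheme where
  pubCap : ℕ → ℕ
  hidCap : ℕ → ℕ
  blockLen : ℕ → ℕ
  rule₁ : ℕ → Pattern → Pattern → Prop
  rule₂ : ℕ → Pattern → Pattern → Prop
  setup : ℕ → PMF (Data × Data × Data × Trace)
  oper : ℕ → Data → Data → Data → Device → Pattern →
    PMF (Data × Trace × List Block × List Block)

namespace PDScheme

def LegitRequest (D : PDScheme) (κ : ℕ) (r : Request) : Prop :=
  ∀ o, r.op = some o → o.Legit (if r.vol = .pub then D.pubCap κ else D.hidCap κ) (D.blockLen κ)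

/-- The requirements on the patterns `(P¹_pub, P²_pub, P_hid)` that the adversary submits. -/
structure ValidQuery (D : PDScheme) (κ : ℕ) (q : Pattern × Pattern × Pattern) : Prop where
  legit : ∀ r ∈ q.1 ++ q.2.1 ++ q.2.2, D.LegitRequest κ r
  pub_only : ∀ r ∈ q.1 ++ q.2.1, r.vol = .pub
  hid_only : ∀ r ∈ q.2.2, r.vol = .hid
  empty_hid : q.2.2 = [] → q.2.1 = []
  rule₁ : D.rule₁ κ q.1 q.2.2
  rule₂ : D.rule₂ κ q.2.1 q.2.2

/-- The patterns on which the scheme is meant to be used: those that occur in a valid query. -/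
def Allowed (D : PDScheme) (κ : ℕ) (pat : Pattern) : Prop :=
  ∃ P₁ P₂ Ph : Pattern, D.ValidQuery κ (P₁, P₂, Ph) ∧ (pat = P₁ ++ P₂ ∨ pat = P₁ ++ Ph)

/-- The keys, the internal state and the device. -/
structure Config where
  kpub : Data
  khid : Data
  st : Data
  dev : Device

/-- The configuration after setup, with the trace that initialized the device. -/
noncomputable def initial (D : PDScheme) (κ : ℕ) : PMF (Config × Trace) :=
  (D.setup κ).bind fun (kp, kh, st, t) => PMF.pure (⟨kp, kh, st, Device.exec [] t⟩, t)

/-- Execute one pattern. -/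
noncomputable def step (D : PDScheme) (κ : ℕ) (c : Config) (pat : Pattern) :
    PMF (Config × Trace × List Block × List Block) :=
  (D.oper κ c.kpub c.khid c.st c.dev pat).bind fun (st', t, ans) =>
    PMF.pure (⟨c.kpub, c.khid, st', c.dev.exec t⟩, t, ans)

/-- Execute several patterns, collecting the answers per pattern. -/
noncomputable def exec (D : PDScheme) (κ : ℕ) :
    Config → List Pattern → PMF (Config × List (List Block × List Block))
  | c, [] => PMF.pure (c, [])
  | c, pat :: pats =>
      (D.step κ c pat).bind fun (c₁, _, ans) =>
        (exec D κ c₁ pats).bind fun (c₂, anss) => PMF.pure (c₂, ans :: anss)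

/-- Set up and execute several patterns. -/
noncomputable def run (D : PDScheme) (κ : ℕ) (pats : List Pattern) :
    PMF (Config × List (List Block × List Block)) :=
  (D.initial κ).bind fun (c, _) => D.exec κ c pats

/-- All algorithms are probabilistic polynomial time: each operation takes time polynomial in the
security parameter and the length of all patterns so far. -/
def Efficient (D : PDScheme) : Prop :=
  ComputableInPolyTime D.pubCap ∧
  ComputableInPolyTime D.hidCap ∧
  ComputableInPolyTime (fun κ => Unary.mk (D.blockLen κ)) ∧
  SamplableInPolyTime D.setup ∧
  ∃ (P : Prog) (p : Polynomial ℕ), ∀ (κ : ℕ) (pats : List Pattern) (pat : Pattern),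
    (∀ x ∈ pats ++ [pat], D.Allowed κ x) →
    ∀ c ∈ (D.run κ pats).support,
      RunsIn P
        (fun x : Unary × Data × Data × Data × Device × Pattern =>
          D.oper x.1.val x.2.1 x.2.2.1 x.2.2.2.1 x.2.2.2.2.1 x.2.2.2.2.2)
        (⟨κ⟩, c.1.kpub, c.1.khid, c.1.st, c.1.dev, pat) (p.eval (κ + encSize (pats ++ [pat])))

/-- On polynomially many requests, all `Read`s of both volumes are answered correctly except with
negligible probability. -/
def Correct (D : PDScheme) : Prop :=
  ∀ p : Polynomial ℕ, ∃ ε : ℕ → ℝ, Negligible ε ∧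
    ∀ (κ : ℕ) (pats : List Pattern), (∀ x ∈ pats, D.Allowed κ x) →
      pats.length + pats.flatten.length ≤ p.eval κ →
      prob (D.run κ pats) (fun c => ¬
        (ConsistentSeq (fun _ => none) (pats.map (opsOf .pub)) (c.2.map Prod.fst) ∧
          ConsistentSeq (fun _ => none) (pats.map (opsOf .hid)) (c.2.map Prod.snd))) ≤ ε κ

/-- The dummy request has no effect: executed alone, it writes nothing and keeps the internal
state. -/
def DummyNoop (D : PDScheme) : Prop :=
  ∀ (κ : ℕ) (pats : List Pattern), (∀ x ∈ pats, D.Allowed κ x) →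
    ∀ c ∈ (D.run κ pats).support,
      ∀ o ∈ (D.oper κ c.1.kpub c.1.khid c.1.st c.1.dev [pubDummy]).support,
        o.1 = c.1.st ∧ wOnly o.2.1 = []

/-- The adversary is given the public key and the `Write` operations of the initialization, queries
triples `(P¹_pub, P²_pub, P_hid)`, and receives the device and the `Write` operations of the
executed pattern. -/
abbrev Coercer := Adversary (Data × Trace) (Pattern × Pattern × Pattern) (Device × Trace)

/-- Execute `P¹_pub ∪ P²_pub` (`b = false`) or `P¹_pub ∪ P_hid` (`b = true`). -/
noncomputable def respond (D : PDScheme) (κ : ℕ) (b : Bool) (c : Config)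
    (q : Pattern × Pattern × Pattern) : PMF (Config × (Device × Trace)) :=
  (D.step κ c (q.1 ++ if b then q.2.2 else q.2.1)).bind fun (c', t, _) =>
    PMF.pure (c', (c'.dev, wOnly t))

/-- The security game; its outcome tells whether the adversary guessed the challenge bit. -/
noncomputable def game (D : PDScheme) (A : Coercer) (r : Polynomial ℕ) (κ : ℕ) : PMF Bool :=
  (D.initial κ).bind fun (c, t) =>
    (A.start κ (c.kpub, wOnly t)).bind fun a =>
      (PMF.uniformOfFintype Bool).bind fun b =>
        (A.play κ (D.respond κ b) (r.eval κ) c a).bind fun g => PMF.pure (g == b)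

/-- Security of the scheme in the trace-oriented game with polynomially many rounds. -/
def TraceSecure (D : PDScheme) : Prop :=
  ∀ (r : Polynomial ℕ) (A : Coercer), A.IsPPT D.ValidQuery r →
    Negligible fun κ => |prob (D.game A r κ) (· = true) - 1 / 2|

/-- `D` is a trace-oriented PD scheme. -/
def IsTraceOrientedPD (D : PDScheme) : Prop :=
  D.Efficient ∧ D.Correct ∧ D.DummyNoop ∧ D.TraceSecure

/-- `P₁`, `P₂` are universal public patterns for hidden patterns of length `n`: the adversary may
combine them with every hidden pattern of that length.  Moreover a hidden pattern of that length
without `Write`s may be accompanied by the dummy request alone. -/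
structure Universal (D : PDScheme) (n : ℕ → ℕ) (P₁ P₂ : ℕ → Pattern) : Prop where
  pos : ∀ κ, 1 ≤ n κ
  computable_n : ComputableInPolyTime fun κ => Unary.mk (n κ)
  computable₁ : ComputableInPolyTime P₁
  computable₂ : ComputableInPolyTime P₂
  cover : ∀ (κ : ℕ) (Ph : Pattern), Ph.length = n κ →
    (∀ r ∈ Ph, r.vol = .hid ∧ D.LegitRequest κ r) → D.ValidQuery κ (P₁ κ, P₂ κ, Ph)
  coverReads : ∀ (κ : ℕ) (Ph : Pattern), Ph.length = n κ →
    (∀ r ∈ Ph, r.vol = .hid ∧ D.LegitRequest κ r ∧ ∀ o, r.op = some o → o.isWrite = false) →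
    D.ValidQuery κ ([pubDummy], [], Ph)

/-! ### A write-only ORAM from a trace-oriented PD scheme -/

/-- The hidden pattern that contains the request `o`, padded with dummies to length `n`. -/
def hiddenGen (n : ℕ) (o : Op) : Pattern := ⟨.hid, some o⟩ :: List.replicate (n - 1) hidDummy

/-- The ORAM that serves every request on the hidden volume: a `Write` is accompanied by the public
pattern `P₁`, a `Read` by the dummy request. -/
noncomputable def toORAM (D : PDScheme) (n : ℕ → ℕ) (P₁ : ℕ → Pattern) : ORAM where
  cap := D.hidCap
  blockLen := D.blockLen
  setup κ := (D.setup κ).bind fun (kp, kh, st, t) =>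
    PMF.pure (Data.cons kp (Data.cons kh st), t)
  access κ s dev o :=
    (D.oper κ s.left s.right.left s.right.right dev
      ((if o.isWrite then P₁ κ else [pubDummy]) ++ hiddenGen (n κ) o)).bind
        fun (st', t, _, hidAns) =>
          PMF.pure (Data.cons s.left (Data.cons s.right.left st'), t, hidAns.headD [])

end PDScheme

/-! ### A trace-oriented PD scheme from a write-only ORAM -/

namespace Hive

/-- Move a trace to one of the two halves of the device. -/
def tag (b : Bool) (t : Trace) : Trace :=
  t.map fun a => match a with
    | .read l => .read (b :: l)
    | .write l d => .write (b :: l) d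

/-- One of the two halves of the device. -/
def half (b : Bool) (dev : Device) : Device :=
  dev.filterMap fun e => match e.1 with
    | [] => none
    | c :: l => if c = b then some (l, e.2) else none

/-- The dummy access to the hidden ORAM that accompanies the public slot `p`: a `Write` to the
reserved block `0` if `p` is an access. -/
def dummyAccess (len : ℕ) (p : Option Op) : List Op :=
  if p.isSome then [.write 0 (List.replicate len false)] else []

/-- What the hidden ORAM does in a slot with public request `p` and hidden request `h`: block `a` of
the hidden volume is block `2 a + 1` of the ORAM, and a public access always comes with exactly one
`Write` to the hidden ORAM, a dummy one unless `h` is a `Write`. -/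
def slot (len : ℕ) (p h : Option Op) : List Op :=
  match h with
  | some (.write a d) => [.write (2 * a + 1) d]
  | some (.read a) => .read (2 * a + 1) :: dummyAccess len p
  | none => dummyAccess len p

/-- The requests to the hidden ORAM, when the `i`-th public and the `i`-th hidden request share a
slot. -/
def schedule (len : ℕ) : List (Option Op) → List (Option Op) → List Op
  | [], [] => []
  | [], h :: hs => slot len none h ++ schedule len [] hs
  | p :: ps, [] => slot len p none ++ schedule len ps []
  | p :: ps, h :: hs => slot len p h ++ schedule len ps hs

end Hive

/-- The HIVE scheme: the public and the hidden volume are kept in two instances of the ORAM, on the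
two halves of the device, and every access to the public volume is accompanied by a (real or dummy)
access to the hidden one.  `rule₁`: the public and the hidden pattern have equal length (and a
dummy, which is no access, is not paired with a hidden `Write`).  `rule₂`: the second public pattern
is empty. -/
noncomputable def hive (Γ : ORAM) : PDScheme where
  pubCap := Γ.cap
  hidCap κ := Γ.cap κ / 2
  blockLen := Γ.blockLen
  rule₁ _ P₁ Ph := List.Forall₂
    (fun p h : Request => ∀ o, h.op = some o → o.isWrite = true → p.op.isSome = true) P₁ Ph
  rule₂ _ P₂ _ := P₂ = []
  setup κ :=
    (Γ.setup κ).bind fun (sp, tp) => (Γ.setup κ).bind fun (sh, th) =>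
      PMF.pure (sp, sh, Data.cons sp sh, Hive.tag false tp ++ Hive.tag true th)
  oper κ _ _ st dev pat :=
    (Γ.exec κ st.left (Hive.half false dev) (opsOf .pub pat)).bind fun (sp, _, tp, ansp) =>
      (Γ.exec κ st.right (Hive.half true dev)
        (Hive.schedule (Γ.blockLen κ) (slotsOf .pub pat) (slotsOf .hid pat))).bind
          fun (sh, _, th, ansh) =>
            PMF.pure (Data.cons sp sh, Hive.tag false tp ++ Hive.tag true th, ansp, ansh)

/-! ### Distributions -/

/-! Sufficiency. HIVE runs two instances of the ORAM with independent random choices, and each of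
them sees its half of the device evolve as if it were alone (`Hive.half_false_exec`,
`Hive.half_true_exec`). Integrating out one instance leaves an ordinary run of the other, so
correctness is a union bound (`Hive.correct`); dummy writes go to block 0 and hidden data to odd
blocks, so they do not collide. For security, a valid triple gives the public instance the same
requests for both values of the challenge bit, and gives the hidden instance two sequences with
equally many `Write`s: a slot with a public data request causes exactly one hidden `Write`, every
other slot none (`Hive.writeCount_slot`). Hence a distinguisher against the ORAM can run the
coercer, operate the public instance itself, and leave the hidden instance to its challenger. It
learns only the hidden `Write`s, but reads do not change the device, so these suffice to reconstruct
it (`exec_wOnly`). The simulation is perfect (`Hive.world_distinguisher`), and the guessing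
advantage is half the distinguishing advantage (`PDScheme.abs_prob_game`).

Necessity. Each ORAM request is the `b = 1` side of a valid triple
(`PDScheme.validQuery_serveQuery`). Given a distinguisher against the derived ORAM, the coercer
number `j` runs it and submits, one by one, the triples for its `j`-th sequences. For `b = 1` the
distinguisher sees exactly the ORAM executing these sequences (`PDScheme.toORAM_world`). For `b = 0`
a `Read` becomes the public dummy, which has no effect, and each `Write` becomes the same public
pattern, so the view depends only on the number of `Write`s and is common to both coercers
(`PDScheme.world_coercer_false`). The triangle inequality through this common world bounds the
distinguishing advantage by the advantages of the two coercers.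

Running times. ORAMs, PD schemes and adversaries are efficient only in situations that can actually
arise. `PolySamp` therefore speaks of one program on an indexed family of inputs, and invariants
describe the indices. Since a program pays for the data it handles, a running time bounds the sizes
of its input and output; this controls the states of algorithms about which nothing else is known.
The delicate point in both reductions is that the budget of the inner adversary is measured by the
messages it receives, which has to be compared with the messages received by the outer one
(`Hive.SimInv`, `PDScheme.SubmitInv`). -/

theorem PMF.bind_congr_support {α β : Type} {μ : PMF α} {f g : α → PMF β}
    (h : ∀ a ∈ μ.support, f a = g a) : μ.bind f = μ.bind g := by
  ext b
  simp only [PMF.bind_apply]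
  refine tsum_congr fun a => ?_
  by_cases ha : μ a = 0
  · simp [ha]
  · rw [h a ((PMF.mem_support_iff _ _).2 ha)]

theorem PMF.bind_eq_of_support {α β : Type} {μ : PMF α} {f : α → PMF β} {ν : PMF β}
    (h : ∀ a ∈ μ.support, f a = ν) : μ.bind f = ν := by
  rw [PMF.bind_congr_support h, PMF.bind_const]

/-! ### Running programs -/

/-- On input `d` the program `P` samples `μ` in at most `t` steps. -/
def Runs (P : Prog) (d : Data) (μ : PMF Data) (t : ℕ) : Prop :=
  (P.run d).map Prod.fst = μ ∧ ∀ o ∈ (P.run d).support, o.2 ≤ t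

theorem Data.size_pos (d : Data) : 0 < d.size := by
  cases d <;> simp [Data.size]

theorem Data.size_left_le (d : Data) : d.left.size ≤ d.size := by
  cases d <;> simp [Data.size, Data.left]; omega

theorem Data.size_right_le (d : Data) : d.right.size ≤ d.size := by
  cases d <;> simp [Data.size, Data.right]; omega

theorem Data.len_le_size (d : Data) : d.len ≤ d.size := by
  induction d with
  | nil => simp [Data.len]
  | cons l r _ ih => simp [Data.len, Data.size]; omega

theorem iterCost_size_le (f : Data → PMF (Data × ℕ))
    (hf : ∀ x, ∀ o ∈ (f x).support, o.1.size ≤ 2 * o.2) :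
    ∀ n x, ∀ o ∈ (iterCost f n x).support, o.1.size ≤ x.size + 2 * o.2 := by
  intro n
  induction n with
  | zero => intro x o ho; simp [iterCost] at ho; subst ho; simp
  | succ n ih =>
    intro x o ho
    simp only [iterCost, PMF.mem_support_bind_iff, PMF.mem_support_pure_iff] at ho
    obtain ⟨y, hy, z, hz, rfl⟩ := ho
    have h1 := hf _ _ hy
    have h2 := ih _ _ hz
    simp only
    omega

/-- Every operation is charged for the data it handles. The factor 2 is needed for `flip`: on `nil`
it costs 2 and may return a tree with 3 nodes. -/
theorem Prog.size_le_cost (P : Prog) : ∀ x, ∀ o ∈ (P.run x).support, o.1.size ≤ 2 * o.2 := by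
  induction P with
  | id => intro x o ho; simp [Prog.run] at ho; subst ho; simp; omega
  | nil =>
    intro x o ho; simp [Prog.run] at ho; subst ho
    have := x.size_pos
    simp [Data.size]; omega
  | left =>
    intro x o ho; simp [Prog.run] at ho; subst ho
    have := x.size_left_le
    simp; omega
  | right =>
    intro x o ho; simp [Prog.run] at ho; subst ho
    have := x.size_right_le
    simp; omega
  | flip =>
    intro x o ho
    simp only [Prog.run, PMF.mem_support_bind_iff, PMF.mem_support_pure_iff] at ho
    obtain ⟨b, -, rfl⟩ := ho
    have := x.size_pos
    cases b <;> simp [bitData, Data.size] <;> omega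
  | pair f g hf hg =>
    intro x o ho
    simp only [Prog.run, PMF.mem_support_bind_iff, PMF.mem_support_pure_iff] at ho
    obtain ⟨y, hy, z, hz, rfl⟩ := ho
    have h1 := hf _ _ hy
    have h2 := hg _ _ hz
    simp only [Data.size]
    omega
  | comp g f hg hf =>
    intro x o ho
    simp only [Prog.run, PMF.mem_support_bind_iff, PMF.mem_support_pure_iff] at ho
    obtain ⟨y, hy, z, hz, rfl⟩ := ho
    have h2 := hg _ _ hz
    simp only
    omega
  | cond c f g hc hf hg =>
    intro x o ho
    simp only [Prog.run, PMF.mem_support_bind_iff, PMF.mem_support_pure_iff] at ho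
    obtain ⟨y, hy, z, hz, rfl⟩ := ho
    have h2 : z.1.size ≤ 2 * z.2 := by
      cases h : y.1 <;> simp only [h, Data.select] at hz
      · exact hf _ _ hz
      · exact hg _ _ hz
    simp only
    omega
  | loop f hf =>
    intro x o ho
    simp only [Prog.run, PMF.mem_support_bind_iff, PMF.mem_support_pure_iff] at ho
    obtain ⟨z, hz, rfl⟩ := ho
    have h1 := iterCost_size_le _ hf _ _ _ hz
    have h2 := x.size_right_le
    simp only
    omega

theorem Prog.exists_mem_support (P : Prog) (x : Data) : ∃ o, o ∈ (P.run x).support :=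
  (P.run x).support_nonempty

/-- The first primitive to be run receives the whole input and pays its size. Hence a time bound is
also a bound on the length of the input. -/
theorem Prog.input_size_le_cost (P : Prog) : ∀ x, ∀ o ∈ (P.run x).support, x.size ≤ o.2 := by
  induction P with
  | id => intro x o ho; simp [Prog.run] at ho; subst ho; simp
  | nil => intro x o ho; simp [Prog.run] at ho; subst ho; simp
  | left => intro x o ho; simp [Prog.run] at ho; subst ho; simp
  | right => intro x o ho; simp [Prog.run] at ho; subst ho; simp
  | flip =>
    intro x o ho
    simp only [Prog.run, PMF.mem_support_bind_iff, PMF.mem_support_pure_iff] at ho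
    obtain ⟨b, -, rfl⟩ := ho
    simp
  | pair f g hf hg =>
    intro x o ho
    simp only [Prog.run, PMF.mem_support_bind_iff, PMF.mem_support_pure_iff] at ho
    obtain ⟨y, hy, z, hz, rfl⟩ := ho
    have h1 := hf _ _ hy
    simp only
    omega
  | comp g f hg hf =>
    intro x o ho
    simp only [Prog.run, PMF.mem_support_bind_iff, PMF.mem_support_pure_iff] at ho
    obtain ⟨y, hy, z, hz, rfl⟩ := ho
    have h1 := hf _ _ hy
    simp only
    omega
  | cond c f g hc hf hg =>
    intro x o ho
    simp only [Prog.run, PMF.mem_support_bind_iff, PMF.mem_support_pure_iff] at ho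
    obtain ⟨y, hy, z, hz, rfl⟩ := ho
    have h1 := hc _ _ hy
    simp only
    omega
  | loop f hf =>
    intro x o ho
    simp only [Prog.run, PMF.mem_support_bind_iff, PMF.mem_support_pure_iff] at ho
    obtain ⟨z, hz, rfl⟩ := ho
    simp only
    omega

namespace Runs

variable {P Q : Prog} {d : Data} {μ : PMF Data} {t u : ℕ}

theorem mono (h : Runs P d μ t) (htu : t ≤ u) : Runs P d μ u :=
  ⟨h.1, fun o ho => (h.2 o ho).trans htu⟩

theorem input_size (h : Runs P d μ t) : d.size ≤ t := by
  obtain ⟨o, ho⟩ := P.exists_mem_support d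
  exact (P.input_size_le_cost d o ho).trans (h.2 o ho)

theorem mem_support (h : Runs P d μ t) {o : Data × ℕ} (ho : o ∈ (P.run d).support) :
    o.1 ∈ μ.support := by
  rw [← h.1, PMF.mem_support_map_iff]
  exact ⟨o, ho, rfl⟩

theorem output_size (h : Runs P d μ t) {y : Data} (hy : y ∈ μ.support) : y.size ≤ 2 * t := by
  rw [← h.1, PMF.mem_support_map_iff] at hy
  obtain ⟨o, ho, rfl⟩ := hy
  have h1 := P.size_le_cost d o ho
  have h2 := h.2 o ho
  omega

theorem id (d : Data) : Runs .id d (PMF.pure d) (d.size + 1) := by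
  constructor
  · simp [Prog.run, PMF.pure_map]
  · intro o ho; simp [Prog.run] at ho; subst ho; simp

theorem nil (d : Data) : Runs .nil d (PMF.pure .nil) (d.size + 1) := by
  constructor
  · simp [Prog.run, PMF.pure_map]
  · intro o ho; simp [Prog.run] at ho; subst ho; simp

theorem left (d : Data) : Runs .left d (PMF.pure d.left) (d.size + 1) := by
  constructor
  · simp [Prog.run, PMF.pure_map]
  · intro o ho; simp [Prog.run] at ho; subst ho; simp

theorem right (d : Data) : Runs .right d (PMF.pure d.right) (d.size + 1) := by
  constructor
  · simp [Prog.run, PMF.pure_map]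
  · intro o ho; simp [Prog.run] at ho; subst ho; simp

theorem pair {ν : PMF Data} (hP : Runs P d μ t) (hQ : Runs Q d ν u) :
    Runs (.pair P Q) d (μ.bind fun y => ν.map (Data.cons y)) (t + u + 1) := by
  constructor
  · simp only [Prog.run, PMF.map_bind, PMF.pure_map]
    rw [← hP.1, PMF.bind_map]
    refine PMF.bind_congr_support fun y hy => ?_
    rw [Function.comp_apply, ← hQ.1, PMF.map_comp]
    rfl
  · intro o ho
    simp only [Prog.run, PMF.mem_support_bind_iff, PMF.mem_support_pure_iff] at ho
    obtain ⟨y, hy, z, hz, rfl⟩ := ho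
    have h1 := hP.2 _ hy
    have h2 := hQ.2 _ hz
    simp only
    omega

/-- Since the test is deterministic, the branch is determined by the input, and each branch has to
work only on the inputs that select it. -/
theorem cond {C : Prog} {c : Data} (hC : Runs C d (PMF.pure c) t)
    (hP : c = .nil → Runs P d μ u) (hQ : c ≠ .nil → Runs Q d μ u) :
    Runs (.cond C P Q) d μ (t + u + 1) := by
  have key : ∀ y ∈ (C.run d).support, ∃ R : Prog, y.1.select (P.run d) (Q.run d) = R.run d ∧
      Runs R d μ u := by
    intro y hy
    have hy' : y.1 = c := by simpa using hC.mem_support hy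
    cases hc : c with
    | nil => exact ⟨P, by rw [hy', hc]; rfl, hP hc⟩
    | cons l r => exact ⟨Q, by rw [hy', hc]; rfl, hQ (by simp [hc])⟩
  constructor
  · simp only [Prog.run, PMF.map_bind, PMF.pure_map]
    refine PMF.bind_eq_of_support fun y hy => ?_
    obtain ⟨R, hR, hR'⟩ := key y hy
    rw [hR, ← hR'.1]
    rfl
  · intro o ho
    simp only [Prog.run, PMF.mem_support_bind_iff, PMF.mem_support_pure_iff] at ho
    obtain ⟨y, hy, z, hz, rfl⟩ := ho
    obtain ⟨R, hR, hR'⟩ := key y hy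
    rw [hR] at hz
    have h1 := hC.2 _ hy
    have h2 := hR'.2 _ hz
    simp only
    omega

end Runs

/-- Iterate a randomized step. -/
noncomputable def iterP {σ : Type} (step : σ → PMF σ) : ℕ → σ → PMF σ
  | 0, s => PMF.pure s
  | n + 1, s => (step s).bind (iterP step n)

/-- The body has to work only on states that satisfy the invariant of their round; after one step
the remaining rounds are governed by the shifted invariant. -/
theorem iterCost_runs {σ : Type} {P : Prog} (e : σ → Data) (step : σ → PMF σ) (t : ℕ) :
    ∀ (n : ℕ) (Inv : ℕ → σ → Prop),
      (∀ k s, k < n → Inv k s → Runs P (e s) ((step s).map e) t ∧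
        ∀ s' ∈ (step s).support, Inv (k + 1) s') →
      ∀ s, Inv 0 s → (iterCost P.run n (e s)).map Prod.fst = (iterP step n s).map e ∧
        ∀ o ∈ (iterCost P.run n (e s)).support, o.2 ≤ n * (t + 1) := by
  intro n
  induction n with
  | zero =>
    intro Inv _ s _
    simp [iterCost, iterP, PMF.pure_map]
  | succ n ih =>
    intro Inv hInv s hs
    obtain ⟨hr, hn⟩ := hInv 0 s (Nat.succ_pos _) hs
    have hi : ∀ s' ∈ (step s).support, _ := fun s' hs' =>
      ih (fun k => Inv (k + 1)) (fun k s hk h => hInv (k + 1) s (by omega) h) s' (hn s' hs')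
    constructor
    · simp only [iterCost, PMF.map_bind, PMF.pure_map, iterP]
      have h1 : ((P.run (e s)).bind fun y => (iterCost P.run n y.1).bind fun z => PMF.pure z.1) =
          ((P.run (e s)).map Prod.fst).bind fun y => (iterCost P.run n y).map Prod.fst := by
        rw [PMF.bind_map]; rfl
      rw [h1, hr.1, PMF.bind_map]
      exact PMF.bind_congr_support fun s' hs' => (hi s' hs').1
    · intro o ho
      simp only [iterCost, PMF.mem_support_bind_iff, PMF.mem_support_pure_iff] at ho
      obtain ⟨y, hy, z, hz, rfl⟩ := ho
      have hy' := hr.mem_support hy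
      rw [PMF.mem_support_map_iff] at hy'
      obtain ⟨s', hs', hse⟩ := hy'
      rw [← hse] at hz
      have h1 := (hi s' hs').2 _ hz
      have h2 := hr.2 _ hy
      simp only
      rw [Nat.succ_mul]
      omega

theorem Runs.loop {σ : Type} {P : Prog} {e : σ → Data} {step : σ → PMF σ} {t : ℕ} {n : Data}
    (Inv : ℕ → σ → Prop)
    (hInv : ∀ k s, k < n.len → Inv k s → Runs P (e s) ((step s).map e) t ∧
        ∀ s' ∈ (step s).support, Inv (k + 1) s') {s : σ} (hs : Inv 0 s) :
    Runs (.loop P) (.cons n (e s)) ((iterP step n.len s).map e)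
      ((Data.cons n (e s)).size * (t + 2) + 1) := by
  obtain ⟨h1, h2⟩ := iterCost_runs e step t n.len Inv hInv s hs
  constructor
  · simp only [Prog.run, PMF.map_bind, PMF.pure_map, Data.left, Data.right]
    rw [← h1]
    rfl
  · intro o ho
    simp only [Prog.run, PMF.mem_support_bind_iff, PMF.mem_support_pure_iff] at ho
    obtain ⟨z, hz, rfl⟩ := ho
    -- The number of rounds is at most the size of the input, since the list that counts them is a
    -- part of it.
    have h3 := h2 _ hz
    have h4 : n.len ≤ (Data.cons n (e s)).size := by
      have := n.len_le_size
      simp only [Data.size]; omega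
    have h5 := Nat.mul_le_mul_right (t + 1) h4
    simp only
    have : (Data.cons n (e s)).size * (t + 2) =
      (Data.cons n (e s)).size * (t + 1) + (Data.cons n (e s)).size := by ring
    omega

/-! ### Polynomial bounds -/

/-- `t` is bounded by a polynomial in `sz`. -/
def PolyBdd {I : Type} (sz t : I → ℕ) : Prop := ∃ p : Polynomial ℕ, ∀ i, t i ≤ p.eval (sz i)

/-- The coefficients are natural numbers, hence nonnegative. -/
theorem Polynomial.eval_nat_mono (p : Polynomial ℕ) {a b : ℕ} (h : a ≤ b) :
    p.eval a ≤ p.eval b := by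
  rw [Polynomial.eval_eq_sum_range, Polynomial.eval_eq_sum_range]
  exact Finset.sum_le_sum fun i _ => Nat.mul_le_mul_left _ (Nat.pow_le_pow_left h i)

namespace PolyBdd

variable {I J : Type} {sz t u : I → ℕ}

theorem const (n : ℕ) : PolyBdd sz fun _ => n := ⟨Polynomial.C n, fun i => by simp⟩

theorem self : PolyBdd sz sz := ⟨Polynomial.X, fun i => by simp⟩

theorem mono (h : PolyBdd sz u) (htu : ∀ i, t i ≤ u i) : PolyBdd sz t := by
  obtain ⟨p, hp⟩ := h
  exact ⟨p, fun i => (htu i).trans (hp i)⟩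

theorem add (ht : PolyBdd sz t) (hu : PolyBdd sz u) : PolyBdd sz fun i => t i + u i := by
  obtain ⟨p, hp⟩ := ht
  obtain ⟨q, hq⟩ := hu
  exact ⟨p + q, fun i => by rw [Polynomial.eval_add]; exact Nat.add_le_add (hp i) (hq i)⟩

theorem mul (ht : PolyBdd sz t) (hu : PolyBdd sz u) : PolyBdd sz fun i => t i * u i := by
  obtain ⟨p, hp⟩ := ht
  obtain ⟨q, hq⟩ := hu
  exact ⟨p * q, fun i => by rw [Polynomial.eval_mul]; exact Nat.mul_le_mul (hp i) (hq i)⟩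

theorem eval (p : Polynomial ℕ) (ht : PolyBdd sz t) : PolyBdd sz fun i => p.eval (t i) := by
  obtain ⟨q, hq⟩ := ht
  exact ⟨p.comp q, fun i => by rw [Polynomial.eval_comp]; exact p.eval_nat_mono (hq i)⟩

theorem trans (hu : PolyBdd t u) (ht : PolyBdd sz t) : PolyBdd sz u := by
  obtain ⟨p, hp⟩ := hu
  exact (eval p ht).mono hp

theorem reindex (h : PolyBdd sz t) (e : J → I) : PolyBdd (fun j => sz (e j)) fun j => t (e j) := by
  obtain ⟨p, hp⟩ := h
  exact ⟨p, fun j => hp (e j)⟩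

end PolyBdd

/-! ### Families of inputs treated in polynomial time -/

/-- One program samples `f i` on input `x i`, for all `i`, in time polynomial in `sz i`. -/
def PolySamp {I : Type} (sz : I → ℕ) {α β : Type} [Enc α] [Enc β] (x : I → α)
    (f : I → PMF β) : Prop :=
  ∃ (P : Prog) (p : Polynomial ℕ), ∀ i,
    Runs P (Enc.enc (x i)) ((f i).map Enc.enc) (p.eval (sz i))

/-- One program computes `g i` on input `x i`, for all `i`, in time polynomial in `sz i`. -/
def PolyComp {I : Type} (sz : I → ℕ) {α β : Type} [Enc α] [Enc β] (x : I → α) (g : I → β) : Prop :=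
  PolySamp sz x fun i => PMF.pure (g i)

/-- The function `f` is computable in time polynomial in the length of the input. -/
def PolyFun {α β : Type} [Enc α] [Enc β] (f : α → β) : Prop := PolyComp encSize (fun x : α => x) f

section

variable {I J : Type} {sz sz' : I → ℕ} {α β γ δ σ : Type} [Enc α] [Enc β] [Enc γ] [Enc δ] [Enc σ]
  {x : I → α}

theorem encSize_pos (a : α) : 0 < encSize a := Data.size_pos _

theorem encSize_pair (a : α) (b : β) : encSize (a, b) = encSize a + encSize b + 1 := rfl

theorem encSize_nil : encSize ([] : List α) = 1 := rfl

theorem encSize_cons (a : α) (l : List α) : encSize (a :: l) = encSize a + encSize l + 1 := rfl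

theorem encSize_append (l l' : List α) : encSize (l ++ l') + 1 = encSize l + encSize l' := by
  induction l with
  | nil => simp [encSize_nil]; omega
  | cons a l ih => simp only [List.cons_append, encSize_cons]; omega

theorem encSize_mem {a : α} {l : List α} (h : a ∈ l) : encSize a < encSize l := by
  induction l with
  | nil => simp at h
  | cons b l ih =>
    rw [encSize_cons]
    rcases List.mem_cons.1 h with rfl | h
    · have := encSize_pos l; omega
    · have := ih h; omega

theorem length_lt_encSize (l : List α) : l.length < encSize l := by
  induction l with
  | nil => simp [encSize_nil]
  | cons b l ih => rw [encSize_cons, List.length_cons]; omega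

theorem enc_list_len (l : List α) : (Enc.enc l).len = l.length := by
  induction l with
  | nil => rfl
  | cons a l ih =>
    change (Data.cons (Enc.enc a) (Enc.enc l)).len = _
    rw [Data.len, ih, List.length_cons]

namespace PolySamp

theorem of_bdd {f : I → PMF β} (P : Prog) {t : I → ℕ} (ht : PolyBdd sz t)
    (h : ∀ i, Runs P (Enc.enc (x i)) ((f i).map Enc.enc) (t i)) : PolySamp sz x f := by
  obtain ⟨p, hp⟩ := ht
  exact ⟨P, p, fun i => (h i).mono (hp i)⟩

theorem congr {f g : I → PMF β} (h : PolySamp sz x f) (hfg : ∀ i, f i = g i) :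
    PolySamp sz x g := by
  obtain rfl : f = g := funext hfg
  exact h

/-- Together with `output_bdd` this is the only source of size bounds for the states of unknown
algorithms. -/
theorem input_bdd {f : I → PMF β} (h : PolySamp sz x f) : PolyBdd sz fun i => encSize (x i) := by
  obtain ⟨P, p, h⟩ := h
  exact ⟨p, fun i => (h i).input_size⟩

theorem output_bdd {f : I → PMF β} (h : PolySamp sz x f) :
    ∃ p : Polynomial ℕ, ∀ i, ∀ y ∈ (f i).support, encSize y ≤ p.eval (sz i) := by
  obtain ⟨P, p, h⟩ := h
  refine ⟨2 * p, fun i y hy => ?_⟩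
  have := (h i).output_size (PMF.mem_support_map_iff _ _ _ |>.2 ⟨y, hy, rfl⟩)
  rw [Polynomial.eval_mul, Polynomial.eval_ofNat]
  exact this

theorem resize {f : I → PMF β} (h : PolySamp sz x f) (hs : PolyBdd sz' sz) :
    PolySamp sz' x f := by
  obtain ⟨P, p, h⟩ := h
  exact of_bdd P (hs.eval p) h

theorem reindex {f : I → PMF β} (h : PolySamp sz x f) (e : J → I) :
    PolySamp (fun j => sz (e j)) (fun j => x (e j)) fun j => f (e j) := by
  obtain ⟨P, p, h⟩ := h
  exact ⟨P, p, fun j => h (e j)⟩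

/-- Sample, and feed the result to the next program. -/
theorem andThen {f : I → PMF β} {g : I → β → PMF γ} (hf : PolySamp sz x f)
    (hg : PolySamp (fun z : {z : I × β // z.2 ∈ (f z.1).support} => sz z.1.1)
      (fun z => z.1.2) fun z => g z.1.1 z.1.2) :
    PolySamp sz x fun i => (f i).bind (g i) := by
  obtain ⟨P, p, hP⟩ := hf
  obtain ⟨Q, q, hQ⟩ := hg
  refine of_bdd (.comp Q P) (t := fun i => p.eval (sz i) + q.eval (sz i) + 1)
    (((PolyBdd.self.eval p).add (PolyBdd.self.eval q)).add (.const 1)) fun i => ?_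
  have h1 := hP i
  obtain ⟨h2, h3⟩ := h1
  constructor
  · simp only [Prog.run, PMF.map_bind, PMF.pure_map]
    have h1 : ((P.run (Enc.enc (x i))).bind fun y => (Q.run y.1).bind fun z => PMF.pure z.1) =
          ((P.run (Enc.enc (x i))).map Prod.fst).bind fun y => (Q.run y).map Prod.fst := by
        rw [PMF.bind_map]; rfl
    rw [h1, h2, PMF.bind_map]
    exact PMF.bind_congr_support fun y hy => (hQ ⟨(i, y), hy⟩).1
  · intro o ho
    simp only [Prog.run, PMF.mem_support_bind_iff, PMF.mem_support_pure_iff] at ho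
    obtain ⟨y, hy, z, hz, rfl⟩ := ho
    have hy' := (hP i).mem_support hy
    rw [PMF.mem_support_map_iff] at hy'
    obtain ⟨s', hs', hse⟩ := hy'
    rw [← hse] at hz
    have h1 := (hQ ⟨(i, s'), hs'⟩).2 _ hz
    have h2 := h3 _ hy
    simp only at h1 ⊢
    omega

end PolySamp

theorem PolyComp.of_prog {g : I → β} (P : Prog) {t : I → ℕ} (ht : PolyBdd sz t)
    (h : ∀ i, Runs P (Enc.enc (x i)) (PMF.pure (Enc.enc (g i))) (t i)) : PolyComp sz x g :=
  PolySamp.of_bdd P ht fun i => by rw [PMF.pure_map]; exact h i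

theorem PolyComp.exists_prog {g : I → β} (h : PolyComp sz x g) :
    ∃ (P : Prog) (p : Polynomial ℕ), ∀ i,
      Runs P (Enc.enc (x i)) (PMF.pure (Enc.enc (g i))) (p.eval (sz i)) := by
  obtain ⟨P, p, h⟩ := h
  exact ⟨P, p, fun i => by have := h i; rwa [PMF.pure_map] at this⟩

/-- Precompute the input. -/
theorem PolySamp.comp {y : I → β} {f : I → PMF γ} (hf : PolySamp sz y f) (hy : PolyComp sz x y) :
    PolySamp sz x f := by
  refine (PolySamp.andThen (g := fun i _ => f i) hy ?_).congr fun i => PMF.pure_bind _ _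
  obtain ⟨P, p, h⟩ := hf
  refine ⟨P, p, ?_⟩
  rintro ⟨⟨i, b⟩, hb⟩
  obtain rfl : b = y i := by simpa using hb
  exact h i

theorem PolySamp.map {f : I → PMF β} (hf : PolySamp sz x f) {h : β → γ} (hh : PolyFun h) :
    PolySamp sz x fun i => (f i).map h := by
  refine PolySamp.andThen (g := fun _ y => PMF.pure (h y)) hf ?_
  obtain ⟨q, hq⟩ := hf.output_bdd
  refine (PolySamp.reindex hh fun z : {z : I × β // z.2 ∈ (f z.1).support} => z.1.2).resize ?_
  exact ⟨q, fun z => hq _ _ z.2⟩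

namespace PolyComp

theorem congr {f g : I → β} (h : PolyComp sz x f) (hfg : ∀ i, f i = g i) : PolyComp sz x g := by
  obtain rfl : f = g := funext hfg
  exact h

theorem bdd {g : I → β} (h : PolyComp sz x g) : PolyBdd sz fun i => encSize (g i) := by
  obtain ⟨p, hp⟩ := PolySamp.output_bdd h
  exact ⟨p, fun i => hp i _ (by simp)⟩

theorem input (h : PolyBdd sz fun i => encSize (x i)) : PolyComp sz x x :=
  of_prog .id (h.add (.const 1)) fun _ => Runs.id _

/-- Programs see only encodings, so types may be exchanged freely as long as the trees agree. -/
theorem cast {g : I → β} (h : PolyComp sz x g) {f : I → γ}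
    (e : ∀ i, Enc.enc (f i) = Enc.enc (g i)) : PolyComp sz x f := by
  obtain ⟨P, p, h⟩ := h.exists_prog
  exact of_prog P (.eval p .self) fun i => by rw [e]; exact h i

theorem data {g : I → β} (h : PolyComp sz x g) : PolyComp sz x fun i => Enc.enc (g i) :=
  h.cast fun _ => rfl

theorem andThen {g : I → β} {h : I → γ} (hg : PolyComp sz x g) (hh : PolyComp sz g h) :
    PolyComp sz x h := PolySamp.comp hh hg

theorem app {h : β → γ} (hh : PolyFun h) {g : I → β} (hg : PolyComp sz x g) :
    PolyComp sz x fun i => h (g i) := by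
  refine hg.andThen ?_
  exact (PolySamp.reindex hh g).resize hg.bdd

theorem ofLeft {g : I → β} (h : PolyComp sz x g) {f : I → γ}
    (e : ∀ i, Enc.enc (f i) = (Enc.enc (g i)).left) : PolyComp sz x f :=
  h.andThen (of_prog .left (h.bdd.add (.const 1)) fun i => by rw [e]; exact Runs.left _)

theorem ofRight {g : I → β} (h : PolyComp sz x g) {f : I → γ}
    (e : ∀ i, Enc.enc (f i) = (Enc.enc (g i)).right) : PolyComp sz x f :=
  h.andThen (of_prog .right (h.bdd.add (.const 1)) fun i => by rw [e]; exact Runs.right _)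

theorem ofCons {g : I → β} {h : I → γ} (hg : PolyComp sz x g) (hh : PolyComp sz x h) {f : I → δ}
    (e : ∀ i, Enc.enc (f i) = Data.cons (Enc.enc (g i)) (Enc.enc (h i))) : PolyComp sz x f := by
  obtain ⟨P, p, hP⟩ := hg.exists_prog
  obtain ⟨Q, q, hQ⟩ := hh.exists_prog
  refine of_prog (.pair P Q) (((PolyBdd.self.eval p).add (PolyBdd.self.eval q)).add (.const 1))
    fun i => ?_
  have := (hP i).pair (hQ i)
  rwa [PMF.pure_bind, PMF.pure_map, ← e] at this

theorem pair {g : I → β} {h : I → γ} (hg : PolyComp sz x g) (hh : PolyComp sz x h) :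
    PolyComp sz x fun i => (g i, h i) := hg.ofCons hh fun _ => rfl

theorem fst {g : I → β × γ} (hg : PolyComp sz x g) : PolyComp sz x fun i => (g i).1 :=
  hg.ofLeft fun _ => rfl

theorem snd {g : I → β × γ} (hg : PolyComp sz x g) : PolyComp sz x fun i => (g i).2 :=
  hg.ofRight fun _ => rfl

theorem const (hx : PolyBdd sz fun i => encSize (x i)) (b : β) : PolyComp sz x fun _ => b := by
  suffices h : ∀ d : Data, PolyComp sz x fun _ => d from (h (Enc.enc b)).cast fun _ => rfl
  intro d
  induction d with
  | nil => exact of_prog .nil (hx.add (.const 1)) fun i => Runs.nil _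
  | cons l r hl hr => exact hl.ofCons hr fun _ => rfl

theorem cons {g : I → β} {h : I → List β} (hg : PolyComp sz x g) (hh : PolyComp sz x h) :
    PolyComp sz x fun i => g i :: h i := hg.ofCons hh fun _ => rfl

theorem some {g : I → β} (hg : PolyComp sz x g) : PolyComp sz x fun i => Option.some (g i) :=
  (PolyComp.const hg.input_bdd Data.nil).ofCons hg fun _ => rfl

theorem head {g : I → List β} (hg : PolyComp sz x g) {f : I → β}
    (h : ∀ i, ∃ l, g i = f i :: l) : PolyComp sz x f :=
  hg.ofLeft fun i => by obtain ⟨l, hl⟩ := h i; rw [hl]; rfl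

theorem tail {g : I → List β} (hg : PolyComp sz x g) : PolyComp sz x fun i => (g i).tail :=
  hg.ofRight fun i => by cases g i <;> rfl

end PolyComp

/-- Case distinction. -/
theorem PolySamp.cond {c : I → γ} {f : I → PMF β} (hc : PolyComp sz x c)
    (h₁ : PolySamp (fun i : {i // Enc.enc (c i) = Data.nil} => sz i.1) (fun i => x i.1)
      fun i => f i.1)
    (h₂ : PolySamp (fun i : {i // Enc.enc (c i) ≠ Data.nil} => sz i.1) (fun i => x i.1)
      fun i => f i.1) : PolySamp sz x f := by
  obtain ⟨C, c, hC⟩ := hc.exists_prog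
  obtain ⟨P, p, hP⟩ := h₁
  obtain ⟨Q, q, hQ⟩ := h₂
  refine of_bdd (.cond C P Q) (t := fun i => c.eval (sz i) + (p.eval (sz i) + q.eval (sz i)) + 1)
    (((PolyBdd.self.eval c).add ((PolyBdd.self.eval p).add (PolyBdd.self.eval q))).add (.const 1))
    fun i => ?_
  exact (hC i).cond (fun h => (hP ⟨i, h⟩).mono (Nat.le_add_right _ _))
    fun h => (hQ ⟨i, h⟩).mono (Nat.le_add_left _ _)

theorem PolyComp.reindex {g : I → β} (h : PolyComp sz x g) (e : J → I) :
    PolyComp (fun j => sz (e j)) (fun j => x (e j)) fun j => g (e j) :=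
  PolySamp.reindex h e

theorem PolyComp.resize {g : I → β} (h : PolyComp sz x g) (hs : PolyBdd sz' sz) :
    PolyComp sz' x g := PolySamp.resize h hs

/-- Sample, and feed the input together with the result to the next program. -/
theorem PolySamp.bind {f : I → PMF β} {g : I → β → PMF γ} (hf : PolySamp sz x f)
    (hg : PolySamp (fun z : {z : I × β // z.2 ∈ (f z.1).support} => sz z.1.1)
      (fun z => (x z.1.1, z.1.2)) fun z => g z.1.1 z.1.2) :
    PolySamp sz x fun i => (f i).bind (g i) := by
  have h1 : PolySamp sz x fun i => (f i).map fun y => (x i, y) := by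
    obtain ⟨P, p, hP⟩ := hf
    have hx := PolySamp.input_bdd ⟨P, p, hP⟩
    refine of_bdd (.pair .id P) (((hx.add (.const 1)).add (PolyBdd.self.eval p)).add (.const 1))
      fun i => ?_
    have := (Runs.id (Enc.enc (x i))).pair (hP i)
    rw [PMF.pure_bind, PMF.map_comp] at this
    rw [PMF.map_comp]
    exact this
  have := PolySamp.andThen (g := fun i z => g i z.2) h1 ?_
  · exact this.congr fun i => by rw [PMF.bind_map]; rfl
  · obtain ⟨Q, q, hQ⟩ := hg
    refine ⟨Q, q, ?_⟩
    rintro ⟨⟨i, ⟨a, y⟩⟩, hb⟩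
    simp only [PMF.mem_support_map_iff] at hb
    obtain ⟨y', hy', he⟩ := hb
    cases he
    exact hQ ⟨(i, y), hy'⟩

/-- This supplies the continuation of `PolySamp.bind` with access to the old input and to the
sample; the length of the latter is bounded by the running time. Projections of this identity are
the building blocks of what follows a sampling step. -/
theorem PolySamp.bindInput {f : I → PMF β} (hf : PolySamp sz x f) :
    PolyComp (fun z : {z : I × β // z.2 ∈ (f z.1).support} => sz z.1.1)
      (fun z => (x z.1.1, z.1.2)) fun z => (x z.1.1, z.1.2) := by
  obtain ⟨q, hq⟩ := hf.output_bdd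
  refine PolyComp.input (((hf.input_bdd.reindex fun z : {z : I × β // z.2 ∈ (f z.1).support} =>
    z.1.1).add (PolyBdd.add ⟨q, fun z => hq z.1.1 z.1.2 z.2⟩ (.const 1))).mono fun z => ?_)
  exact (add_assoc _ _ _).le

theorem enc_bool_eq_nil {b : Bool} : Enc.enc b = Data.nil ↔ b = false := by
  cases b
  · exact ⟨fun _ => rfl, fun _ => rfl⟩
  · exact ⟨fun h => (nomatch h), fun h => (nomatch h)⟩

theorem enc_bool_ne_nil {b : Bool} : Enc.enc b ≠ Data.nil ↔ b = true := by
  rw [Ne, enc_bool_eq_nil, Bool.not_eq_false]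

theorem PolyComp.ite {c : I → Bool} {f g : I → β} (hc : PolyComp sz x c)
    (hf : PolyComp sz x f) (hg : PolyComp sz x g) :
    PolyComp sz x fun i => if c i then f i else g i := by
  refine PolySamp.cond hc ?_ ?_
  · refine (hg.reindex fun i : {i // Enc.enc (c i) = Data.nil} => i.1).congr ?_
    rintro ⟨i, hi⟩
    simp [enc_bool_eq_nil.1 hi]
  · refine (hf.reindex fun i : {i // Enc.enc (c i) ≠ Data.nil} => i.1).congr ?_
    rintro ⟨i, hi⟩
    simp [enc_bool_ne_nil.1 hi]

/-! ### Loops -/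

/-- Process a list by a randomized step. -/
noncomputable def foldP {σ β : Type} (step : σ → β → PMF σ) : σ → List β → PMF σ
  | s, [] => PMF.pure s
  | s, b :: l => (step s b).bind fun s' => foldP step s' l

/-- The loop body that processes the next list entry. -/
noncomputable def popStep {γ σ β : Type} (step : σ → β → PMF σ) :
    γ × List β × σ → PMF (γ × List β × σ)
  | (c, [], s) => PMF.pure (c, [], s)
  | (c, b :: l, s) => (step s b).map fun s' => (c, l, s')

/-- A loop with as many rounds as the list has entries, removing one entry per round, is a fold over
the list. -/
theorem iterP_popStep {γ σ β : Type} (step : σ → β → PMF σ) (c : γ) (l : List β) :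
    ∀ s, iterP (popStep step) l.length (c, l, s) = (foldP step s l).map fun s' => (c, [], s') := by
  induction l with
  | nil => intro s; simp [iterP, foldP, PMF.pure_map]
  | cons b l ih =>
    intro s
    rw [List.length_cons, iterP, popStep, PMF.bind_map, foldP, PMF.map_bind]
    exact congrArg _ (funext fun s' => ih s')

/-- The bound for the step refers to `sz` of the original index and not to the size of the current
state. So it holds uniformly over all rounds, and running times are added rather than composed. The
invariant, indexed by the prefix already processed, is what makes such a uniform bound available;
`c` carries data that the step needs but does not change. -/
theorem PolySamp.fold {l : I → List β} {c : I → γ} {s₀ : I → σ} {step : I → σ → β → PMF σ}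
    (hl : PolyComp sz x l) (hc : PolyComp sz x c) (hs : PolyComp sz x s₀)
    (Inv : I → List β → σ → Prop) (h0 : ∀ i, Inv i [] (s₀ i))
    (hInv : ∀ i pre b post s, l i = pre ++ b :: post → Inv i pre s →
      ∀ s' ∈ (step i s b).support, Inv i (pre ++ [b]) s')
    (hP : PolySamp (fun z : {z : I × List β × β × List β × σ //
        l z.1 = z.2.1 ++ z.2.2.1 :: z.2.2.2.1 ∧ Inv z.1 z.2.1 z.2.2.2.2} => sz z.1.1)
      (fun z => (c z.1.1, z.1.2.2.2.2, z.1.2.2.1)) fun z => step z.1.1 z.1.2.2.2.2 z.1.2.2.1) :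
    PolySamp sz x fun i => foldP (step i) (s₀ i) (l i) := by
  let Z := {z : I × List β × β × List β × σ //
        l z.1 = z.2.1 ++ z.2.2.1 :: z.2.2.2.1 ∧ Inv z.1 z.2.1 z.2.2.2.2}
  have hbody : PolySamp (fun z : Z => sz z.1.1)
      (fun z => (c z.1.1, z.1.2.2.1 :: z.1.2.2.2.1, z.1.2.2.2.2))
      fun z => popStep (step z.1.1) (c z.1.1, z.1.2.2.1 :: z.1.2.2.2.1, z.1.2.2.2.2) := by
    have hin : PolyComp (fun z : Z => sz z.1.1)
        (fun z : Z => (c z.1.1, z.1.2.2.1 :: z.1.2.2.2.1, z.1.2.2.2.2))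
        (fun z => (c z.1.1, z.1.2.2.1 :: z.1.2.2.2.1, z.1.2.2.2.2)) := by
      refine .input ?_
      have h1 := hP.input_bdd
      have h2 := hl.bdd.reindex fun z : Z => z.1.1
      refine (h1.add h2).mono fun z => ?_
      have h3 := encSize_append z.1.2.1 (z.1.2.2.1 :: z.1.2.2.2.1)
      rw [← z.2.1] at h3
      have h4 := encSize_pos z.1.2.1
      simp only [encSize_pair]
      omega
    have h1 := PolySamp.comp hP
      (hin.fst.pair (hin.snd.snd.pair (hin.snd.fst.head fun z => ⟨_, rfl⟩)))
    refine (PolySamp.bind (g := fun z s' => PMF.pure (c z.1.1, z.1.2.2.2.1, s')) h1 ?_).congr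
      fun z => rfl
    obtain ⟨q, hq⟩ := hP.output_bdd
    let Z' := {z : Z × σ // z.2 ∈ (step z.1.1.1 z.1.1.2.2.2.2 z.1.1.2.2.1).support}
    have hin' : PolyComp (fun z : Z' => sz z.1.1.1.1) (fun z => ((c z.1.1.1.1,
      z.1.1.1.2.2.1 :: z.1.1.1.2.2.2.1, z.1.1.1.2.2.2.2), z.1.2)) _ := PolyComp.input <| by
        refine (((hin.bdd.reindex fun z : Z' => z.1.1).add
          ⟨q, fun z : Z' => hq z.1.1 z.1.2 z.2⟩).add (.const 1)).mono fun z => ?_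
        exact le_rfl
    exact hin'.fst.fst.pair (hin'.fst.snd.fst.tail.pair hin'.snd)
  obtain ⟨P, p, hP'⟩ := hbody
  -- The list enters twice: one copy only counts the rounds, the other one is consumed.
  have hin := hl.pair (hc.pair (hl.pair hs))
  have hloop : PolySamp sz (fun i => (l i, c i, l i, s₀ i))
      fun i => (foldP (step i) (s₀ i) (l i)).map fun s' => (c i, ([] : List β), s') := by
    refine of_bdd (.loop P) ((hin.bdd.mul ((PolyBdd.self.eval p).add (.const 2))).add (.const 1))
      fun i => ?_
    -- After `k` rounds the processed prefix has length `k`, so an entry is left as long as `k` is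
    -- below the length of the list.
    have := Runs.loop (P := P) (e := Enc.enc) (step := popStep (step i)) (t := p.eval (sz i))
      (n := Enc.enc (l i)) (s := (c i, l i, s₀ i))
      (fun k z => z.1 = c i ∧ ∃ pre, l i = pre ++ z.2.1 ∧ pre.length = k ∧ Inv i pre z.2.2) ?_
      ⟨rfl, [], rfl, rfl, h0 i⟩
    · rwa [enc_list_len, iterP_popStep] at this
    · rintro k ⟨c', r, s⟩ hk ⟨h1, pre, h2, h3, h4⟩
      simp only at h1 h2 h3 h4
      subst h1
      rw [enc_list_len] at hk
      cases r with
      | nil => rw [h2] at hk; simp at hk; omega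
      | cons b r =>
        refine ⟨hP' ⟨(i, pre, b, r, s), h2, h4⟩, ?_⟩
        intro z' hz'
        simp only [popStep, PMF.mem_support_map_iff] at hz'
        obtain ⟨s', hs', rfl⟩ := hz'
        exact ⟨rfl, pre ++ [b], by simpa using h2, by simp [h3], hInv i pre b r s h2 h4 s' hs'⟩
  have := (PolySamp.comp hloop hin).map (h := fun z : γ × List β × σ => z.2.2)
    (PolyComp.input .self).snd.snd
  refine this.congr fun i => ?_
  rw [PMF.map_comp]
  exact PMF.map_id _

theorem foldP_pure {σ β : Type} (step : σ → β → σ) (s : σ) (l : List β) :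
    foldP (fun s b => PMF.pure (step s b)) s l = PMF.pure (l.foldl step s) := by
  induction l generalizing s with
  | nil => rfl
  | cons b l ih => rw [foldP, PMF.pure_bind, ih]; rfl

/-- A loop over a list whose state grows by a bounded amount in every step. -/
theorem PolyComp.foldl {l : I → List β} {c : I → γ} {s₀ : I → σ} {step : γ → σ → β → σ}
    (hl : PolyComp sz x l) (hc : PolyComp sz x c) (hs : PolyComp sz x s₀)
    (hstep : PolyFun fun z : γ × σ × β => step z.1 z.2.1 z.2.2) (q : Polynomial ℕ)
    (hq : ∀ c s b, encSize (step c s b) ≤ encSize s + q.eval (encSize c + encSize b)) :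
    PolyComp sz x fun i => (l i).foldl (step (c i)) (s₀ i) := by
  -- Growth is additive: after a prefix the state exceeds the initial one by at most the length of
  -- the prefix times the largest increment.
  refine (PolySamp.fold (step := fun i s b => PMF.pure (step (c i) s b)) hl hc hs
    (fun i pre s => encSize s ≤ encSize (s₀ i) +
      pre.length * q.eval (encSize (c i) + encSize (l i))) ?_ ?_ ?_).congr fun i => foldP_pure _ _ _
  · intro i; simp
  · intro i pre b post s h1 h2 s' hs'
    obtain rfl := (PMF.mem_support_pure_iff _ _).1 hs'
    have h3 := hq (c i) s b
    have h4 : encSize b < encSize (l i) := encSize_mem (by rw [h1]; simp)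
    have h5 := q.eval_nat_mono (Nat.add_le_add_left h4.le (encSize (c i)))
    rw [List.length_append, List.length_singleton, add_mul, one_mul]
    omega
  · refine (PolySamp.reindex hstep _).resize ?_
    set Z := {z : I × List β × β × List β × σ // l z.1 = z.2.1 ++ z.2.2.1 :: z.2.2.2.1 ∧
      encSize z.2.2.2.2 ≤ encSize (s₀ z.1) +
      z.2.1.length * q.eval (encSize (c z.1) + encSize (l z.1))} with hZ
    have B : PolyBdd sz fun i => encSize (c i) + (encSize (s₀ i) + encSize (l i) *
      q.eval (encSize (c i) + encSize (l i)) + encSize (l i) + 1) + 1 :=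
      (hc.bdd.add (((hs.bdd.add (hl.bdd.mul ((hc.bdd.add hl.bdd).eval q))).add hl.bdd).add
        (.const 1))).add (.const 1)
    refine (B.reindex fun z : Z => z.1.1).mono ?_
    rintro ⟨⟨i, pre, b, post, s⟩, h1, h2⟩
    simp only at h1 h2 ⊢
    have h4 : encSize b < encSize (l i) := encSize_mem (by rw [h1]; simp)
    have h5 : pre.length ≤ encSize (l i) := by
      have := length_lt_encSize (l i)
      rw [h1] at this ⊢
      simp at this
      omega
    have h6 := Nat.mul_le_mul_right (q.eval (encSize (c i) + encSize (l i))) h5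
    simp only [encSize_pair]
    omega

end

section

variable {I J : Type} {sz sz' : I → ℕ} {α β γ δ σ : Type} [Enc α] [Enc β] [Enc γ] [Enc δ] [Enc σ]
  {x : I → α}

/-! ### Case distinctions on structured data -/

/-- Once the constructor is known, its arguments are a subtree of the encoding. The indices `K`
record an index together with these arguments, and a program that treats all of `K` treats all of
`I`, because every index is covered by one whose payload has the computed encoding. -/
theorem PolySamp.ofPayload {K : Type} {f : I → PMF β} {D : I → Data} (hx : PolyComp sz x D)
    (π : K → I) (pay : K → γ) (h : ∀ i, ∃ k, π k = i ∧ Enc.enc (pay k) = D i)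
    (hK : PolySamp (fun k => sz (π k)) (fun k => (x (π k), pay k)) fun k => f (π k)) :
    PolySamp sz x f := by
  obtain ⟨Q, q, hQ⟩ := hK
  refine PolySamp.comp (y := fun i => (x i, D i)) ⟨Q, q, fun i => ?_⟩
    ((PolyComp.input hx.input_bdd).pair hx)
  obtain ⟨k, rfl, hk⟩ := h i
  have := hQ k
  change Runs Q (Data.cons _ (Enc.enc (pay k))) _ _ at this
  rwa [hk] at this

theorem PolySamp.optionCases {o : I → Option β} {f : I → PMF δ} (ho : PolyComp sz x o)
    (h₁ : PolySamp (fun i : {i // o i = none} => sz i.1) (fun i => x i.1) fun i => f i.1)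
    (h₂ : PolySamp (fun z : {z : I × β // o z.1 = some z.2} => sz z.1.1)
      (fun z => (x z.1.1, z.1.2)) fun z => f z.1.1) : PolySamp sz x f := by
  refine PolySamp.cond ho ?_ ?_
  · refine h₁.reindex fun i : {i // Enc.enc (o i) = Data.nil} => ⟨i.1, ?_⟩
    obtain ⟨i, hi⟩ := i
    cases h : o i with
    | none => rfl
    | some b => rw [h] at hi; nomatch hi
  · have hD : PolyComp (fun i : {i // Enc.enc (o i) ≠ Data.nil} => sz i.1) (fun i => x i.1)
      fun i => (Enc.enc (o i.1)).right := (ho.reindex _).ofRight fun i => rfl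
    refine PolySamp.ofPayload (K := {z : I × β // o z.1 = some z.2}) hD
      (fun z => ⟨z.1.1, by rw [z.2]; exact fun h => nomatch h⟩) (fun z => z.1.2) ?_ h₂
    rintro ⟨i, hi⟩
    cases h : o i with
    | none => rw [h] at hi; exact absurd rfl hi
    | some b => exact ⟨⟨(i, b), h⟩, rfl, rfl⟩

theorem PolySamp.listCases {l : I → List β} {f : I → PMF δ} (hl : PolyComp sz x l)
    (h₁ : PolySamp (fun i : {i // l i = []} => sz i.1) (fun i => x i.1) fun i => f i.1)
    (h₂ : PolySamp (fun z : {z : I × β × List β // l z.1 = z.2.1 :: z.2.2} => sz z.1.1)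
      (fun z => (x z.1.1, z.1.2)) fun z => f z.1.1) : PolySamp sz x f := by
  refine PolySamp.cond hl ?_ ?_
  · refine h₁.reindex fun i : {i // Enc.enc (l i) = Data.nil} => ⟨i.1, ?_⟩
    obtain ⟨i, hi⟩ := i
    cases h : l i with
    | nil => rfl
    | cons b t => rw [h] at hi; nomatch hi
  · have hD : PolyComp (fun i : {i // Enc.enc (l i) ≠ Data.nil} => sz i.1) (fun i => x i.1)
      fun i => Enc.enc (l i.1) := (hl.reindex _).data
    refine PolySamp.ofPayload (K := {z : I × β × List β // l z.1 = z.2.1 :: z.2.2}) hD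
      (fun z => ⟨z.1.1, by rw [z.2]; exact fun h => nomatch h⟩) (fun z => z.1.2) ?_ h₂
    rintro ⟨i, hi⟩
    cases h : l i with
    | nil => rw [h] at hi; exact absurd rfl hi
    | cons b t => exact ⟨⟨(i, b, t), h⟩, rfl, rfl⟩

theorem PolySamp.opCases {o : I → Op} {f : I → PMF δ} (ho : PolyComp sz x o)
    (h₁ : PolySamp (fun z : {z : I × ℕ // o z.1 = .read z.2} => sz z.1.1)
      (fun z => (x z.1.1, z.1.2)) fun z => f z.1.1)
    (h₂ : PolySamp (fun z : {z : I × ℕ × Block // o z.1 = .write z.2.1 z.2.2} => sz z.1.1)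
      (fun z => (x z.1.1, z.1.2)) fun z => f z.1.1) : PolySamp sz x f := by
  -- The left subtree of the encoding is the tag: `nil` for a read, a nonempty tree for a write.
  refine PolySamp.cond (c := fun i => (Enc.enc (o i)).left) (ho.ofLeft fun i => rfl) ?_ ?_
  · have hD : PolyComp (fun i : {i // (Enc.enc (o i)).left = Data.nil} => sz i.1) (fun i => x i.1)
      fun i => (Enc.enc (o i.1)).right := (ho.reindex _).ofRight fun i => rfl
    refine PolySamp.ofPayload (K := {z : I × ℕ // o z.1 = .read z.2}) hD
      (fun z => ⟨z.1.1, by rw [z.2]; rfl⟩) (fun z => z.1.2) ?_ h₁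
    rintro ⟨i, hi⟩
    cases h : o i with
    | write a d => rw [h] at hi; nomatch hi
    | read a => exact ⟨⟨(i, a), h⟩, rfl, rfl⟩
  · have hD : PolyComp (fun i : {i // (Enc.enc (o i)).left ≠ Data.nil} => sz i.1) (fun i => x i.1)
      fun i => (Enc.enc (o i.1)).right := (ho.reindex _).ofRight fun i => rfl
    refine PolySamp.ofPayload (K := {z : I × ℕ × Block // o z.1 = .write z.2.1 z.2.2}) hD
      (fun z => ⟨z.1.1, by rw [z.2]; exact fun h => nomatch h⟩) (fun z => z.1.2) ?_ h₂
    rintro ⟨i, hi⟩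
    cases h : o i with
    | read a => rw [h] at hi; exact absurd rfl hi
    | write a d => exact ⟨⟨(i, a, d), h⟩, rfl, rfl⟩

theorem PolySamp.accessCases {o : I → Access} {f : I → PMF δ} (ho : PolyComp sz x o)
    (h₁ : PolySamp (fun z : {z : I × List Bool // o z.1 = .read z.2} => sz z.1.1)
      (fun z => (x z.1.1, z.1.2)) fun z => f z.1.1)
    (h₂ : PolySamp (fun z : {z : I × List Bool × Block // o z.1 = .write z.2.1 z.2.2} => sz z.1.1)
      (fun z => (x z.1.1, z.1.2)) fun z => f z.1.1) : PolySamp sz x f := by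
  refine PolySamp.cond (c := fun i => (Enc.enc (o i)).left) (ho.ofLeft fun i => rfl) ?_ ?_
  · have hD : PolyComp (fun i : {i // (Enc.enc (o i)).left = Data.nil} => sz i.1) (fun i => x i.1)
      fun i => (Enc.enc (o i.1)).right := (ho.reindex _).ofRight fun i => rfl
    refine PolySamp.ofPayload (K := {z : I × List Bool // o z.1 = .read z.2}) hD
      (fun z => ⟨z.1.1, by rw [z.2]; rfl⟩) (fun z => z.1.2) ?_ h₁
    rintro ⟨i, hi⟩
    cases h : o i with
    | write a d => rw [h] at hi; nomatch hi
    | read a => exact ⟨⟨(i, a), h⟩, rfl, rfl⟩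
  · have hD : PolyComp (fun i : {i // (Enc.enc (o i)).left ≠ Data.nil} => sz i.1) (fun i => x i.1)
      fun i => (Enc.enc (o i.1)).right := (ho.reindex _).ofRight fun i => rfl
    refine PolySamp.ofPayload (K := {z : I × List Bool × Block // o z.1 = .write z.2.1 z.2.2}) hD
      (fun z => ⟨z.1.1, by rw [z.2]; exact fun h => nomatch h⟩) (fun z => z.1.2) ?_ h₂
    rintro ⟨i, hi⟩
    cases h : o i with
    | read a => rw [h] at hi; exact absurd rfl hi
    | write a d => exact ⟨⟨(i, a, d), h⟩, rfl, rfl⟩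

namespace PolyComp

theorem someInput {o : I → Option β} (ho : PolyComp sz x o) :
    PolyComp (fun z : {z : I × β // o z.1 = Option.some z.2} => sz z.1.1)
      (fun z => (x z.1.1, z.1.2)) fun z => (x z.1.1, z.1.2) := by
  refine PolyComp.input (((ho.input_bdd.add ho.bdd).reindex
    (J := {z : I × β // o z.1 = Option.some z.2}) fun z => z.1.1).mono ?_)
  rintro ⟨⟨i, b⟩, h⟩
  simp only at h
  have h1 : encSize (Option.some b) = 1 + encSize b + 1 := rfl
  simp only [encSize_pair, h, h1]
  omega

theorem consInput {l : I → List β} (hl : PolyComp sz x l) :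
    PolyComp (fun z : {z : I × β × List β // l z.1 = z.2.1 :: z.2.2} => sz z.1.1)
      (fun z => (x z.1.1, z.1.2)) fun z => (x z.1.1, z.1.2) := by
  refine PolyComp.input ((((hl.input_bdd.add hl.bdd).add (.const 1)).reindex
    (J := {z : I × β × List β // l z.1 = z.2.1 :: z.2.2}) fun z => z.1.1).mono ?_)
  rintro ⟨⟨i, b, t⟩, h⟩
  simp only at h
  simp only [encSize_pair, h, encSize_cons]
  omega

theorem readInput {o : I → Op} (ho : PolyComp sz x o) :
    PolyComp (fun z : {z : I × ℕ // o z.1 = .read z.2} => sz z.1.1)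
      (fun z => (x z.1.1, z.1.2)) fun z => (x z.1.1, z.1.2) := by
  refine PolyComp.input (((ho.input_bdd.add ho.bdd).reindex
    (J := {z : I × ℕ // o z.1 = .read z.2}) fun z => z.1.1).mono ?_)
  rintro ⟨⟨i, b⟩, h⟩
  simp only at h
  have h1 : encSize (Op.read b) = 1 + encSize b + 1 := rfl
  simp only [encSize_pair, h, h1]
  omega

theorem writeInput {o : I → Op} (ho : PolyComp sz x o) :
    PolyComp (fun z : {z : I × ℕ × Block // o z.1 = .write z.2.1 z.2.2} => sz z.1.1)
      (fun z => (x z.1.1, z.1.2)) fun z => (x z.1.1, z.1.2) := by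
  refine PolyComp.input (((ho.input_bdd.add ho.bdd).reindex
    (J := {z : I × ℕ × Block // o z.1 = .write z.2.1 z.2.2}) fun z => z.1.1).mono ?_)
  rintro ⟨⟨i, b, d⟩, h⟩
  simp only at h
  have h1 : encSize (Op.write b d) = 3 + (encSize b + encSize d + 1) + 1 := rfl
  simp only [encSize_pair, h, h1]
  omega

theorem accessReadInput {o : I → Access} (ho : PolyComp sz x o) :
    PolyComp (fun z : {z : I × List Bool // o z.1 = .read z.2} => sz z.1.1)
      (fun z => (x z.1.1, z.1.2)) fun z => (x z.1.1, z.1.2) := by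
  refine PolyComp.input (((ho.input_bdd.add ho.bdd).reindex
    (J := {z : I × List Bool // o z.1 = .read z.2}) fun z => z.1.1).mono ?_)
  rintro ⟨⟨i, b⟩, h⟩
  simp only at h
  have h1 : encSize (Access.read b) = 1 + encSize b + 1 := rfl
  simp only [encSize_pair, h, h1]
  omega

theorem accessWriteInput {o : I → Access} (ho : PolyComp sz x o) :
    PolyComp (fun z : {z : I × List Bool × Block // o z.1 = .write z.2.1 z.2.2} => sz z.1.1)
      (fun z => (x z.1.1, z.1.2)) fun z => (x z.1.1, z.1.2) := by
  refine PolyComp.input (((ho.input_bdd.add ho.bdd).reindex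
    (J := {z : I × List Bool × Block // o z.1 = .write z.2.1 z.2.2}) fun z => z.1.1).mono ?_)
  rintro ⟨⟨i, b, d⟩, h⟩
  simp only at h
  have h1 : encSize (Access.write b d) = 3 + (encSize b + encSize d + 1) + 1 := rfl
  simp only [encSize_pair, h, h1]
  omega

end PolyComp

/-! ### List functions -/

namespace PolyComp

theorem nil (hx : PolyBdd sz fun i => encSize (x i)) : PolyComp sz x fun _ => ([] : List β) :=
  const hx []

theorem reverse {l : I → List β} (hl : PolyComp sz x l) : PolyComp sz x fun i => (l i).reverse := by
  have h := PolyComp.foldl (l := l) (c := fun _ => Data.nil) (s₀ := fun _ => ([] : List β))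
    (step := fun _ s b => b :: s) hl (.const hl.input_bdd _) (.nil hl.input_bdd)
    (PolyComp.cons (PolyComp.input .self).snd.snd (PolyComp.input .self).snd.fst)
    (Polynomial.X + 1) (fun c s b => by
      simp only [encSize_cons, Polynomial.eval_add, Polynomial.eval_X, Polynomial.eval_one]; omega)
  exact h.congr fun i => by simp

theorem append {l l' : I → List β} (hl : PolyComp sz x l) (hl' : PolyComp sz x l') :
    PolyComp sz x fun i => l i ++ l' i := by
  have h := PolyComp.foldl (l := fun i => (l i).reverse) (c := fun _ => Data.nil) (s₀ := l')
    (step := fun _ s b => b :: s) hl.reverse (.const hl.input_bdd _) hl'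
    (PolyComp.cons (PolyComp.input .self).snd.snd (PolyComp.input .self).snd.fst)
    (Polynomial.X + 1) (fun c s b => by
      simp only [encSize_cons, Polynomial.eval_add, Polynomial.eval_X, Polynomial.eval_one]; omega)
  exact h.congr fun i => by simp

theorem flatMap {l : I → List β} {c : I → γ} {f : γ → β → List δ} (hl : PolyComp sz x l)
    (hc : PolyComp sz x c) (hf : PolyFun fun z : γ × β => f z.1 z.2) :
    PolyComp sz x fun i => (l i).flatMap (f (c i)) := by
  obtain ⟨q, hq⟩ := PolyComp.bdd hf
  have hin : PolyComp encSize (fun z : γ × List δ × β => z) _ := PolyComp.input .self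
  have h := PolyComp.foldl (l := l) (c := c) (s₀ := fun _ => ([] : List δ))
    (step := fun c s b => s ++ f c b) hl hc (.nil hl.input_bdd)
    (hin.snd.fst.append (app hf (hin.fst.pair hin.snd.snd)))
    (q.comp (Polynomial.X + 1)) (fun c s b => by
      have h1 := encSize_append s (f c b)
      have h2 := hq (c, b)
      simp only [encSize_pair] at h2
      simp only [Polynomial.eval_comp, Polynomial.eval_add, Polynomial.eval_X, Polynomial.eval_one]
      omega)
  refine h.congr fun i => ?_
  have : ∀ (l : List β) (s : List δ), l.foldl (fun s b => s ++ f (c i) b) s =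
      s ++ l.flatMap (f (c i)) := by
    intro l
    induction l with
    | nil => simp
    | cons b l ih => intro s; simp [ih]
  simpa using this (l i) []

theorem listMap {l : I → List β} {c : I → γ} {f : γ → β → δ} (hl : PolyComp sz x l)
    (hc : PolyComp sz x c) (hf : PolyFun fun z : γ × β => f z.1 z.2) :
    PolyComp sz x fun i => (l i).map (f (c i)) := by
  refine (hl.flatMap (f := fun c b => [f c b]) hc ?_).congr fun i => ?_
  · exact PolyComp.cons hf (.nil .self)
  · generalize l i = l
    induction l <;> simp_all

theorem isEmpty {l : I → List β} (hl : PolyComp sz x l) : PolyComp sz x fun i => (l i).isEmpty := by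
  refine PolySamp.listCases hl ?_ ?_
  · exact (PolyComp.const (hl.input_bdd.reindex _) true).congr fun i => by simp [i.2]
  · exact (PolyComp.const hl.consInput.input_bdd false).congr fun z => by simp [z.2]

theorem headD {l : I → List β} {b : β} (hb : Enc.enc b = Data.nil) (hl : PolyComp sz x l) :
    PolyComp sz x fun i => (l i).headD b :=
  hl.ofLeft fun i => by cases l i <;> first | exact hb | rfl

theorem and {a b : I → Bool} (ha : PolyComp sz x a) (hb : PolyComp sz x b) :
    PolyComp sz x fun i => a i && b i :=
  (PolyComp.ite ha hb (.const ha.input_bdd false)).congr fun i => by cases a i <;> simp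

theorem not {a : I → Bool} (ha : PolyComp sz x a) : PolyComp sz x fun i => !a i :=
  (PolyComp.ite ha (.const ha.input_bdd false) (.const ha.input_bdd true)).congr
    fun i => by cases a i <;> simp

theorem beqBool {a b : I → Bool} (ha : PolyComp sz x a) (hb : PolyComp sz x b) :
    PolyComp sz x fun i => a i == b i :=
  (PolyComp.ite ha hb hb.not).congr fun i => by cases a i <;> cases b i <;> simp

end PolyComp

/-! ### Comparing bit strings -/

/-- Compare the next bit. -/
def eqStep (s : Bool × List Bool) (b : Bool) : Bool × List Bool :=
  ((s.1 && !s.2.isEmpty) && (s.2.headD false == b), s.2.tail)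

/-- Two strings agree if all bits compared agree, the second string never runs out, and nothing of
it is left at the end. -/
theorem foldl_eqStep (l : List Bool) : ∀ (ok : Bool) (r : List Bool),
    ((l.foldl eqStep (ok, r)).1 && (l.foldl eqStep (ok, r)).2.isEmpty) =
      (ok && decide (l = r)) := by
  induction l with
  | nil => intro ok r; cases r <;> simp
  | cons b l ih =>
    intro ok r
    rw [List.foldl_cons, eqStep, ih]
    cases r with
    | nil => simp
    | cons c r => by_cases h : l = r <;> cases ok <;> cases b <;> cases c <;> simp [h]

theorem PolyComp.decideEq {l l' : I → List Bool} (hl : PolyComp sz x l) (hl' : PolyComp sz x l') :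
    PolyComp sz x fun i => decide (l i = l' i) := by
  have hin : PolyComp encSize (fun z : Data × (Bool × List Bool) × Bool => z) _ := .input .self
  have h := PolyComp.foldl (l := l) (c := fun _ => Data.nil) (s₀ := fun i => (true, l' i))
    (step := fun _ => eqStep) hl (.const hl.input_bdd _) ((PolyComp.const hl.input_bdd _).pair hl')
    ((hin.snd.fst.fst.and hin.snd.fst.snd.isEmpty.not).and
      ((hin.snd.fst.snd.headD rfl).beqBool hin.snd.snd) |>.pair hin.snd.fst.snd.tail)
    (Polynomial.C 4) (fun c s b => by
      obtain ⟨ok, r⟩ := s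
      have h1 : ∀ b : Bool, encSize b ≤ 3 := by rintro (_ | _) <;> decide
      have h3 : encSize r.tail ≤ encSize r := by
        cases r
        · rfl
        · rw [encSize_cons, List.tail_cons]; omega
      have h4 := h1 (eqStep (ok, r) b).1
      change encSize (eqStep (ok, r) b).1 + encSize r.tail + 1 ≤ encSize ok + encSize r + 1 + _
      rw [Polynomial.eval_C]
      omega)
  exact (h.fst.and h.snd.isEmpty).congr fun i => by rw [foldl_eqStep]; simp

/-! ### Unary arithmetic -/

theorem enc_unary (n : ℕ) : Enc.enc (Unary.mk n) = Enc.enc (List.replicate n false) := rfl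

theorem PolyComp.replicate {n : I → ℕ} (hn : PolyComp sz x fun i => Unary.mk (n i)) :
    PolyComp sz x fun i => List.replicate (n i) false := hn.cast fun _ => rfl

/-- Addition of unary numbers is concatenation, and multiplication by `n` replaces every entry by a
list of length `n`. This provides the coercer with a counter for the rounds of the distinguisher. -/
theorem PolyComp.replicate_eval {n : I → ℕ} (hn : PolyComp sz x fun i => Unary.mk (n i))
    (r : Polynomial ℕ) : PolyComp sz x fun i => List.replicate (r.eval (n i)) false := by
  induction r using Polynomial.induction_on' with
  | add p q hp hq => exact (hp.append hq).congr fun i => by simp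
  | monomial k a =>
    induction k with
    | zero => exact (PolyComp.const hn.input_bdd (List.replicate a false)).congr fun i => by simp
    | succ k ih =>
      refine (ih.flatMap (f := fun c _ => c) hn.replicate (PolyComp.input .self).fst).congr
        fun i => ?_
      simp only [Polynomial.eval_monomial]
      rw [List.eq_replicate_iff]
      constructor
      · simp [pow_succ, mul_assoc]
      · simp

end

section

variable {I J : Type} {sz sz' : I → ℕ} {α β γ δ σ : Type} [Enc α] [Enc β] [Enc γ] [Enc δ] [Enc σ]
  {x : I → α}

/-! ### Devices and traces -/

/-- Look for the location to overwrite, copying the entries seen before. -/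
def putStep (k : List Bool × Block) (s : Bool × Device) (e : List Bool × Block) : Bool × Device :=
  if s.1 then (true, e :: s.2)
  else if decide (e.1 = k.1) then (true, k :: s.2) else (false, e :: s.2)

theorem foldl_putStep_true (k : List Bool × Block) (dev : Device) : ∀ acc : Device,
    dev.foldl (putStep k) (true, acc) = (true, dev.reverse ++ acc) := by
  induction dev with
  | nil => intro acc; rfl
  | cons e dev ih => intro acc; rw [List.foldl_cons, putStep, if_pos rfl, ih]; simp

/-- The flag tells whether the location has been found; if it is still unset at the end, the new
entry has to be appended. The copy is collected in reverse order. -/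
theorem foldl_putStep_false (k : List Bool × Block) (dev : Device) : ∀ acc : Device,
    (if (dev.foldl (putStep k) (false, acc)).1 then (dev.foldl (putStep k) (false, acc)).2.reverse
      else (k :: (dev.foldl (putStep k) (false, acc)).2).reverse) =
      acc.reverse ++ Device.put k.1 k.2 dev := by
  induction dev with
  | nil => intro acc; simp [Device.put]
  | cons e dev ih =>
    intro acc
    rw [List.foldl_cons]
    by_cases h : e.1 = k.1
    · rw [show putStep k (false, acc) e = (true, k :: acc) by simp [putStep, h],
        foldl_putStep_true]
      simp [Device.put, h]
    · rw [show putStep k (false, acc) e = (false, e :: acc) by simp [putStep, h], ih]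
      simp [Device.put, h]

theorem encSize_bool_le (b : Bool) : encSize b ≤ 3 := by cases b <;> decide

theorem PolyComp.put {l : I → List Bool} {d : I → Block} {dev : I → Device}
    (hl : PolyComp sz x l) (hd : PolyComp sz x d) (hdev : PolyComp sz x dev) :
    PolyComp sz x fun i => Device.put (l i) (d i) (dev i) := by
  have hx := hl.input_bdd
  have hk := hl.pair hd
  have h := PolyComp.foldl (c := fun i => (l i, d i)) (s₀ := fun _ => (false, ([] : Device)))
    (step := putStep) hdev hk (.const hx _) (by
      have hin : PolyComp encSize
        (fun z : (List Bool × Block) × (Bool × Device) × (List Bool × Block) => z) _ := .input .self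
      refine PolyComp.ite hin.snd.fst.fst
        ((PolyComp.const .self true).pair (hin.snd.snd.cons hin.snd.fst.snd)) ?_
      exact PolyComp.ite (hin.snd.snd.fst.decideEq hin.fst.fst)
        ((PolyComp.const .self true).pair (hin.fst.cons hin.snd.fst.snd))
        ((PolyComp.const .self false).pair (hin.snd.snd.cons hin.snd.fst.snd)))
    (Polynomial.X + 5) (fun c s b => by
      obtain ⟨f, dev⟩ := s
      simp only [Polynomial.eval_add, Polynomial.eval_X, Polynomial.eval_ofNat, putStep]
      have h1 := encSize_bool_le true
      have h2 := encSize_bool_le false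
      split_ifs <;> simp only [encSize_pair, encSize_cons] <;> omega)
  exact (PolyComp.ite h.fst h.snd.reverse (hk.cons h.snd).reverse).congr fun i =>
    foldl_putStep_false (l i, d i) (dev i) []

theorem encSize_put_le (l : List Bool) (d : Block) (dev : Device) :
    encSize (Device.put l d dev) ≤ encSize dev + (encSize l + encSize d + 2) := by
  induction dev with
  | nil => simp only [Device.put, encSize_cons, encSize_nil, encSize_pair]; omega
  | cons e dev ih =>
    rw [Device.put]
    split_ifs
    · simp only [encSize_cons, encSize_pair]; omega
    · simp only [encSize_cons]; omega

theorem encSize_perform_le (dev : Device) (a : Access) :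
    encSize (dev.perform a) ≤ encSize dev + encSize a := by
  cases a with
  | read l => exact Nat.le_add_right _ _
  | write l d =>
    have := encSize_put_le l d dev
    have h : encSize (Access.write l d) = 3 + (encSize l + encSize d + 1) + 1 := rfl
    rw [h, Device.perform]
    omega

theorem encSize_exec_le (t : Trace) : ∀ dev : Device,
    encSize (dev.exec t) ≤ encSize dev + encSize t := by
  induction t with
  | nil => intro dev; exact Nat.le_add_right _ _
  | cons a t ih =>
    intro dev
    have h1 := ih (dev.perform a)
    have h2 := encSize_perform_le dev a
    rw [encSize_cons]
    change encSize ((dev.perform a).exec t) ≤ _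
    omega

theorem PolyFun.perform : PolyFun fun z : Device × Access => z.1.perform z.2 := by
  have hin : PolyComp encSize (fun z : Device × Access => z) _ := .input .self
  refine PolySamp.accessCases hin.snd ?_ ?_
  · exact (hin.snd.accessReadInput.fst.fst).congr fun z => by beta_reduce; rw [z.2]; rfl
  · have h := hin.snd.accessWriteInput
    exact (h.snd.fst.put h.snd.snd h.fst.fst).congr fun z => by beta_reduce; rw [z.2]; rfl

theorem PolyComp.devExec {dev : I → Device} {t : I → Trace} (hdev : PolyComp sz x dev)
    (ht : PolyComp sz x t) : PolyComp sz x fun i => (dev i).exec (t i) := by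
  have hin : PolyComp encSize (fun z : Data × Device × Access => z) _ := .input .self
  exact PolyComp.foldl (c := fun _ => Data.nil) (step := fun _ => Device.perform) ht
    (.const ht.input_bdd _) hdev (PolyComp.app PolyFun.perform hin.snd) Polynomial.X (fun c s b =>
        by
      rw [Polynomial.eval_X]
      have := encSize_perform_le s b
      omega)

theorem PolyComp.accessIsWrite {a : I → Access} (h : PolyComp sz x a) :
    PolyComp sz x fun i => (a i).isWrite := h.ofLeft fun i => by cases a i <;> rfl

theorem PolyComp.opIsWrite {a : I → Op} (h : PolyComp sz x a) :
    PolyComp sz x fun i => (a i).isWrite := h.ofLeft fun i => by cases a i <;> rfl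

theorem PolyComp.wOnly {t : I → Trace} (ht : PolyComp sz x t) :
    PolyComp sz x fun i => wOnly (t i) := by
  have hin : PolyComp encSize (fun z : Data × Access => z) _ := .input .self
  refine (ht.flatMap (f := fun (_ : Data) (a : Access) => if a.isWrite then [a] else []) (c := fun
      _ => Data.nil)
    (.const ht.input_bdd _) (PolyComp.ite hin.snd.accessIsWrite (hin.snd.cons (.nil .self))
      (.nil .self))).congr fun i => ?_
  rw [_root_.wOnly]
  generalize t i = l
  induction l with
  | nil => rfl
  | cons a l ih => rw [List.flatMap_cons, ih, List.filter_cons]; split_ifs <;> simp_all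

/-- Move an operation to one of the two halves of the device. -/
def tagAccess (b : Bool) : Access → Access
  | .read l => .read (b :: l)
  | .write l d => .write (b :: l) d

theorem PolyComp.tag (b : Bool) {t : I → Trace} (ht : PolyComp sz x t) :
    PolyComp sz x fun i => Hive.tag b (t i) := by
  have hin : PolyComp encSize (fun z : Data × Access => z) _ := .input .self
  refine PolyComp.congr (ht.listMap (c := fun _ => Data.nil)
    (f := fun (_ : Data) (a : Access) => tagAccess b a) (.const ht.input_bdd _) ?_) fun _ => rfl
  refine PolySamp.accessCases hin.snd ?_ ?_
  · have h := hin.snd.accessReadInput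
    refine PolyComp.congr (f := fun z => Access.read (b :: z.1.2)) ?_
      fun z => by beta_reduce; rw [z.2]; rfl
    exact (PolyComp.const h.input_bdd Data.nil).ofCons
      ((PolyComp.const h.input_bdd b).cons h.snd) fun _ => rfl
  · have h := hin.snd.accessWriteInput
    refine PolyComp.congr (f := fun z => Access.write (b :: z.1.2.1) z.1.2.2) ?_
      fun z => by beta_reduce; rw [z.2]; rfl
    exact (PolyComp.const h.input_bdd true).ofCons
      (((PolyComp.const h.input_bdd b).cons h.snd.fst).pair h.snd.snd) fun _ => rfl

theorem PolyComp.half (b : Bool) {dev : I → Device} (hdev : PolyComp sz x dev) :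
    PolyComp sz x fun i => Hive.half b (dev i) := by
  have hin : PolyComp encSize (fun z : Data × List Bool × Block => z) _ := .input .self
  refine (hdev.flatMap (c := fun _ => Data.nil) (f := fun _ e => if (!e.1.isEmpty) &&
    (e.1.headD false == b) then [(e.1.tail, e.2)] else []) (.const hdev.input_bdd _)
    (PolyComp.ite (hin.snd.fst.isEmpty.not.and
      ((hin.snd.fst.headD rfl).beqBool (.const .self b)))
      ((hin.snd.fst.tail.pair hin.snd.snd).cons (.nil .self)) (.nil .self))).congr fun i => ?_
  rw [Hive.half]
  generalize dev i = l
  induction l with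
  | nil => rfl
  | cons e l ih =>
    obtain ⟨loc, d⟩ := e
    rw [List.flatMap_cons, ih]
    cases loc with
    | nil => simp
    | cons c loc => by_cases h : c = b <;> simp [h]

/-! ### Patterns -/

theorem PolyComp.slotsOf (v : Volume) {pat : I → Pattern} (h : PolyComp sz x pat) :
    PolyComp sz x fun i => slotsOf v (pat i) := by
  have hin : PolyComp encSize (fun z : Data × Request => z) _ := .input .self
  have hvol : PolyComp encSize (fun z : Data × Request => z) fun z => decide (z.2.vol = v) := by
    have hh : PolyComp encSize (fun z : Data × Request => z) fun z => decide (z.2.vol = .hid) :=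
      hin.snd.ofLeft fun z => by
        change _ = Enc.enc z.2.vol
        cases z.2.vol <;> rfl
    cases v with
    | hid => exact hh
    | pub => exact hh.not.congr fun z => by cases z.2.vol <;> rfl
  have hop : PolyComp encSize (fun z : Data × Request => z) fun z => z.2.op :=
    hin.snd.ofRight fun z => rfl
  refine (h.flatMap (c := fun _ => Data.nil) (f := fun _ r => if decide (r.vol = v) then [r.op]
    else []) (.const h.input_bdd _) (PolyComp.ite hvol (hop.cons (.nil .self))
      (.nil .self))).congr fun i => ?_
  rw [_root_.slotsOf]
  generalize pat i = l
  induction l with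
  | nil => rfl
  | cons a l ih => rw [List.flatMap_cons, ih, List.filter_cons]; split_ifs <;> simp_all

theorem PolyFun.toList : PolyFun fun o : Option β => o.toList := by
  have hin : PolyComp encSize (fun z : Option β => z) _ := .input .self
  refine PolySamp.optionCases hin ?_ ?_
  · exact (PolyComp.nil (hin.input_bdd.reindex _)).congr fun z => by beta_reduce; rw [z.2]; rfl
  · exact (hin.someInput.snd.cons (.nil hin.someInput.input_bdd)).congr fun z => by
      beta_reduce; rw [z.2]; rfl

theorem PolyComp.opsOf (v : Volume) {pat : I → Pattern} (h : PolyComp sz x pat) :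
    PolyComp sz x fun i => opsOf v (pat i) := by
  have hin : PolyComp encSize (fun z : Data × Option Op => z) _ := .input .self
  refine ((h.slotsOf v).flatMap (c := fun _ => Data.nil) (f := fun (_ : Data) (o : Option Op) =>
      o.toList)
    (.const h.input_bdd _) (PolyComp.app PolyFun.toList hin.snd)).congr fun i => ?_
  rw [_root_.opsOf]
  generalize _root_.slotsOf v (pat i) = l
  induction l with
  | nil => rfl
  | cons a l ih => rw [List.flatMap_cons, ih]; cases a <;> simp

theorem PolyComp.opRead {a : I → ℕ} (h : PolyComp sz x a) : PolyComp sz x fun i => Op.read (a i) :=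
  (PolyComp.const h.input_bdd Data.nil).ofCons h fun _ => rfl

theorem PolyComp.opWrite {a : I → ℕ} {d : I → Block} (h : PolyComp sz x a) (hd : PolyComp sz x d) :
    PolyComp sz x fun i => Op.write (a i) (d i) :=
  (PolyComp.const h.input_bdd true).ofCons (h.pair hd) fun _ => rfl

/-- Addresses are encoded with the lowest bit first, so the new address arises by putting a `true`
in front. -/
theorem PolyComp.odd {a : I → ℕ} (h : PolyComp sz x a) : PolyComp sz x fun i => 2 * a i + 1 :=
  (PolyComp.const h.input_bdd true).ofCons h fun i => by
    change Enc.enc (Nat.bits _) = _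
    rw [Nat.bit1_bits]
    rfl

theorem PolyComp.isSome {o : I → Option β} (h : PolyComp sz x o) :
    PolyComp sz x fun i => (o i).isSome := by
  refine PolySamp.optionCases h ?_ ?_
  · exact (PolyComp.const (h.input_bdd.reindex _) false).congr fun z => by
      beta_reduce; rw [z.2]; rfl
  · exact (PolyComp.const h.someInput.input_bdd true).congr fun z => by beta_reduce; rw [z.2]; rfl

theorem PolyComp.dummyAccess {len : I → ℕ} {p : I → Option Op}
    (hlen : PolyComp sz x fun i => Unary.mk (len i)) (hp : PolyComp sz x p) :
    PolyComp sz x fun i => Hive.dummyAccess (len i) (p i) :=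
  PolyComp.ite hp.isSome
    (((PolyComp.const hp.input_bdd 0).opWrite hlen.replicate).cons (.nil hp.input_bdd))
    (.nil hp.input_bdd)

theorem PolyComp.slot {len : I → ℕ} {p h : I → Option Op}
    (hlen : PolyComp sz x fun i => Unary.mk (len i)) (hp : PolyComp sz x p)
    (hh : PolyComp sz x h) : PolyComp sz x fun i => Hive.slot (len i) (p i) (h i) := by
  have hd := hlen.dummyAccess hp
  refine PolySamp.optionCases hh ?_ ?_
  · exact (hd.reindex _).congr fun z => by beta_reduce; rw [z.2]; rfl
  · have hin := hh.someInput
    have hd' := hin.fst.andThen (hd.reindex _)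
    refine PolySamp.opCases hin.snd ?_ ?_
    · have hin' := hin.snd.readInput
      refine (hin'.snd.odd.opRead.cons (hin'.fst.andThen (hd'.reindex _))).congr fun z => ?_
      beta_reduce
      rw [z.1.1.2, show z.1.1.1.2 = _ from z.2]; rfl
    · have hin' := hin.snd.writeInput
      refine ((hin'.snd.fst.odd.opWrite hin'.snd.snd).cons (.nil hin'.input_bdd)).congr fun z => ?_
      beta_reduce
      rw [z.1.1.2, show z.1.1.1.2 = _ from z.2]; rfl

/-- Pair up the entries of two lists of slots, padding with dummies. -/
def zipSlots : List (Option Op) → List (Option Op) → List (Option Op × Option Op)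
  | [], [] => []
  | [], h :: hs => (none, h) :: zipSlots [] hs
  | p :: ps, [] => (p, none) :: zipSlots ps []
  | p :: ps, h :: hs => (p, h) :: zipSlots ps hs

theorem schedule_eq_flatMap (len : ℕ) (ps hs : List (Option Op)) :
    Hive.schedule len ps hs = (zipSlots ps hs).flatMap fun z => Hive.slot len z.1 z.2 := by
  fun_induction zipSlots ps hs <;> simp_all [Hive.schedule]

/-- Pair the next entry with the head of the other list. -/
def zipStep (s : List (Option Op) × List (Option Op × Option Op)) (p : Option Op) :
    List (Option Op) × List (Option Op × Option Op) := (s.1.tail, (p, s.1.headD none) :: s.2)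

theorem zipSlots_nil (hs : List (Option Op)) : zipSlots [] hs = hs.map fun h => (none, h) := by
  induction hs with
  | nil => rw [zipSlots]; rfl
  | cons h hs ih => rw [zipSlots, ih]; rfl

/-- If the hidden list runs out, the default of `headD` plays the dummy partner; hidden slots that
remain after the public ones are paired with dummies separately. -/
theorem foldl_zipStep (ps : List (Option Op)) :
    ∀ (hs : List (Option Op)) (acc : List (Option Op × Option Op)),
    (ps.foldl zipStep (hs, acc)).2.reverse ++ (ps.foldl zipStep (hs, acc)).1.map (fun h => (none,
        h))
      = acc.reverse ++ zipSlots ps hs := by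
  induction ps with
  | nil => intro hs acc; rw [zipSlots_nil]; rfl
  | cons p ps ih =>
    intro hs acc
    rw [List.foldl_cons, zipStep, ih]
    cases hs <;> simp [zipSlots]

theorem PolyComp.schedule {len : I → ℕ} {ps hs : I → List (Option Op)}
    (hlen : PolyComp sz x fun i => Unary.mk (len i)) (hp : PolyComp sz x ps)
    (hh : PolyComp sz x hs) : PolyComp sz x fun i => Hive.schedule (len i) (ps i) (hs i) := by
  have hx := hp.input_bdd
  have hzip : PolyComp sz x fun i => zipSlots (ps i) (hs i) := by
    have hin : PolyComp encSize
      (fun z : Data × (List (Option Op) × List (Option Op × Option Op)) × Option Op => z) _ :=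
        .input .self
    have h := PolyComp.foldl (c := fun _ => Data.nil) (step := fun _ => zipStep)
      (s₀ := fun i => (hs i, [])) hp (.const hx _) (hh.pair (.nil hx))
      (hin.snd.fst.fst.tail.pair
        ((hin.snd.snd.pair (hin.snd.fst.fst.headD rfl)).cons hin.snd.fst.snd))
      (Polynomial.X + 3) (fun c s b => by
        obtain ⟨hs, acc⟩ := s
        simp only [Polynomial.eval_add, Polynomial.eval_X, Polynomial.eval_ofNat, zipStep,
          encSize_pair, encSize_cons]
        have : encSize hs.tail + encSize (hs.headD none) ≤ encSize hs + 1 := by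
          cases hs
          · exact le_rfl
          · simp only [List.tail_cons, List.headD_cons, encSize_cons]; omega
        omega)
    have hin' : PolyComp encSize (fun z : Data × Option Op => z) _ := .input .self
    refine (h.snd.reverse.append (h.fst.listMap (c := fun _ => Data.nil)
      (f := fun _ h => ((none : Option Op), h)) (.const hx _)
      ((PolyComp.const .self none).pair hin'.snd))).congr fun i => ?_
    exact foldl_zipStep _ _ []
  have hin : PolyComp encSize (fun z : List Bool × Option Op × Option Op => z) _ := .input .self
  -- The block length is passed to the loop body as the length of a list.
  refine (hzip.flatMap (c := fun i => List.replicate (len i) false)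
    (f := fun c z => Hive.slot c.length z.1 z.2) hlen.replicate ?_).congr fun i => ?_
  · exact PolyComp.slot (len := fun z : List Bool × Option Op × Option Op => z.1.length)
      ((hin.fst.listMap (f := fun _ _ => false) (.const .self Data.nil) (.const .self false)).cast
        fun z => by rw [enc_unary]; simp) hin.snd.fst hin.snd.snd
  · simp [schedule_eq_flatMap]

end

/-! ### Executing request sequences -/

theorem SamplableInPolyTime.polySamp {β : Type} [Enc β] {f : ℕ → PMF β}
    (h : SamplableInPolyTime f) : PolySamp (fun κ => κ) Unary.mk f := by
  obtain ⟨P, p, h⟩ := h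
  exact ⟨P, p, fun κ => h κ⟩

theorem PolySamp.samplable {β : Type} [Enc β] {f : ℕ → PMF β}
    (h : PolySamp (fun κ => κ) Unary.mk f) : SamplableInPolyTime f := by
  obtain ⟨P, p, h⟩ := h
  exact ⟨P, p, fun κ => h κ⟩

theorem ComputableInPolyTime.polyComp {β : Type} [Enc β] {f : ℕ → β}
    (h : ComputableInPolyTime f) : PolyComp (fun κ => κ) Unary.mk f :=
  SamplableInPolyTime.polySamp h

theorem PolyComp.computable {β : Type} [Enc β] {f : ℕ → β}
    (h : PolyComp (fun κ => κ) Unary.mk f) : ComputableInPolyTime f :=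
  PolySamp.samplable h

/-- Compute a function of the security parameter, which is available from the input. -/
theorem ComputableInPolyTime.at {I : Type} {sz : I → ℕ} {α β : Type} [Enc α] [Enc β] {x : I → α}
    {f : ℕ → β} (h : ComputableInPolyTime f) {κ : I → ℕ} (hκ : PolyComp sz x fun i => Unary.mk (κ
        i))
    (hs : PolyBdd sz κ) : PolyComp sz x fun i => f (κ i) :=
  hκ.andThen ((h.polyComp.reindex κ).resize hs)

theorem encSize_unary (n : ℕ) : encSize (Unary.mk n) = 2 * n + 1 := by
  induction n with
  | zero => rfl
  | succ n ih =>
    have : encSize (Unary.mk (n + 1)) = 1 + encSize (Unary.mk n) + 1 := rfl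
    omega

theorem Device.exec_append (dev : Device) (t t' : Trace) :
    dev.exec (t ++ t') = (dev.exec t).exec t' := List.foldl_append ..

/-- Reading does not modify the device. Hence whoever sees only the `Write`s of a trace can maintain
the device. -/
theorem exec_wOnly (t : Trace) : ∀ dev : Device, dev.exec (wOnly t) = dev.exec t := by
  induction t with
  | nil => intro dev; rfl
  | cons a t ih =>
    intro dev
    cases a with
    | read l => exact ih dev
    | write l d => exact ih _

theorem wOnly_append (t t' : Trace) : wOnly (t ++ t') = wOnly t ++ wOnly t' := List.filter_append ..

namespace ORAM

variable {Γ : ORAM} {κ : ℕ}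

theorem exec_append (s : Data) (dev : Device) (y y' : List Op) :
    Γ.exec κ s dev (y ++ y') = (Γ.exec κ s dev y).bind fun a =>
      (Γ.exec κ a.1 a.2.1 y').bind fun b =>
        PMF.pure (b.1, b.2.1, a.2.2.1 ++ b.2.2.1, a.2.2.2 ++ b.2.2.2) := by
  induction y generalizing s dev with
  | nil => simp [exec, PMF.pure_bind]
  | cons o y ih =>
    simp only [List.cons_append, exec, PMF.bind_bind, PMF.pure_bind, ih]
    congr 1
    funext a
    congr 1
    funext b
    congr 1
    funext c
    cases o.isWrite <;> simp

theorem dev_of_mem_exec {y : List Op} {s : Data} {dev : Device}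
    {a : Data × Device × Trace × List Block} (h : a ∈ (Γ.exec κ s dev y).support) :
    a.2.1 = dev.exec a.2.2.1 := by
  induction y generalizing s dev a with
  | nil =>
    simp only [exec, PMF.mem_support_pure_iff] at h
    subst h
    rfl
  | cons o y ih =>
    simp only [exec, PMF.mem_support_bind_iff, PMF.mem_support_pure_iff] at h
    obtain ⟨b, -, c, hc, rfl⟩ := h
    simp only [ih hc, Device.exec_append]

/-- The interface adds one answer per `Read`, whatever the access algorithm does; this is used to
cut lists of answers at the right places. -/
theorem length_of_mem_exec {y : List Op} {s : Data} {dev : Device}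
    {a : Data × Device × Trace × List Block} (h : a ∈ (Γ.exec κ s dev y).support) :
    a.2.2.2.length + writeCount y = y.length := by
  induction y generalizing s dev a with
  | nil =>
    simp only [exec, PMF.mem_support_pure_iff] at h
    subst h
    rfl
  | cons o y ih =>
    simp only [exec, PMF.mem_support_bind_iff, PMF.mem_support_pure_iff] at h
    obtain ⟨b, -, c, hc, rfl⟩ := h
    have := ih hc
    simp only [writeCount] at this
    cases h : o.isWrite
    · simp [writeCount, h, ← this]; ring
    · simp [writeCount, h, ← this]; ring

/-- The private state and the device can be reached by the request sequence `y`. -/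
def Reachable (Γ : ORAM) (κ : ℕ) (y : List Op) (s : Data) (dev : Device) : Prop :=
  ∃ ans, (s, dev, ans) ∈ (Γ.run κ y).support

theorem reachable_iff {y : List Op} {s : Data} {dev : Device} : Γ.Reachable κ y s dev ↔
    ∃ a ∈ (Γ.setup κ).support, ∃ b ∈ (Γ.exec κ a.1 (Device.exec [] a.2) y).support,
      s = b.1 ∧ dev = b.2.1 := by
  simp only [Reachable, run, PMF.mem_support_bind_iff, PMF.mem_support_pure_iff, Prod.mk.injEq]
  constructor
  · rintro ⟨ans, a, ha, b, hb, h1, h2, -⟩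
    exact ⟨a, ha, b, hb, h1, h2⟩
  · rintro ⟨a, ha, b, hb, h1, h2⟩
    exact ⟨_, a, ha, b, hb, h1, h2, rfl⟩

theorem reachable_nil {a : Data × Trace} (h : a ∈ (Γ.setup κ).support) :
    Γ.Reachable κ [] a.1 (Device.exec [] a.2) :=
  reachable_iff.2 ⟨a, h, (a.1, Device.exec [] a.2, [], []), by simp [exec], rfl, rfl⟩

theorem Reachable.exec {y y' : List Op} {s : Data} {dev : Device} (h : Γ.Reachable κ y s dev)
    {a : Data × Device × Trace × List Block} (ha : a ∈ (Γ.exec κ s dev y').support) :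
    Γ.Reachable κ (y ++ y') a.1 a.2.1 := by
  obtain ⟨i, hi, b, hb, rfl, rfl⟩ := reachable_iff.1 h
  refine reachable_iff.2
    ⟨i, hi, (a.1, a.2.1, b.2.2.1 ++ a.2.2.1, b.2.2.2 ++ a.2.2.2), ?_, rfl, rfl⟩
  rw [exec_append, PMF.mem_support_bind_iff]
  refine ⟨b, hb, ?_⟩
  rw [PMF.mem_support_bind_iff]
  exact ⟨a, ha, by simp⟩

theorem exec_singleton (s : Data) (dev : Device) (o : Op) : Γ.exec κ s dev [o] =
    (Γ.access κ s dev o).bind fun a =>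
      PMF.pure (a.1, dev.exec a.2.1, a.2.1, if o.isWrite then [] else [a.2.2]) := by
  simp [ORAM.exec, PMF.pure_bind]

theorem Reachable.access {y : List Op} {o : Op} {s : Data} {dev : Device}
    (h : Γ.Reachable κ y s dev) {a : Data × Trace × Block} (ha : a ∈ (Γ.access κ s dev o).support) :
    Γ.Reachable κ (y ++ [o]) a.1 (dev.exec a.2.1) := by
  refine h.exec (y' := [o]) (a := (a.1, dev.exec a.2.1, a.2.1, if o.isWrite then [] else [a.2.2]))
      ?_
  rw [exec_singleton, PMF.mem_support_bind_iff]
  exact ⟨a, ha, by simp⟩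

theorem Reachable.snoc_inv {y : List Op} {o : Op} {s : Data} {dev : Device}
    (h : Γ.Reachable κ (y ++ [o]) s dev) : ∃ s₀ dev₀, Γ.Reachable κ y s₀ dev₀ ∧
      ∃ a ∈ (Γ.access κ s₀ dev₀ o).support, s = a.1 ∧ dev = dev₀.exec a.2.1 := by
  obtain ⟨i, hi, b, hb, rfl, rfl⟩ := reachable_iff.1 h
  simp only [exec_append, exec_singleton, PMF.mem_support_bind_iff, PMF.mem_support_pure_iff] at hb
  obtain ⟨c, hc, d, ⟨e, he, rfl⟩, rfl⟩ := hb
  exact ⟨c.1, c.2.1, reachable_iff.2 ⟨i, hi, c, hc, rfl, rfl⟩, e, he, rfl, rfl⟩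

/-- The situations in which an access must be efficient. -/
def AccessIndex (Γ : ORAM) : Type :=
  {z : ℕ × List Op × Op × Data × Device //
    Γ.LegitSeq z.1 (z.2.1 ++ [z.2.2.1]) ∧ Γ.Reachable z.1 z.2.1 z.2.2.2.1 z.2.2.2.2}

theorem Efficient.access (h : Γ.Efficient) :
    PolySamp (fun z : Γ.AccessIndex => z.1.1 + encSize (z.1.2.1 ++ [z.1.2.2.1]))
      (fun z => (Unary.mk z.1.1, z.1.2.2.2.1, z.1.2.2.2.2, z.1.2.2.1))
      fun z => Γ.access z.1.1 z.1.2.2.2.1 z.1.2.2.2.2 z.1.2.2.1 := by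
  obtain ⟨-, -, -, P, p, h⟩ := h
  refine ⟨P, p, ?_⟩
  rintro ⟨⟨κ, y, o, s, dev⟩, hl, ans, hr⟩
  exact h κ y o hl _ hr

/-- No induction over the requests, which would compose polynomials: the state after the last access
is an output of a program whose time is polynomial in the total length of all requests, the device
before it is an input of that program, and the last trace adds at most its own length. -/
theorem Efficient.reachable_bdd (h : Γ.Efficient) : ∃ p : Polynomial ℕ, ∀ κ y s dev,
    Γ.LegitSeq κ y → Γ.Reachable κ y s dev → encSize s + encSize dev ≤ p.eval (κ + encSize y) := by
  obtain ⟨p, hp⟩ := h.2.2.1.polySamp.output_bdd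
  obtain ⟨q, hq⟩ := h.access.output_bdd
  obtain ⟨u, hu⟩ := h.access.input_bdd
  refine ⟨p + q + u + 1, fun κ y s dev hl hr => ?_⟩
  simp only [Polynomial.eval_add, Polynomial.eval_one]
  rcases List.eq_nil_or_concat y with rfl | ⟨y, o, rfl⟩
  · obtain ⟨a, ha, b, hb, rfl, rfl⟩ := reachable_iff.1 hr
    simp only [ORAM.exec, PMF.mem_support_pure_iff] at hb
    subst hb
    have h1 := hp κ a ha
    have h2 := encSize_exec_le a.2 []
    have h3 : encSize a = encSize a.1 + encSize a.2 + 1 := rfl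
    have h4 := p.eval_nat_mono (Nat.le_add_right κ (encSize ([] : List Op)))
    have h5 : encSize ([] : Device) = 1 := rfl
    simp only
    omega
  · rw [List.concat_eq_append] at *
    obtain ⟨s₀, dev₀, hr₀, a, ha, rfl, rfl⟩ := hr.snoc_inv
    have h1 := hq ⟨(κ, y, o, s₀, dev₀), hl, hr₀⟩ a ha
    have h2 := hu ⟨(κ, y, o, s₀, dev₀), hl, hr₀⟩
    have h3 := encSize_exec_le a.2.1 dev₀
    have h4 : encSize a = encSize a.1 + (encSize a.2.1 + encSize a.2.2 + 1) + 1 := rfl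
    simp only [encSize_pair] at h1 h2
    omega

/-- The situations in which the execution of a request sequence must be efficient. -/
def ExecIndex (Γ : ORAM) : Type :=
  {z : ℕ × List Op × List Op × Data × Device //
    Γ.LegitSeq z.1 (z.2.1 ++ z.2.2.1) ∧ Γ.Reachable z.1 z.2.1 z.2.2.2.1 z.2.2.2.2}

/-- One step of the execution, collecting the trace and the answers. -/
noncomputable def execStep (Γ : ORAM) (κ : ℕ) (s : Data × Device × Trace × List Block) (o : Op) :
    PMF (Data × Device × Trace × List Block) :=
  (Γ.access κ s.1 s.2.1 o).bind fun a =>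
    PMF.pure (a.1, s.2.1.exec a.2.1, s.2.2.1 ++ a.2.1,
      if o.isWrite then s.2.2.2 else s.2.2.2 ++ [a.2.2])

theorem foldP_execStep (y : List Op) : ∀ s : Data × Device × Trace × List Block,
    foldP (Γ.execStep κ) s y = (Γ.exec κ s.1 s.2.1 y).bind fun a =>
      PMF.pure (a.1, a.2.1, s.2.2.1 ++ a.2.2.1, s.2.2.2 ++ a.2.2.2) := by
  induction y with
  | nil => intro s; simp [foldP, ORAM.exec, PMF.pure_bind]
  | cons o y ih =>
    intro s
    simp only [foldP, execStep, ORAM.exec, PMF.bind_bind, PMF.pure_bind, ih]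
    congr 1
    funext a
    congr 1
    funext b
    cases o.isWrite <;> simp

theorem legitSeq_append {y y' : List Op} :
    Γ.LegitSeq κ (y ++ y') ↔ Γ.LegitSeq κ y ∧ Γ.LegitSeq κ y' := by
  simp only [LegitSeq, List.mem_append, or_imp, forall_and]

/-- Private state and device are bounded because they are reachable; the collected trace and answers
grow in every step by at most the output length of one access. -/
theorem Efficient.exec (h : Γ.Efficient) :
    PolySamp (fun z : Γ.ExecIndex => z.1.1 + encSize (z.1.2.1 ++ z.1.2.2.1))
      (fun z => (Unary.mk z.1.1, z.1.2.2.2.1, z.1.2.2.2.2, z.1.2.2.1))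
      fun z => Γ.exec z.1.1 z.1.2.2.2.1 z.1.2.2.2.2 z.1.2.2.1 := by
  set sz := fun z : Γ.ExecIndex => z.1.1 + encSize (z.1.2.1 ++ z.1.2.2.1) with hsz
  obtain ⟨p, hp⟩ := h.reachable_bdd
  obtain ⟨q, hq⟩ := h.access.output_bdd
  have hin := PolyComp.input (sz := sz) (x := fun z : Γ.ExecIndex =>
      (Unary.mk z.1.1, z.1.2.2.2.1, z.1.2.2.2.2, z.1.2.2.1)) <| by
    refine (PolyBdd.mono ((PolyBdd.self.mul (.const 3)).add
      ((PolyBdd.self.eval p).add (.const 5))) ?_)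
    rintro ⟨⟨κ, y, z, s, dev⟩, hl, hr⟩
    simp only at hl hr
    have h1 := hp κ y s dev (legitSeq_append.1 hl).1 hr
    have h2 := encSize_append y z
    have h3 := encSize_pos y
    have h4 := encSize_pos z
    have h5 := p.eval_nat_mono (show κ + encSize y ≤ κ + encSize (y ++ z) by omega)
    simp only [encSize_pair, encSize_unary, hsz]
    omega
  have hs₀ := hin.snd.fst.pair (hin.snd.snd.fst.pair ((PolyComp.nil hin.input_bdd
    (β := Access)).pair (PolyComp.nil hin.input_bdd (β := Block))))
  -- The constant 2 in the invariant is the size of the two empty lists at the start.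
  refine (PolySamp.fold (step := fun z : Γ.ExecIndex => Γ.execStep z.1.1) hin.snd.snd.snd hin.fst
    hs₀ (fun z pre s => Γ.Reachable z.1.1 (z.1.2.1 ++ pre) s.1 s.2.1 ∧
      encSize s.2.2.1 + encSize s.2.2.2 ≤ 2 + pre.length * (q.eval (sz z) + 1)) ?_ ?_ ?_).congr
      fun z => ?_
  · rintro ⟨⟨κ, y, z, s, dev⟩, hl, hr⟩
    simp only [List.append_nil]
    exact ⟨hr, by simp [encSize_nil]⟩
  · rintro ⟨⟨κ, y, z, s, dev⟩, hl, hr⟩ pre b post ⟨s₁, dev₁, t₁, v₁⟩ h1 ⟨h2, h3⟩ s' hs'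
    simp only at h1 h2 h3 hl hr hs'
    subst h1
    simp only [execStep, PMF.mem_support_bind_iff, PMF.mem_support_pure_iff] at hs'
    obtain ⟨a, ha, rfl⟩ := hs'
    refine ⟨by simpa using h2.access ha, ?_⟩
    have h4 := hq ⟨(κ, y ++ pre, b, s₁, dev₁), by
      rw [legitSeq_append] at hl ⊢
      rw [legitSeq_append]
      have := hl.2
      simp only [LegitSeq, List.mem_append, List.mem_cons] at this ⊢
      exact ⟨⟨hl.1, fun o ho => this o (.inl ho)⟩, fun o ho => this o (.inr (.inl (by simpa using
          ho)))⟩,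
      h2⟩ a ha
    have h5 : encSize a = encSize a.1 + (encSize a.2.1 + encSize a.2.2 + 1) + 1 := rfl
    have h6 : encSize (y ++ pre ++ [b]) ≤ encSize (y ++ (pre ++ b :: post)) := by
      have e1 := encSize_append (y ++ pre ++ [b]) post
      have e2 := encSize_pos post
      simp only [List.append_assoc, List.singleton_append] at e1 ⊢
      omega
    have h7 := q.eval_nat_mono (Nat.add_le_add_left h6 κ)
    have h8 := encSize_append t₁ a.2.1
    have h9 := encSize_append v₁ [a.2.2]
    have h10 : encSize [a.2.2] = encSize a.2.2 + 1 + 1 := rfl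
    simp only [hsz, List.length_append, List.length_singleton, add_mul, one_mul] at h3 h4 ⊢
    split_ifs <;> omega
  · let Z := {z : Γ.ExecIndex × List Op × Op × List Op × (Data × Device × Trace × List Block) //
        z.1.1.2.2.1 = z.2.1 ++ z.2.2.1 :: z.2.2.2.1 ∧
        (Γ.Reachable z.1.1.1 (z.1.1.2.1 ++ z.2.1) z.2.2.2.2.1 z.2.2.2.2.2.1 ∧
      encSize z.2.2.2.2.2.2.1 + encSize z.2.2.2.2.2.2.2 ≤ 2 + z.2.1.length * (q.eval (sz z.1) + 1))}
    have hZl : ∀ z : Z, Γ.LegitSeq z.1.1.1.1 (z.1.1.1.2.1 ++ z.1.2.1 ++ [z.1.2.2.1]) ∧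
        encSize (z.1.1.1.2.1 ++ z.1.2.1 ++ [z.1.2.2.1]) ≤ encSize (z.1.1.1.2.1 ++ z.1.1.1.2.2.1) :=
            by
      rintro ⟨⟨⟨⟨κ, y, z, s, dev⟩, hl, hr⟩, pre, b, post, s₁, dev₁, t₁, v₁⟩, h1, h2, h3⟩
      simp only at h1 h2 h3 hl hr ⊢
      subst h1
      constructor
      · intro o ho
        exact hl o (by simp at ho ⊢; tauto)
      · have e1 := encSize_append (y ++ pre ++ [b]) post
        have e2 := encSize_pos post
        simp only [List.append_assoc, List.singleton_append] at e1 ⊢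
        omega
    -- The requests before the batch and the processed part of the batch together form the history
    -- of the next access.
    let e : Z → Γ.AccessIndex := fun z => ⟨(z.1.1.1.1, z.1.1.1.2.1 ++ z.1.2.1, z.1.2.2.1,
      z.1.2.2.2.2.1, z.1.2.2.2.2.2.1), (hZl z).1, z.2.2.1⟩
    have hacc : PolySamp (fun z : Z => sz z.1.1) _ _ := (h.access.reindex e).resize
      (PolyBdd.self.mono fun z => Nat.add_le_add_left (hZl z).2 _)
    have hZin := PolyComp.input (sz := fun z : Z => sz z.1.1)
        (x := fun z => (Unary.mk z.1.1.1.1, z.1.2.2.2.2, z.1.2.2.1)) <| by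
      refine (PolyBdd.mono (hacc.input_bdd.add ((PolyBdd.const 5).add
        (PolyBdd.self.mul ((PolyBdd.self.eval q).add (.const 1))))) fun z => ?_)
      have h1 := z.2.2.2
      have h2 : z.1.2.1.length ≤ sz z.1.1 := by
        have h3 := length_lt_encSize (z.1.1.1.2.1 ++ z.1.1.1.2.2.1)
        rw [z.2.1] at h3
        simp only [hsz]
        rw [z.2.1]
        simp only [List.length_append] at h3
        omega
      have h3 := Nat.mul_le_mul_right (q.eval (sz z.1.1) + 1) h2
      obtain ⟨⟨i, pre, b, post, s₁, dev₁, t₁, v₁⟩, g1, g2, g3⟩ := z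
      simp only [encSize_pair, e] at h1 h3 ⊢
      omega
    have hacc' := hacc.comp (x := fun z : Z => (Unary.mk z.1.1.1.1, z.1.2.2.2.2, z.1.2.2.1))
      (hZin.fst.pair (hZin.snd.fst.fst.pair (hZin.snd.fst.snd.fst.pair hZin.snd.snd)))
    refine PolySamp.bind hacc' ?_
    have hin' := hacc'.bindInput
    exact hin'.snd.fst.pair ((hin'.fst.snd.fst.snd.fst.devExec hin'.snd.snd.fst).pair
      ((hin'.fst.snd.fst.snd.snd.fst.append hin'.snd.snd.fst).pair
        (PolyComp.ite hin'.fst.snd.snd.opIsWrite hin'.fst.snd.fst.snd.snd.snd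
          (hin'.fst.snd.fst.snd.snd.snd.append (hin'.snd.snd.snd.cons (.nil hin'.input_bdd))))))
  · rw [foldP_execStep]
    simp

end ORAM

/-! ### Probabilities -/

theorem prob_map {α β : Type} (μ : PMF α) (f : α → β) (E : β → Prop) :
    prob (μ.map f) E = prob μ fun a => E (f a) := by
  simp only [prob, PMF.toOuterMeasure_map_apply]
  rfl

theorem prob_ne_top {α : Type} (μ : PMF α) (E : α → Prop) : μ.toOuterMeasure {x | E x} ≠ ⊤ := by
  refine ne_top_of_le_ne_top ENNReal.one_ne_top ?_
  calc μ.toOuterMeasure {x | E x} ≤ μ.toOuterMeasure Set.univ :=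
        μ.toOuterMeasure.mono (Set.subset_univ _)
    _ = 1 := by rw [PMF.toOuterMeasure_apply_eq_one_iff]; exact Set.subset_univ _

theorem prob_mono {α : Type} (μ : PMF α) {E F : α → Prop} (h : ∀ a ∈ μ.support, E a → F a) :
    prob μ E ≤ prob μ F := by
  refine ENNReal.toReal_mono (prob_ne_top μ F) ?_
  rw [← PMF.toOuterMeasure_apply_inter_support]
  exact μ.toOuterMeasure.mono fun a ha => h a ha.2 ha.1

theorem prob_or_le {α : Type} (μ : PMF α) (E F : α → Prop) :
    prob μ (fun a => E a ∨ F a) ≤ prob μ E + prob μ F := by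
  rw [prob, prob, prob, ← ENNReal.toReal_add (prob_ne_top μ E) (prob_ne_top μ F)]
  refine ENNReal.toReal_mono (ENNReal.add_ne_top.2 ⟨prob_ne_top μ E, prob_ne_top μ F⟩) ?_
  exact MeasureTheory.measure_union_le {x | E x} {x | F x}

/-! ### Batches of requests -/

namespace ORAM

variable {Γ : ORAM} {κ : ℕ}

/-- Serve several request sequences, collecting the answers per sequence. -/
noncomputable def execBatch (Γ : ORAM) (κ : ℕ) :
    Data → Device → List (List Op) → PMF (Data × Device × List (List Block))
  | s, dev, [] => PMF.pure (s, dev, [])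
  | s, dev, y :: ys => (Γ.exec κ s dev y).bind fun a =>
      (execBatch Γ κ a.1 a.2.1 ys).bind fun b => PMF.pure (b.1, b.2.1, a.2.2.2 :: b.2.2)

/-- Batches only cut the list of answers; the execution itself does not notice them. -/
theorem execBatch_flatten (ys : List (List Op)) : ∀ (s : Data) (dev : Device),
    (Γ.execBatch κ s dev ys).bind (fun b => PMF.pure (b.1, b.2.1, b.2.2.flatten)) =
      (Γ.exec κ s dev ys.flatten).bind fun a => PMF.pure (a.1, a.2.1, a.2.2.2) := by
  induction ys with
  | nil => intro s dev; simp [execBatch, exec, PMF.pure_bind]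
  | cons y ys ih =>
    intro s dev
    rw [List.flatten_cons, exec_append]
    simp only [execBatch, PMF.bind_bind, PMF.pure_bind, List.flatten_cons]
    refine congrArg _ (funext fun a => ?_)
    have := congrArg (fun μ => μ.bind fun c => PMF.pure (c.1, c.2.1, a.2.2.2 ++ c.2.2))
      (ih a.1 a.2.1)
    simpa only [PMF.bind_bind, PMF.pure_bind] using this

theorem length_of_mem_execBatch {ys : List (List Op)} : ∀ {s : Data} {dev : Device}
    {b : Data × Device × List (List Block)}, b ∈ (Γ.execBatch κ s dev ys).support →
    List.Forall₂ (fun y (ans : List Block) => ans.length + writeCount y = y.length) ys b.2.2 := by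
  induction ys with
  | nil =>
    intro s dev b hb
    simp only [execBatch, PMF.mem_support_pure_iff] at hb
    subst hb
    exact .nil
  | cons y ys ih =>
    intro s dev b hb
    simp only [execBatch, PMF.mem_support_bind_iff, PMF.mem_support_pure_iff] at hb
    obtain ⟨a, ha, c, hc, rfl⟩ := hb
    exact .cons (length_of_mem_exec ha) (ih hc)

end ORAM

/-- The number of answers equals the number of `Read`s in `y`, so the cut between the answers is the
cut between the requests. -/
theorem consistent_append {y y' : List Op} {mem : ℕ → Option Block} {ans ans' : List Block}
    (hl : ans.length + writeCount y = y.length) (h : Consistent mem (y ++ y') (ans ++ ans')) :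
    Consistent mem y ans ∧ Consistent (memAfter mem y) y' ans' := by
  induction y generalizing mem ans with
  | nil =>
    obtain rfl : ans = [] := by
      rw [← List.length_eq_zero_iff]
      simpa [writeCount] using hl
    exact ⟨rfl, h⟩
  | cons o y ih =>
    cases o with
    | write a d =>
      refine ih (ans := ans) ?_ h
      simp only [writeCount, List.countP_cons, Op.isWrite, List.length_cons, if_true] at hl ⊢
      exact Nat.succ.inj hl
    | read a =>
      cases ans with
      | nil =>
        exfalso
        have : writeCount y ≤ y.length := List.countP_le_length
        have h2 : writeCount (Op.read a :: y) = writeCount y := by simp [writeCount, Op.isWrite]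
        rw [h2] at hl
        simp only [List.length_nil, List.length_cons] at hl
        omega
      | cons v ans =>
        have h2 : writeCount (Op.read a :: y) = writeCount y := by simp [writeCount, Op.isWrite]
        rw [h2] at hl
        have h3 := ih (mem := mem) (ans := ans)
          (by simp only [List.length_cons] at hl ⊢; omega) h.2
        exact ⟨⟨h.1, h3.1⟩, h3.2⟩

theorem consistentSeq_of_flatten {ys : List (List Op)} {anss : List (List Block)}
    (hl : List.Forall₂ (fun y (ans : List Block) => ans.length + writeCount y = y.length) ys anss) :
    ∀ {mem : ℕ → Option Block}, Consistent mem ys.flatten anss.flatten →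
      ConsistentSeq mem ys anss := by
  induction hl with
  | nil => intro mem _; rfl
  | cons h _ ih =>
    intro mem hc
    obtain ⟨h1, h2⟩ := consistent_append h hc
    exact ⟨h1, ih h2⟩

/-- The answers to batches of requests, on a freshly initialized instance. -/
noncomputable def ORAM.batchAnswers (Γ : ORAM) (κ : ℕ) (ys : List (List Op)) :
    PMF (List (List Block)) :=
  (Γ.setup κ).bind fun a =>
    (Γ.execBatch κ a.1 (Device.exec [] a.2) ys).bind fun b => PMF.pure b.2.2

/-- The flattened answers have the law of an ordinary run, and on the support the cuts can be
recovered from the lengths. -/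
theorem ORAM.prob_batchAnswers_le (Γ : ORAM) (κ : ℕ) (ys : List (List Op)) :
    prob (Γ.batchAnswers κ ys) (fun anss => ¬ ConsistentSeq (fun _ => none) ys anss) ≤
      prob (Γ.run κ ys.flatten)
        fun c => ¬ Consistent (fun _ => none) ys.flatten c.2.2 := by
  have h1 : (Γ.batchAnswers κ ys).map List.flatten = (Γ.run κ ys.flatten).map fun c => c.2.2 := by
    simp only [batchAnswers, run, PMF.map_bind, PMF.pure_map]
    refine congrArg _ (funext fun a => ?_)
    have := congrArg (fun μ => μ.bind fun c => PMF.pure c.2.2)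
      (execBatch_flatten (Γ := Γ) (κ := κ) ys a.1 (Device.exec [] a.2))
    simpa only [PMF.bind_bind, PMF.pure_bind] using this
  have h2 := prob_map (Γ.run κ ys.flatten) (fun c => c.2.2)
    fun ans => ¬ Consistent (fun _ => none) ys.flatten ans
  rw [← h2, ← h1, prob_map]
  refine prob_mono _ fun anss ha h hc => h ?_
  simp only [batchAnswers, PMF.mem_support_bind_iff, PMF.mem_support_pure_iff] at ha
  obtain ⟨a, -, b, hb, rfl⟩ := ha
  exact consistentSeq_of_flatten (length_of_mem_execBatch hb) hc

/-! ### The two halves of the device -/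

namespace Hive

/-- The search passes over entries of the other half, and prefixing a bit is injective on locations,
so the same entry is overwritten. -/
theorem half_put_same (b : Bool) (l : List Bool) (d : Block) (dev : Device) :
    half b (Device.put (b :: l) d dev) = Device.put l d (half b dev) := by
  induction dev with
  | nil => simp [Device.put, half]
  | cons e dev ih =>
    obtain ⟨loc, c⟩ := e
    simp only [half] at ih
    rcases loc with _ | ⟨b', loc⟩
    · simp [Device.put, half, ih]
    · by_cases h : b' = b
      · by_cases h' : loc = l <;> simp [Device.put, half, h, h', ih]
      · simp [Device.put, half, h, ih]

theorem half_put_ne {b b' : Bool} (h : b' ≠ b) (l : List Bool) (d : Block) (dev : Device) :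
    half b (Device.put (b' :: l) d dev) = half b dev := by
  induction dev with
  | nil => simp [Device.put, half, h]
  | cons e dev ih =>
    obtain ⟨loc, c⟩ := e
    simp only [half] at ih
    by_cases h' : loc = b' :: l
    · simp [Device.put, half, h, h']
    · simp only [Device.put, half, h', if_false, List.filterMap_cons, ih]

theorem tag_cons (b : Bool) (a : Access) (t : Trace) : tag b (a :: t) = tagAccess b a :: tag b t :=
  rfl

theorem half_exec_tag_same (b : Bool) (t : Trace) : ∀ dev : Device,
    half b (dev.exec (tag b t)) = (half b dev).exec t := by
  induction t with
  | nil => intro dev; rfl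
  | cons a t ih =>
    intro dev
    rw [tag_cons]
    change half b ((dev.perform (tagAccess b a)).exec (tag b t)) = ((half b dev).perform a).exec t
    rw [ih]
    cases a with
    | read l => rfl
    | write l d => exact congrArg (fun dev' : Device => dev'.exec t) (half_put_same b l d dev)

theorem half_exec_tag_ne {b b' : Bool} (h : b' ≠ b) (t : Trace) : ∀ dev : Device,
    half b (dev.exec (tag b' t)) = half b dev := by
  induction t with
  | nil => intro dev; rfl
  | cons a t ih =>
    intro dev
    rw [tag_cons]
    change half b ((dev.perform (tagAccess b' a)).exec (tag b' t)) = half b dev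
    rw [ih]
    cases a with
    | read l => rfl
    | write l d => exact half_put_ne h l d dev

/-- Each instance sees its half as if the other one did not exist; this decouples the two instances
everywhere below. -/
theorem half_false_exec (tp th : Trace) (dev : Device) :
    half false (dev.exec (tag false tp ++ tag true th)) = (half false dev).exec tp := by
  rw [Device.exec_append, half_exec_tag_ne (by decide), half_exec_tag_same]

theorem half_true_exec (tp th : Trace) (dev : Device) :
    half true (dev.exec (tag false tp ++ tag true th)) = (half true dev).exec th := by
  rw [Device.exec_append, half_exec_tag_same, half_exec_tag_ne (by decide)]

/-- Every location of the device belongs to one of the halves. -/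
def Tagged (dev : Device) : Prop := ∀ e ∈ dev, e.1 ≠ []

theorem Tagged.put {dev : Device} (h : Tagged dev) (b : Bool) (l : List Bool) (d : Block) :
    Tagged (Device.put (b :: l) d dev) := by
  induction dev with
  | nil => intro e he; simp [Device.put] at he; simp [he]
  | cons e dev ih =>
    have h1 : Tagged dev := fun e he => h e (List.mem_cons_of_mem _ he)
    rw [Device.put]
    split_ifs with hc
    · intro e' he'
      rcases List.mem_cons.1 he' with rfl | he'
      · simp
      · exact h1 e' he'
    · intro e' he'
      rcases List.mem_cons.1 he' with rfl | he'
      · exact h _ (List.mem_cons_self ..)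
      · exact ih h1 e' he'

theorem Tagged.exec_tag (b : Bool) (t : Trace) : ∀ {dev : Device}, Tagged dev →
    Tagged (dev.exec (tag b t)) := by
  induction t with
  | nil => intro dev h; exact h
  | cons a t ih =>
    intro dev h
    rw [tag_cons]
    change Tagged ((dev.perform (tagAccess b a)).exec (tag b t))
    cases a with
    | read l => exact ih h
    | write l d => exact ih (h.put b l d)

theorem Tagged.exec {dev : Device} (h : Tagged dev) (tp th : Trace) :
    Tagged (dev.exec (tag false tp ++ tag true th)) := by
  rw [Device.exec_append]
  exact (h.exec_tag false tp).exec_tag true th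

/-- An entry at the empty location would belong to neither half, hence the hypothesis. The constant
absorbs the tag bit of each location. -/
theorem Tagged.encSize_le {dev : Device} (h : Tagged dev) :
    encSize dev ≤ 4 * (encSize (half false dev) + encSize (half true dev)) := by
  induction dev with
  | nil => decide
  | cons e dev ih =>
    have h1 := ih fun e he => h e (List.mem_cons_of_mem _ he)
    have h2 := h e (List.mem_cons_self ..)
    obtain ⟨loc, d⟩ := e
    rcases loc with _ | ⟨b, loc⟩
    · exact absurd rfl h2
    · have h3 := encSize_bool_le b
      cases b
      · rw [show half false ((false :: loc, d) :: dev) = (loc, d) :: half false dev from rfl,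
          show half true ((false :: loc, d) :: dev) = half true dev from rfl]
        simp only [encSize_cons, encSize_pair]
        have := encSize_pos loc
        omega
      · rw [show half true ((true :: loc, d) :: dev) = (loc, d) :: half true dev from rfl,
          show half false ((true :: loc, d) :: dev) = half false dev from rfl]
        simp only [encSize_cons, encSize_pair]
        have := encSize_pos loc
        omega

theorem wOnly_tag (b : Bool) (t : Trace) : wOnly (tag b t) = tag b (wOnly t) := by
  induction t with
  | nil => rfl
  | cons a t ih =>
    cases a with
    | read l => exact ih
    | write l d => exact congrArg (List.cons (Access.write (b :: l) d)) ih

end Hive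

/-! ### The two ORAM instances inside HIVE -/

namespace Hive

variable {Γ : ORAM} {κ : ℕ}

/-- The requests to the hidden instance that a pattern causes. -/
def hidOps (Γ : ORAM) (κ : ℕ) (pat : Pattern) : List Op :=
  schedule (Γ.blockLen κ) (slotsOf .pub pat) (slotsOf .hid pat)

theorem slotsOf_append (v : Volume) (P Q : Pattern) :
    slotsOf v (P ++ Q) = slotsOf v P ++ slotsOf v Q := by
  simp [slotsOf]

theorem opsOf_append (v : Volume) (P Q : Pattern) : opsOf v (P ++ Q) = opsOf v P ++ opsOf v Q := by
  simp [opsOf, slotsOf_append]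

theorem mem_slotsOf {v : Volume} {pat : Pattern} {o : Option Op} :
    o ∈ slotsOf v pat ↔ ∃ r ∈ pat, r.vol = v ∧ r.op = o := by
  simp [slotsOf, and_assoc]

theorem mem_opsOf {v : Volume} {pat : Pattern} {o : Op} :
    o ∈ opsOf v pat ↔ ∃ r ∈ pat, r.vol = v ∧ r.op = some o := by
  simp [opsOf, mem_slotsOf]

theorem mem_schedule {len : ℕ} {ps hs : List (Option Op)} {o : Op} (h : o ∈ schedule len ps hs) :
    (o = .write 0 (List.replicate len false) ∧ ∃ p, some p ∈ ps) ∨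
      (∃ a, o = .read (2 * a + 1) ∧ some (.read a) ∈ hs) ∨
      ∃ a d, o = .write (2 * a + 1) d ∧ some (.write a d) ∈ hs := by
  have key : ∀ p h, o ∈ slot len p h →
      (o = .write 0 (List.replicate len false) ∧ ∃ p', p = some p') ∨
      (∃ a, o = .read (2 * a + 1) ∧ h = some (.read a)) ∨
      ∃ a d, o = .write (2 * a + 1) d ∧ h = some (.write a d) := by
    intro p h ho
    have hd : o ∈ dummyAccess len p →
        o = .write 0 (List.replicate len false) ∧ ∃ p', p = some p' := by
      intro ho
      cases p <;> simp_all [dummyAccess]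
    rcases h with _ | ⟨a⟩ | ⟨a, d⟩
    · exact .inl (hd ho)
    · rcases List.mem_cons.1 ho with rfl | ho
      · exact .inr (.inl ⟨a, rfl, rfl⟩)
      · exact .inl (hd ho)
    · exact .inr (.inr ⟨a, d, by simpa [slot] using ho, rfl⟩)
  fun_induction schedule len ps hs with
  | case1 => simp at h
  | case2 h' hs ih =>
    rcases List.mem_append.1 h with h | h
    · have := key _ _ h
      simp only [List.mem_cons]
      grind
    · have := ih h
      simp only [List.mem_cons]
      grind
  | case3 p ps ih =>
    rcases List.mem_append.1 h with h | h
    · have := key _ _ h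
      simp only [List.mem_cons]
      grind
    · have := ih h
      simp only [List.mem_cons]
      grind
  | case4 p ps h' hs ih =>
    rcases List.mem_append.1 h with h | h
    · have := key _ _ h
      simp only [List.mem_cons]
      grind
    · have := ih h
      simp only [List.mem_cons]
      grind

theorem legit_opsOf {pat : Pattern} (h : ∀ r ∈ pat, (hive Γ).LegitRequest κ r) :
    Γ.LegitSeq κ (opsOf .pub pat) := by
  intro o ho
  obtain ⟨r, hr, hv, hop⟩ := mem_opsOf.1 ho
  have := h r hr o hop
  rw [if_pos hv] at this
  exact this

/-- From `a < N / 2` with rounding down follows `2 * a + 1 < N`. The reserved block 0 exists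
whenever it is written, because the legitimate public request in that slot shows that the capacity
is positive. -/
theorem legit_hidOps {pat : Pattern} (h : ∀ r ∈ pat, (hive Γ).LegitRequest κ r) :
    Γ.LegitSeq κ (hidOps Γ κ pat) := by
  have hhid : ∀ o, some o ∈ slotsOf .hid pat → o.Legit (Γ.cap κ / 2) (Γ.blockLen κ) := by
    intro o ho
    obtain ⟨r, hr, hv, hop⟩ := mem_slotsOf.1 ho
    have := h r hr o hop
    rw [if_neg (by rw [hv]; decide)] at this
    exact this
  intro o ho
  rcases mem_schedule ho with ⟨rfl, p, hp⟩ | ⟨a, rfl, ha⟩ | ⟨a, d, rfl, ha⟩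
  · obtain ⟨r, hr, hv, hop⟩ := mem_slotsOf.1 hp
    have := h r hr p hop
    rw [if_pos hv] at this
    refine ⟨?_, by simp⟩
    cases p with
    | read a => exact Nat.zero_lt_of_lt (show a < Γ.cap κ from this)
    | write a d => exact Nat.zero_lt_of_lt (show a < Γ.cap κ from this.1)
  · have : a < Γ.cap κ / 2 := hhid _ ha
    change 2 * a + 1 < Γ.cap κ
    omega
  · have h1 : a < Γ.cap κ / 2 := (hhid _ ha).1
    refine ⟨?_, (hhid _ ha).2⟩
    omega

theorem legit_of_allowed {pat : Pattern} (h : (hive Γ).Allowed κ pat) :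
    ∀ r ∈ pat, (hive Γ).LegitRequest κ r := by
  obtain ⟨P₁, P₂, Ph, hv, h⟩ := h
  intro r hr
  refine hv.legit r ?_
  simp only [List.mem_append]
  rcases h with rfl | rfl <;> rw [List.mem_append] at hr <;> tauto

theorem oper_eq (kp kh st : Data) (dev : Device) (pat : Pattern) :
    (hive Γ).oper κ kp kh st dev pat =
      (Γ.exec κ st.left (half false dev) (opsOf .pub pat)).bind fun a =>
        (Γ.exec κ st.right (half true dev) (hidOps Γ κ pat)).bind fun b =>
          PMF.pure (Data.cons a.1 b.1, tag false a.2.2.1 ++ tag true b.2.2.1, a.2.2.2, b.2.2.2) :=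
  rfl

theorem step_eq (c : PDScheme.Config) (pat : Pattern) : (hive Γ).step κ c pat =
      (Γ.exec κ c.st.left (half false c.dev) (opsOf .pub pat)).bind fun a =>
        (Γ.exec κ c.st.right (half true c.dev) (hidOps Γ κ pat)).bind fun b =>
          PMF.pure (⟨c.kpub, c.khid, Data.cons a.1 b.1,
            c.dev.exec (tag false a.2.2.1 ++ tag true b.2.2.1)⟩,
            tag false a.2.2.1 ++ tag true b.2.2.1, a.2.2.2, b.2.2.2) := by
  rw [PDScheme.step, oper_eq]
  simp only [PMF.bind_bind, PMF.pure_bind]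

theorem initial_eq : (hive Γ).initial κ = (Γ.setup κ).bind fun a => (Γ.setup κ).bind fun b =>
    PMF.pure (⟨a.1, b.1, Data.cons a.1 b.1, Device.exec [] (tag false a.2 ++ tag true b.2)⟩,
      tag false a.2 ++ tag true b.2) := by
  rw [PDScheme.initial, hive]
  simp only [PMF.bind_bind, PMF.pure_bind]

/-- The configuration consists of two instances of the ORAM, which have served the requests `yp` and
`yh`. -/
structure Inv (Γ : ORAM) (κ : ℕ) (yp yh : List Op) (c : PDScheme.Config) : Prop where
  state : ∃ sp sh, c.st = Data.cons sp sh
  pub : Γ.Reachable κ yp c.st.left (half false c.dev)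
  hid : Γ.Reachable κ yh c.st.right (half true c.dev)
  tagged : Tagged c.dev
  kpub : ∃ dev, Γ.Reachable κ [] c.kpub dev
  khid : ∃ dev, Γ.Reachable κ [] c.khid dev

theorem inv_initial {c : PDScheme.Config × Trace} (h : c ∈ ((hive Γ).initial κ).support) :
    Inv Γ κ [] [] c.1 := by
  simp only [initial_eq, PMF.mem_support_bind_iff, PMF.mem_support_pure_iff] at h
  obtain ⟨a, ha, b, hb, rfl⟩ := h
  refine ⟨⟨_, _, rfl⟩, ?_, ?_, ?_, ⟨_, ORAM.reachable_nil ha⟩, ⟨_, ORAM.reachable_nil hb⟩⟩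
  · simp only [half_false_exec]
    exact ORAM.reachable_nil ha
  · simp only [half_true_exec]
    exact ORAM.reachable_nil hb
  · exact Tagged.exec (fun e he => absurd he List.not_mem_nil) _ _

theorem Inv.step {yp yh : List Op} {c : PDScheme.Config} (hc : Inv Γ κ yp yh c) {pat : Pattern}
    {z : PDScheme.Config × Trace × List Block × List Block}
    (h : z ∈ ((hive Γ).step κ c pat).support) :
    Inv Γ κ (yp ++ opsOf .pub pat) (yh ++ hidOps Γ κ pat) z.1 := by
  simp only [step_eq, PMF.mem_support_bind_iff, PMF.mem_support_pure_iff] at h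
  obtain ⟨a, ha, b, hb, rfl⟩ := h
  refine ⟨⟨_, _, rfl⟩, ?_, ?_, ?_, hc.kpub, hc.khid⟩
  · simp only [half_false_exec]
    rw [← ORAM.dev_of_mem_exec ha]
    exact hc.pub.exec ha
  · simp only [half_true_exec]
    rw [← ORAM.dev_of_mem_exec hb]
    exact hc.hid.exec hb
  · exact hc.tagged.exec _ _

theorem Inv.exec {pats : List Pattern} : ∀ {yp yh : List Op} {c : PDScheme.Config},
    Inv Γ κ yp yh c → ∀ z ∈ ((hive Γ).exec κ c pats).support,
      Inv Γ κ (yp ++ pats.flatMap (opsOf .pub)) (yh ++ pats.flatMap (hidOps Γ κ)) z.1 := by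
  induction pats with
  | nil =>
    intro yp yh c hc z hz
    simp only [PDScheme.exec, PMF.mem_support_pure_iff] at hz
    subst hz
    simpa using hc
  | cons pat pats ih =>
    intro yp yh c hc z hz
    simp only [PDScheme.exec, PMF.mem_support_bind_iff, PMF.mem_support_pure_iff] at hz
    obtain ⟨a, ha, b, hb, rfl⟩ := hz
    have := ih (hc.step ha) b hb
    simpa only [List.flatMap_cons, List.append_assoc] using this

theorem inv_run {pats : List Pattern} {c : PDScheme.Config × List (List Block × List Block)}
    (h : c ∈ ((hive Γ).run κ pats).support) :
    Inv Γ κ (pats.flatMap (opsOf .pub)) (pats.flatMap (hidOps Γ κ)) c.1 := by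
  simp only [PDScheme.run, PMF.mem_support_bind_iff] at h
  obtain ⟨a, ha, hc⟩ := h
  simpa using (inv_initial ha).exec c hc

/-! ### The dummy request -/

theorem dummyNoop (Γ : ORAM) : (hive Γ).DummyNoop := by
  intro κ pats _ c hc o ho
  obtain ⟨⟨sp, sh, hst⟩, -⟩ := inv_run hc
  rw [oper_eq] at ho
  have h1 : opsOf .pub [pubDummy] = [] := rfl
  have h2 : hidOps Γ κ [pubDummy] = [] := by
    simp [hidOps, slotsOf, pubDummy, schedule, slot, dummyAccess]
  rw [h1, h2] at ho
  simp only [ORAM.exec, PMF.pure_bind, PMF.mem_support_pure_iff] at ho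
  subst ho
  -- Putting the two components of the state together again returns the state only because it is a
  -- `cons`.
  rw [hst]
  exact ⟨rfl, rfl⟩

/-! ### Universal patterns -/

/-- One slot suffices: reading the public block 0 covers any single hidden request. If the capacity
is zero, block 0 is not legitimate, but then there are no hidden data requests either and the dummy
serves as cover. Capacity zero is recognized by an empty binary expansion. -/
theorem universal (Γ : ORAM) (h : Γ.Efficient) :
    ∃ (n : ℕ → ℕ) (P₁ P₂ : ℕ → Pattern), (hive Γ).Universal n P₁ P₂ := by
  have hx : PolyBdd (fun κ => κ) fun κ => encSize (Unary.mk κ) := h.1.polyComp.input_bdd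
  have hcons : ∀ Ph : Pattern, Ph.length = 1 → ∃ r, Ph = [r] := fun Ph h =>
    List.length_eq_one_iff.1 h
  refine ⟨fun _ => 1, fun κ => if (Nat.bits (Γ.cap κ)).isEmpty then [pubDummy] else
    [⟨.pub, some (.read 0)⟩], fun _ => [], fun _ => le_rfl, (PolyComp.const hx _).computable, ?_,
    (PolyComp.nil hx).computable, ?_, ?_⟩
  · refine PolyComp.computable (PolyComp.ite ?_ (.const hx _) (.const hx _))
    exact (h.1.polyComp.cast (f := fun κ => Nat.bits (Γ.cap κ)) fun _ => rfl).isEmpty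
  · intro κ Ph hl hPh
    obtain ⟨r, rfl⟩ := hcons Ph hl
    obtain ⟨hv, hr⟩ := hPh r (by simp)
    have hcap : (Nat.bits (Γ.cap κ)).isEmpty = true ↔ Γ.cap κ = 0 := by
      rw [List.isEmpty_iff]
      constructor
      · intro h0
        by_contra h1
        have := Nat.size_eq_bits_len (Γ.cap κ)
        rw [h0, List.length_nil, eq_comm, Nat.size_eq_zero] at this
        exact h1 this
      · rintro h0; rw [h0]; simp
    by_cases h0 : Γ.cap κ = 0
    · rw [if_pos (hcap.2 h0)]
      have hnone : r.op = none := by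
        cases hop : r.op with
        | none => rfl
        | some o =>
          have := hr o hop
          rw [if_neg (by rw [hv]; decide)] at this
          change o.Legit (Γ.cap κ / 2) _ at this
          rw [h0] at this
          cases o with
          | read a => exact absurd this (Nat.not_lt_zero a)
          | write a d => exact absurd this.1 (Nat.not_lt_zero a)
      refine ⟨?_, ?_, ?_, ?_, ?_, rfl⟩
      · intro r' hr'
        simp only [List.append_nil, List.singleton_append, List.mem_cons, List.not_mem_nil,
          or_false] at hr'
        rcases hr' with rfl | rfl
        · intro o ho; nomatch ho
        · exact hr
      · intro r' hr'
        simp only [List.append_nil, List.mem_singleton] at hr'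
        subst hr'; rfl
      · intro r' hr'; simp only [List.mem_singleton] at hr'; subst hr'; exact hv
      · intro h; nomatch h
      · refine List.Forall₂.cons (fun o ho => ?_) .nil
        rw [hnone] at ho; nomatch ho
    · rw [if_neg (fun h => h0 (hcap.1 h))]
      refine ⟨?_, ?_, ?_, ?_, ?_, rfl⟩
      · intro r' hr'
        simp only [List.append_nil, List.singleton_append, List.mem_cons, List.not_mem_nil,
          or_false] at hr'
        rcases hr' with rfl | rfl
        · intro o ho
          cases ho
          exact Nat.pos_of_ne_zero h0
        · exact hr
      · intro r' hr'
        simp only [List.append_nil, List.mem_singleton] at hr'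
        subst hr'; rfl
      · intro r' hr'; simp only [List.mem_singleton] at hr'; subst hr'; exact hv
      · intro h; nomatch h
      · exact List.Forall₂.cons (fun o _ _ => rfl) .nil
  · intro κ Ph hl hPh
    obtain ⟨r, rfl⟩ := hcons Ph hl
    obtain ⟨hv, hr, hw⟩ := hPh r (by simp)
    refine ⟨?_, ?_, ?_, ?_, ?_, rfl⟩
    · intro r' hr'
      simp only [List.append_nil, List.singleton_append, List.mem_cons, List.not_mem_nil,
        or_false] at hr'
      rcases hr' with rfl | rfl
      · intro o ho; nomatch ho
      · exact hr
    · intro r' hr'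
      simp only [List.append_nil, List.mem_singleton] at hr'
      subst hr'; rfl
    · intro r' hr'; simp only [List.mem_singleton] at hr'; subst hr'; exact hv
    · intro h; nomatch h
    · refine List.Forall₂.cons (fun o ho hwr => ?_) .nil
      rw [hw o ho] at hwr; nomatch hwr

/-! ### Correctness -/

/-- The public answers do not depend on the randomness of the hidden instance, which is integrated
out. -/
theorem exec_map_pub (pats : List Pattern) : ∀ c : PDScheme.Config,
    ((hive Γ).exec κ c pats).bind (fun z => PMF.pure (z.2.map Prod.fst)) =
      (Γ.execBatch κ c.st.left (half false c.dev) (pats.map (opsOf .pub))).bind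
        fun b => PMF.pure b.2.2 := by
  induction pats with
  | nil => intro c; simp [PDScheme.exec, ORAM.execBatch, PMF.pure_bind]
  | cons pat pats ih =>
    intro c
    simp only [PDScheme.exec, step_eq, List.map_cons, ORAM.execBatch, PMF.bind_bind, PMF.pure_bind]
    refine PMF.bind_congr_support fun a ha => PMF.bind_eq_of_support fun b _ => ?_
    have h1 := congrArg (fun μ => μ.bind fun l => PMF.pure (a.2.2.2 :: l))
      (ih ⟨c.kpub, c.khid, Data.cons a.1 b.1, c.dev.exec (tag false a.2.2.1 ++ tag true b.2.2.1)⟩)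
    simp only [PMF.bind_bind, PMF.pure_bind, half_false_exec] at h1
    rw [← ORAM.dev_of_mem_exec ha] at h1
    exact h1

theorem exec_map_hid (pats : List Pattern) : ∀ c : PDScheme.Config,
    ((hive Γ).exec κ c pats).bind (fun z => PMF.pure (z.2.map Prod.snd)) =
      (Γ.execBatch κ c.st.right (half true c.dev) (pats.map (hidOps Γ κ))).bind
        fun b => PMF.pure b.2.2 := by
  induction pats with
  | nil => intro c; simp [PDScheme.exec, ORAM.execBatch, PMF.pure_bind]
  | cons pat pats ih =>
    intro c
    simp only [PDScheme.exec, step_eq, List.map_cons, ORAM.execBatch, PMF.bind_bind, PMF.pure_bind]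
    refine PMF.bind_eq_of_support fun a _ => PMF.bind_congr_support fun b hb => ?_
    have h1 := congrArg (fun μ => μ.bind fun l => PMF.pure (b.2.2.2 :: l))
      (ih ⟨c.kpub, c.khid, Data.cons a.1 b.1, c.dev.exec (tag false a.2.2.1 ++ tag true b.2.2.1)⟩)
    simp only [PMF.bind_bind, PMF.pure_bind, half_true_exec] at h1
    rw [← ORAM.dev_of_mem_exec hb] at h1
    exact h1

theorem run_map_pub (pats : List Pattern) :
    ((hive Γ).run κ pats).map (fun z => z.2.map Prod.fst) =
      Γ.batchAnswers κ (pats.map (opsOf .pub)) := by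
  change PMF.bind ((hive Γ).run κ pats) (fun z => PMF.pure (z.2.map Prod.fst)) = _
  simp only [PDScheme.run, initial_eq, ORAM.batchAnswers, PMF.bind_bind, PMF.pure_bind]
  refine congrArg _ (funext fun a => PMF.bind_eq_of_support fun b _ => ?_)
  rw [exec_map_pub]
  simp only [half_false_exec]
  rfl

theorem run_map_hid (pats : List Pattern) :
    ((hive Γ).run κ pats).map (fun z => z.2.map Prod.snd) =
      Γ.batchAnswers κ (pats.map (hidOps Γ κ)) := by
  change PMF.bind ((hive Γ).run κ pats) (fun z => PMF.pure (z.2.map Prod.snd)) = _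
  simp only [PDScheme.run, initial_eq, ORAM.batchAnswers, PMF.bind_bind, PMF.pure_bind]
  refine PMF.bind_eq_of_support fun a _ => congrArg _ (funext fun b => ?_)
  rw [exec_map_hid]
  simp only [half_true_exec]
  rfl

/-- The memory of the hidden volume, as part of the memory of the hidden ORAM. -/
def hidMem (mem : ℕ → Option Block) (a : ℕ) : Option Block := mem (2 * a + 1)

theorem hidMem_update_odd (mem : ℕ → Option Block) (a : ℕ) (v : Option Block) :
    hidMem (Function.update mem (2 * a + 1) v) = Function.update (hidMem mem) a v := by
  funext b
  by_cases h : b = a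
  · subst h; simp [hidMem]
  · rw [Function.update_of_ne h, hidMem, Function.update_of_ne (by omega), hidMem]

theorem hidMem_update_zero (mem : ℕ → Option Block) (v : Option Block) :
    hidMem (Function.update mem 0 v) = hidMem mem := by
  funext b
  rw [hidMem, Function.update_of_ne (by omega), hidMem]

theorem dummyAccess_cases (len : ℕ) (p : Option Op) :
    dummyAccess len p = [] ∨ dummyAccess len p = [.write 0 (List.replicate len false)] := by
  cases p <;> simp [dummyAccess]

theorem memAfter_append (mem : ℕ → Option Block) (y y' : List Op) :
    memAfter mem (y ++ y') = memAfter (memAfter mem y) y' := by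
  induction y generalizing mem with
  | nil => rfl
  | cons o y ih =>
    cases o with
    | read a => exact ih mem
    | write a d => exact ih _

/-- Through `hidMem` only odd blocks are visible, so the dummy write to block 0 changes nothing, and
the slot acts on the hidden memory like the hidden request alone. The last clause passes the
consistency of the later answers back over the slot. -/
theorem consistent_slot {len : ℕ} {p h : Option Op} {y : List Op} {mem : ℕ → Option Block}
    {ans : List Block} (hc : Consistent mem (slot len p h ++ y) ans) :
    ∃ mem' ans', Consistent mem' y ans' ∧ mem' = memAfter mem (slot len p h) ∧
      hidMem mem' = memAfter (hidMem mem) h.toList ∧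
      ∀ z, Consistent (hidMem mem') z ans' → Consistent (hidMem mem) (h.toList ++ z) ans := by
  rcases h with _ | ⟨a⟩ | ⟨a, d⟩
  · rcases dummyAccess_cases len p with h0 | h0
    · rw [show slot len p none = [] from h0] at hc ⊢
      exact ⟨mem, ans, hc, rfl, rfl, fun z hz => hz⟩
    · rw [show slot len p none = _ from h0] at hc ⊢
      exact ⟨_, ans, hc, rfl, hidMem_update_zero _ _, fun z hz => by
        rw [hidMem_update_zero] at hz; exact hz⟩
  · cases ans with
    | nil => exact hc.elim
    | cons v ans =>
      obtain ⟨h1, h2⟩ := hc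
      rcases dummyAccess_cases len p with h0 | h0
      · rw [show slot len p (some (.read a)) = [.read (2 * a + 1)] by rw [slot, h0]]
        rw [h0] at h2
        exact ⟨mem, ans, h2, rfl, rfl, fun z hz => ⟨h1, hz⟩⟩
      · rw [show slot len p (some (.read a)) =
          [.read (2 * a + 1), .write 0 (List.replicate len false)] by rw [slot, h0]]
        rw [h0] at h2
        exact ⟨_, ans, h2, rfl, hidMem_update_zero _ _, fun z hz => ⟨h1, by
          rw [hidMem_update_zero] at hz; exact hz⟩⟩
  · exact ⟨_, ans, hc, rfl, hidMem_update_odd _ _ _, fun z hz => by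
      rw [hidMem_update_odd] at hz; exact hz⟩

theorem consistent_schedule {len : ℕ} (ps hs : List (Option Op)) :
    ∀ {mem : ℕ → Option Block} {ans : List Block}, Consistent mem (schedule len ps hs) ans →
      Consistent (hidMem mem) (hs.filterMap fun o => o) ans ∧
      hidMem (memAfter mem (schedule len ps hs)) =
        memAfter (hidMem mem) (hs.filterMap fun o => o) := by
  have key : ∀ (p h : Option Op) (y hs' : List Op) (mem : ℕ → Option Block) (ans : List Block),
      (∀ {mem : ℕ → Option Block} {ans : List Block}, Consistent mem y ans →
        Consistent (hidMem mem) hs' ans ∧ hidMem (memAfter mem y) = memAfter (hidMem mem) hs') →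
      Consistent mem (slot len p h ++ y) ans →
      Consistent (hidMem mem) (h.toList ++ hs') ans ∧
        hidMem (memAfter mem (slot len p h ++ y)) = memAfter (hidMem mem) (h.toList ++ hs') := by
    intro p h y hs' mem ans ih hc
    obtain ⟨mem', ans', h1, h2, h3, h4⟩ := consistent_slot hc
    obtain ⟨h5, h6⟩ := ih h1
    exact ⟨h4 _ h5, by rw [memAfter_append, memAfter_append, ← h2, ← h3, h6]⟩
  fun_induction schedule len ps hs with
  | case1 => intro mem ans h; exact ⟨h, rfl⟩
  | case2 h hs ih =>
    intro mem ans hc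
    have := key none h _ _ mem ans ih hc
    cases h <;> exact this
  | case3 p ps ih =>
    intro mem ans hc
    exact key p none _ _ mem ans ih hc
  | case4 p ps h hs ih =>
    intro mem ans hc
    have := key p h _ _ mem ans ih hc
    cases h <;> exact this

/-- Correct answers of the hidden ORAM are correct answers of the hidden volume, since the memories
correspond after every batch. -/
theorem consistentSeq_hid (pats : List Pattern) : ∀ {mem : ℕ → Option Block}
    {anss : List (List Block)}, ConsistentSeq mem (pats.map (hidOps Γ κ)) anss →
      ConsistentSeq (hidMem mem) (pats.map (opsOf .hid)) anss := by
  induction pats with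
  | nil => intro mem anss h; exact h
  | cons pat pats ih =>
    intro mem anss h
    cases anss with
    | nil => exact h.elim
    | cons ans anss =>
      obtain ⟨h1, h2⟩ := consistent_schedule _ _ h.1
      refine ⟨h1, ?_⟩
      have := ih h.2
      rw [show hidMem (memAfter mem (hidOps Γ κ pat)) = _ from h2] at this
      exact this

theorem length_schedule_le (len : ℕ) (ps hs : List (Option Op)) :
    (schedule len ps hs).length ≤ 2 * (ps.length + hs.length) := by
  have key : ∀ p h, (slot len p h).length ≤ 2 := by
    intro p h
    rcases h with _ | ⟨a⟩ | ⟨a, d⟩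
    · rcases dummyAccess_cases len p with h0 | h0 <;> simp [slot, h0]
    · rcases dummyAccess_cases len p with h0 | h0 <;> simp [slot, h0]
    · simp [slot]
  fun_induction schedule len ps hs with
  | case1 => simp
  | case2 h hs ih =>
    have := key none h
    simp only [List.length_append, List.length_cons] at *
    omega
  | case3 p ps ih =>
    have := key p none
    simp only [List.length_append, List.length_cons] at *
    omega
  | case4 p ps h hs ih =>
    have := key p h
    simp only [List.length_append, List.length_cons] at *
    omega

theorem length_slots (pat : Pattern) :
    (slotsOf .pub pat).length + (slotsOf .hid pat).length = pat.length := by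
  induction pat with
  | nil => rfl
  | cons r pat ih =>
    obtain ⟨v, o⟩ := r
    cases v <;> simp [slotsOf] at ih ⊢ <;> omega

theorem length_hidOps_le (pat : Pattern) : (hidOps Γ κ pat).length ≤ 2 * pat.length := by
  have := length_schedule_le (Γ.blockLen κ) (slotsOf .pub pat) (slotsOf .hid pat)
  rwa [length_slots] at this

theorem length_opsOf_le (v : Volume) (pat : Pattern) : (opsOf v pat).length ≤ pat.length := by
  refine (List.length_filterMap_le _ _).trans ?_
  have := length_slots pat
  cases v <;> omega

theorem length_flatMap_le {f : Pattern → List Op} {n : ℕ}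
    (h : ∀ pat, (f pat).length ≤ n * pat.length) (pats : List Pattern) :
    (pats.map f).flatten.length ≤ n * pats.flatten.length := by
  induction pats with
  | nil => simp
  | cons pat pats ih =>
    have := h pat
    simp only [List.map_cons, List.flatten_cons, List.length_append, Nat.mul_add]
    omega

theorem legitSeq_flatten {f : Pattern → List Op} {pats : List Pattern}
    (h : ∀ pat ∈ pats, Γ.LegitSeq κ (f pat)) : Γ.LegitSeq κ (pats.map f).flatten := by
  intro o ho
  simp only [List.mem_flatten, List.mem_map] at ho
  obtain ⟨_, ⟨pat, hp, rfl⟩, ho⟩ := ho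
  exact h pat hp o ho

/-- A union bound over the two marginals; their independence is not needed here. -/
theorem correct {Γ : ORAM} (h : Γ.Correct) : (hive Γ).Correct := by
  intro p
  -- A slot causes at most two requests to the hidden instance, a `Read` and a dummy `Write`.
  obtain ⟨ε, hε, he⟩ := h (2 * p)
  refine ⟨fun κ => ε κ + ε κ, hε.add hε, fun κ pats hall hlen => ?_⟩
  have hb : ∀ {n : ℕ} {f : Pattern → List Op}, n ≤ 2 → (∀ pat, (f pat).length ≤ n * pat.length) →
      (pats.map f).flatten.length ≤ (2 * p).eval κ := by
    intro n f hn hf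
    have h1 := length_flatMap_le hf pats
    have h2 : n * pats.flatten.length ≤ 2 * pats.flatten.length := Nat.mul_le_mul_right _ hn
    rw [Polynomial.eval_mul, Polynomial.eval_ofNat]
    omega
  have hp := he κ (pats.map (opsOf .pub)).flatten
    (legitSeq_flatten fun pat hpat => legit_opsOf (legit_of_allowed (hall pat hpat)))
    (hb (n := 1) (by omega) fun pat => by rw [one_mul]; exact length_opsOf_le _ _)
  have hh := he κ (pats.map (hidOps Γ κ)).flatten
    (legitSeq_flatten fun pat hpat => legit_hidOps (legit_of_allowed (hall pat hpat)))
    (hb (n := 2) le_rfl fun pat => length_hidOps_le pat)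
  have hp' := (Γ.prob_batchAnswers_le κ _).trans hp
  have hh' := (Γ.prob_batchAnswers_le κ _).trans hh
  rw [← run_map_pub, prob_map] at hp'
  rw [← run_map_hid, prob_map] at hh'
  refine le_trans ?_ (add_le_add hp' hh')
  refine le_trans (prob_mono _ fun c _ hc => ?_) (prob_or_le _ _ _)
  by_contra hcon
  rw [not_or, not_not, not_not] at hcon
  exact hc ⟨hcon.1, consistentSeq_hid pats hcon.2⟩

end Hive

/-! ### HIVE runs in polynomial time -/

namespace Hive

variable {Γ : ORAM} {κ : ℕ}

theorem legitSeq_flatMap {f : Pattern → List Op} {pats : List Pattern}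
    (h : ∀ pat ∈ pats, Γ.LegitSeq κ (f pat)) : Γ.LegitSeq κ (pats.flatMap f) := by
  intro o ho
  obtain ⟨pat, hp, ho⟩ := List.mem_flatMap.1 ho
  exact h pat hp o ho

theorem polyComp_hidOps {I : Type} {sz : I → ℕ} {α : Type} [Enc α] {x : I → α} {κ : I → ℕ}
    {pat : I → Pattern} (h : Γ.Efficient) (hκ : PolyComp sz x fun i => Unary.mk (κ i))
    (hs : PolyBdd sz κ) (hp : PolyComp sz x pat) :
    PolyComp sz x fun i => hidOps Γ (κ i) (pat i) :=
  PolyComp.schedule (len := fun i => Γ.blockLen (κ i)) (h.2.1.at hκ hs) (hp.slotsOf .pub)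
    (hp.slotsOf .hid)

theorem polyComp_flatMap_pub {I : Type} {sz : I → ℕ} {α : Type} [Enc α] {x : I → α}
    {pats : I → List Pattern} (hp : PolyComp sz x pats) :
    PolyComp sz x fun i => (pats i).flatMap (opsOf .pub) := by
  have hin : PolyComp encSize (fun z : Data × Pattern => z) _ := .input .self
  exact hp.flatMap (c := fun _ => Data.nil) (f := fun _ pat => opsOf .pub pat)
    (.const hp.input_bdd _) (hin.snd.opsOf .pub)

theorem polyComp_flatMap_hid {I : Type} {sz : I → ℕ} {α : Type} [Enc α] {x : I → α} {κ : I → ℕ}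
    {pats : I → List Pattern} (h : Γ.Efficient) (hκ : PolyComp sz x fun i => Unary.mk (κ i))
    (hs : PolyBdd sz κ) (hp : PolyComp sz x pats) :
    PolyComp sz x fun i => (pats i).flatMap (hidOps Γ (κ i)) := by
  have hin : PolyComp encSize (fun z : Unary × Pattern => z) _ := .input .self
  exact hp.flatMap (c := fun i => Unary.mk (Γ.blockLen (κ i)))
    (f := fun u pat => schedule u.val (slotsOf .pub pat) (slotsOf .hid pat)) (h.2.1.at hκ hs)
    (PolyComp.schedule (len := fun z : Unary × Pattern => z.1.val) hin.fst (hin.snd.slotsOf .pub)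
      (hin.snd.slotsOf .hid))

theorem efficient_oper (h : Γ.Efficient) :
    PolySamp (fun z : {z : ℕ × List Pattern × Pattern × PDScheme.Config //
        (∀ x ∈ z.2.1 ++ [z.2.2.1], (hive Γ).Allowed z.1 x) ∧
        Inv Γ z.1 (z.2.1.flatMap (opsOf .pub)) (z.2.1.flatMap (hidOps Γ z.1)) z.2.2.2} =>
        z.1.1 + encSize (z.1.2.1 ++ [z.1.2.2.1]))
      (fun z => (Unary.mk z.1.1, z.1.2.2.2.kpub, z.1.2.2.2.khid, z.1.2.2.2.st, z.1.2.2.2.dev,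
        z.1.2.2.1))
      fun z => (hive Γ).oper z.1.1 z.1.2.2.2.kpub z.1.2.2.2.khid z.1.2.2.2.st z.1.2.2.2.dev
        z.1.2.2.1 := by
  set H := {z : ℕ × List Pattern × Pattern × PDScheme.Config //
        (∀ x ∈ z.2.1 ++ [z.2.2.1], (hive Γ).Allowed z.1 x) ∧
        Inv Γ z.1 (z.2.1.flatMap (opsOf .pub)) (z.2.1.flatMap (hidOps Γ z.1)) z.2.2.2} with hH
  set sz := fun z : H => z.1.1 + encSize (z.1.2.1 ++ [z.1.2.2.1]) with hsz
  have hκ : PolyBdd sz fun z => z.1.1 := PolyBdd.self.mono fun z => Nat.le_add_right _ _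
  have hpats := PolyComp.input (sz := sz)
    (x := fun z : H => (Unary.mk z.1.1, z.1.2.1 ++ [z.1.2.2.1]))
    ((PolyBdd.self.mul (.const 3)).mono fun z => by
      have := encSize_pos (z.1.2.1 ++ [z.1.2.2.1])
      simp only [encSize_pair, encSize_unary, hsz]; omega)
  have hbp := (polyComp_flatMap_pub hpats.snd).bdd
  have hbh := (polyComp_flatMap_hid h hpats.fst hκ hpats.snd).bdd
  obtain ⟨p, hp⟩ := h.reachable_bdd
  have hin := PolyComp.input (sz := sz) (x := fun z : H => (Unary.mk z.1.1, z.1.2.2.2.kpub,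
      z.1.2.2.2.khid, z.1.2.2.2.st, z.1.2.2.2.dev, z.1.2.2.1)) <| by
    refine PolyBdd.mono ((hpats.bdd.add (((hκ.add (.const 1)).eval p).mul (.const 2))).add
      ((((hκ.add hbp).eval p).add ((hκ.add hbh).eval p)).mul (.const 5) |>.add (.const 10))) ?_
    rintro ⟨⟨κ, pats, pat, c⟩, hall, hc⟩
    simp only at hall hc ⊢
    -- The keys are initial private states, hence bounded like states reached by the empty request
    -- sequence.
    obtain ⟨dp, hkp⟩ := hc.kpub
    obtain ⟨dh, hkh⟩ := hc.khid
    have h1 := hp κ [] _ _ (fun o ho => absurd ho List.not_mem_nil) hkp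
    have h2 := hp κ [] _ _ (fun o ho => absurd ho List.not_mem_nil) hkh
    rw [encSize_nil] at h1 h2
    have hall' : ∀ x ∈ pats, (hive Γ).Allowed κ x := fun x hx =>
      hall x (List.mem_append_left _ hx)
    have h3 := hp κ _ _ _ (legitSeq_flatMap (f := opsOf .pub) fun x hx => legit_opsOf
        (legit_of_allowed
      (hall' x hx))) hc.pub
    have h4 := hp κ _ _ _ (legitSeq_flatMap (f := hidOps Γ κ) fun x hx => legit_hidOps
        (legit_of_allowed
      (hall' x hx))) hc.hid
    have h5 := hc.tagged.encSize_le
    obtain ⟨sp, sh, hst⟩ := hc.state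
    have h6 : encSize c.st = encSize c.st.left + encSize c.st.right + 1 := by rw [hst]; rfl
    have h7 : encSize (pats ++ [pat]) = encSize pats + encSize pat + 1 := by
      have := encSize_append pats [pat]
      have e : encSize [pat] = encSize pat + 1 + 1 := rfl
      omega
    have h8 : ∀ f : Pattern → List Op,
        encSize (pats.flatMap f) ≤ encSize ((pats ++ [pat]).flatMap f) := by
      intro f
      rw [List.flatMap_append]
      have := encSize_append (pats.flatMap f) ([pat].flatMap f)
      have e := encSize_pos ([pat].flatMap f)
      omega
    have h9 := p.eval_nat_mono (Nat.add_le_add_left (h8 (opsOf .pub)) κ)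
    have h10 := p.eval_nat_mono (Nat.add_le_add_left (h8 (hidOps Γ κ)) κ)
    simp only [encSize_pair]
    rw [h6, h7]
    omega
  have hall : ∀ z : H, (∀ x ∈ z.1.2.1, (hive Γ).Allowed z.1.1 x) ∧
      (hive Γ).Allowed z.1.1 z.1.2.2.1 := fun z =>
    ⟨fun x hx => z.2.1 x (List.mem_append_left _ hx), z.2.1 _ (by simp)⟩
  let ep : H → Γ.ExecIndex := fun z => ⟨(z.1.1, z.1.2.1.flatMap (opsOf .pub),
    opsOf .pub z.1.2.2.1, z.1.2.2.2.st.left, half false z.1.2.2.2.dev),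
    ORAM.legitSeq_append.2 ⟨legitSeq_flatMap fun x hx => legit_opsOf
      (legit_of_allowed ((hall z).1 x hx)), legit_opsOf (legit_of_allowed (hall z).2)⟩, z.2.2.pub⟩
  let eh : H → Γ.ExecIndex := fun z => ⟨(z.1.1, z.1.2.1.flatMap (hidOps Γ z.1.1),
    hidOps Γ z.1.1 z.1.2.2.1, z.1.2.2.2.st.right, half true z.1.2.2.2.dev),
    ORAM.legitSeq_append.2 ⟨legitSeq_flatMap fun x hx => legit_hidOps
      (legit_of_allowed ((hall z).1 x hx)), legit_hidOps (legit_of_allowed (hall z).2)⟩, z.2.2.hid⟩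
  have hflat : ∀ (f : Pattern → List Op) (z : H),
      z.1.2.1.flatMap f ++ f z.1.2.2.1 = (z.1.2.1 ++ [z.1.2.2.1]).flatMap f := by
    intro f z; simp
  have hxp : PolySamp sz _ _ := (h.exec.reindex ep).resize
    ((hκ.add hbp).mono fun z => (congrArg (fun l => z.1.1 + encSize l) (hflat _ z)).le)
  have hxh : PolySamp sz _ _ := (h.exec.reindex eh).resize
    ((hκ.add hbh).mono fun z => (congrArg (fun l => z.1.1 + encSize l) (hflat _ z)).le)
  have hst := hin.snd.snd.snd.fst
  have hdev := hin.snd.snd.snd.snd.fst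
  have hpat := hin.snd.snd.snd.snd.snd
  have hxp' := hxp.comp (hin.fst.pair ((hst.ofLeft (f := fun z => z.1.2.2.2.st.left)
    fun _ => rfl).pair ((hdev.half false).pair (hpat.opsOf .pub))))
  have hxh' := hxh.comp (hin.fst.pair ((hst.ofRight (f := fun z => z.1.2.2.2.st.right)
    fun _ => rfl).pair ((hdev.half true).pair (polyComp_hidOps h hin.fst hκ hpat))))
  simp only [oper_eq]
  refine PolySamp.bind hxp' ?_
  have hin' := hxp'.bindInput
  have hxh'' := (hxh'.reindex _).comp hin'.fst
  refine PolySamp.bind hxh'' ?_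
  have hin'' := hxh''.bindInput
  exact PolyComp.pair (hin''.fst.snd.fst.ofCons hin''.snd.fst fun _ => rfl)
    (((hin''.fst.snd.snd.snd.fst.tag false).append (hin''.snd.snd.snd.fst.tag true)).pair
      (hin''.fst.snd.snd.snd.snd.pair hin''.snd.snd.snd.snd))

theorem efficient_setup (h : Γ.Efficient) : SamplableInPolyTime (hive Γ).setup := by
  have hs := h.2.2.1.polySamp
  refine PolySamp.samplable (PolySamp.bind hs ?_)
  have hin := hs.bindInput
  have hs' := (hs.reindex _).comp hin.fst
  refine PolySamp.bind hs' ?_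
  have hin' := hs'.bindInput
  exact hin'.fst.snd.fst.pair (hin'.snd.fst.pair (PolyComp.pair
    (hin'.fst.snd.fst.ofCons hin'.snd.fst fun _ => rfl)
    ((hin'.fst.snd.snd.tag false).append (hin'.snd.snd.tag true))))

theorem efficient (h : Γ.Efficient) : (hive Γ).Efficient := by
  refine ⟨h.1, ?_, h.2.1, efficient_setup h, ?_⟩
  · refine PolyComp.computable (h.1.polyComp.ofRight fun κ => ?_)
    -- Halving drops the lowest bit, which is the head of the list of bits.
    change Enc.enc (Nat.bits (Γ.cap κ / 2)) = (Enc.enc (Nat.bits (Γ.cap κ))).right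
    rw [← Nat.div2_val, Nat.div2_bits_eq_tail]
    cases Nat.bits (Γ.cap κ) <;> rfl
  · obtain ⟨P, p, hP⟩ := efficient_oper h
    refine ⟨P, p, fun κ pats pat hall c hc => ?_⟩
    exact hP ⟨(κ, pats, pat, c.1), hall, inv_run hc⟩

end Hive

/-! ### Injective encodings -/

/-- Different objects have different encodings. -/
class EncInj (α : Type) [Enc α] : Prop where
  inj : Function.Injective (Enc.enc : α → Data)

section

variable {α β : Type} [Enc α] [Enc β]

instance : EncInj Data := ⟨fun _ _ h => h⟩

instance : EncInj Bool := ⟨by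
  rintro (_ | _) (_ | _) h
  · rfl
  · nomatch h
  · nomatch h
  · rfl⟩

instance [EncInj α] [EncInj β] : EncInj (α × β) := ⟨by
  rintro ⟨a, b⟩ ⟨a', b'⟩ h
  obtain ⟨h1, h2⟩ := Data.cons.inj h
  exact Prod.ext (EncInj.inj h1) (EncInj.inj h2)⟩

instance [EncInj α] : EncInj (List α) := ⟨by
  intro l
  induction l with
  | nil =>
    rintro (_ | ⟨b, l'⟩) h
    · rfl
    · nomatch h
  | cons a l ih =>
    rintro (_ | ⟨b, l'⟩) h
    · nomatch h
    · obtain ⟨h1, h2⟩ := Data.cons.inj h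
      rw [EncInj.inj h1, ih h2]⟩

theorem Nat.bits_injective : Function.Injective Nat.bits := by
  intro m
  induction m using Nat.strong_induction_on with
  | _ m ih =>
    intro n h
    rcases Nat.eq_zero_or_pos m with rfl | hm
    · rcases Nat.eq_zero_or_pos n with rfl | hn
      · rfl
      · have := Nat.size_eq_bits_len n
        rw [← h] at this
        simp only [Nat.zero_bits, List.length_nil] at this
        exact (Nat.size_eq_zero.1 this.symm).symm
    · have h1 : m.div2 = n.div2 := by
        refine ih _ ?_ ?_
        · rw [Nat.div2_val]; omega
        · rw [Nat.div2_bits_eq_tail, Nat.div2_bits_eq_tail, h]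
      have h2 : m.bodd = n.bodd := by
        rw [Nat.bodd_eq_bits_head, Nat.bodd_eq_bits_head, h]
      rw [← Nat.bit_bodd_div2 m, ← Nat.bit_bodd_div2 n, h1, h2]

instance : EncInj ℕ := ⟨fun _ _ h => Nat.bits_injective (EncInj.inj (α := List Bool) h)⟩

instance : EncInj Op := ⟨by
  rintro (a | ⟨a, d⟩) (a' | ⟨a', d'⟩) h
  · rw [EncInj.inj (Data.cons.inj h).2]
  · nomatch (Data.cons.inj h).1
  · nomatch (Data.cons.inj h).1
  · obtain ⟨h1, h2⟩ := Data.cons.inj (Data.cons.inj h).2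
    rw [EncInj.inj h1, EncInj.inj (α := List Bool) h2]⟩

instance : EncInj Access := ⟨by
  rintro (a | ⟨a, d⟩) (a' | ⟨a', d'⟩) h
  · rw [EncInj.inj (Data.cons.inj h).2]
  · nomatch (Data.cons.inj h).1
  · nomatch (Data.cons.inj h).1
  · obtain ⟨h1, h2⟩ := Data.cons.inj (Data.cons.inj h).2
    rw [EncInj.inj h1, EncInj.inj (α := List Bool) h2]⟩

end

instance : Inhabited Data := ⟨.nil⟩

/-! ### Adversaries with structured states -/

/-- An adversary whose states are of type `σ`. -/
structure TypedAdversary (σ Init Query Reply : Type) where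
  start : ℕ → Init → PMF σ
  ask : ℕ → σ → PMF (Option Query × σ)
  tell : ℕ → σ → Reply → PMF σ
  guess : ℕ → σ → PMF Bool

namespace TypedAdversary

variable {σ Init Query Reply : Type}

/-- Play the given number of rounds. -/
noncomputable def play {S : Type} (T : TypedAdversary σ Init Query Reply) (κ : ℕ)
    (respond : S → Query → PMF (S × Reply)) : ℕ → S → σ → PMF Bool
  | 0, _, a => T.guess κ a
  | k + 1, c, a =>
      (T.ask κ a).bind fun x =>
        match x.1 with
        | none => play T κ respond k c x.2
        | some q =>
            (respond c q).bind fun y =>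
              (T.tell κ x.2 y.2).bind fun a' => play T κ respond k y.1 a'

variable [Enc σ] [Nonempty σ]

/-- The state with a given encoding. -/
noncomputable def decode (σ : Type) [Enc σ] [Nonempty σ] : Data → σ := Function.invFun Enc.enc

theorem decode_enc [EncInj σ] (s : σ) : decode σ (Enc.enc s) = s :=
  Function.leftInverse_invFun EncInj.inj s

/-- Encode the states. -/
noncomputable def toAdversary (T : TypedAdversary σ Init Query Reply) :
    Adversary Init Query Reply where
  start κ m := (T.start κ m).map Enc.enc
  ask κ d := (T.ask κ (decode σ d)).map fun x => (x.1, Enc.enc x.2)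
  tell κ d m := (T.tell κ (decode σ d) m).map Enc.enc
  guess κ d := T.guess κ (decode σ d)

theorem toAdversary_play [EncInj σ] {S : Type} (T : TypedAdversary σ Init Query Reply) (κ : ℕ)
    (respond : S → Query → PMF (S × Reply)) (k : ℕ) : ∀ (c : S) (s : σ),
    T.toAdversary.play κ respond k c (Enc.enc s) = T.play κ respond k c s := by
  induction k with
  | zero => intro c s; simp only [Adversary.play, play, toAdversary, decode_enc]
  | succ k ih =>
    intro c s
    rw [Adversary.play, play, show T.toAdversary.ask κ (Enc.enc s) =
      (T.ask κ s).map fun x => (x.1, Enc.enc x.2) by simp only [toAdversary, decode_enc],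
      PMF.bind_map]
    refine congrArg _ (funext fun x => ?_)
    obtain ⟨q, s'⟩ := x
    cases q with
    | none => exact ih c s'
    | some q =>
      simp only [Function.comp_apply]
      refine congrArg _ (funext fun y => ?_)
      rw [show T.toAdversary.tell κ (Enc.enc s') y.2 = (T.tell κ s' y.2).map Enc.enc by
        simp only [toAdversary, decode_enc], PMF.bind_map]
      exact congrArg _ (funext fun s'' => ih y.1 s'')

variable [Enc Init] [Enc Reply]

/-- Only encodings of states are ever reached, so the arbitrary values of `decode` elsewhere do not
matter. -/
theorem exists_of_reach [EncInj σ] {T : TypedAdversary σ Init Query Reply} {r : Polynomial ℕ}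
    {κ : ℕ} (Inv : ℕ → ℕ → σ → Prop)
    (h0 : ∀ m, ∀ s ∈ (T.start κ m).support, Inv 0 (encSize m) s)
    (hpass : ∀ i n s s', i < r.eval κ → Inv i n s → (none, s') ∈ (T.ask κ s).support →
      Inv (i + 1) n s')
    (hround : ∀ i n s s' s'' q m, i < r.eval κ → Inv i n s → (some q, s') ∈ (T.ask κ s).support →
      s'' ∈ (T.tell κ s' m).support → Inv (i + 1) (n + encSize m) s'')
    {i n : ℕ} {d : Data} (h : T.toAdversary.Reach κ i n d) :
    i ≤ r.eval κ → ∃ s, d = Enc.enc s ∧ Inv i n s := by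
  induction h with
  | start m d hd =>
    intro _
    obtain ⟨s, hs, rfl⟩ := (PMF.mem_support_map_iff _ _ _).1 hd
    exact ⟨s, rfl, h0 m s hs⟩
  | pass i n d d' _ ha ih =>
    intro hi
    obtain ⟨s, rfl, hs⟩ := ih (by omega)
    obtain ⟨⟨q, s'⟩, hs', he⟩ := (PMF.mem_support_map_iff _ _ _).1 ha
    rw [decode_enc] at hs'
    obtain ⟨rfl, rfl⟩ := Prod.mk.inj he
    exact ⟨s', rfl, hpass i n s s' (by omega) hs hs'⟩
  | round i n d d' d'' q m _ ha ht ih =>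
    intro hi
    obtain ⟨s, rfl, hs⟩ := ih (by omega)
    obtain ⟨⟨q, s'⟩, hs', he⟩ := (PMF.mem_support_map_iff _ _ _).1 ha
    rw [decode_enc] at hs'
    obtain ⟨rfl, rfl⟩ := Prod.mk.inj he
    obtain ⟨s'', hs'', rfl⟩ := (PMF.mem_support_map_iff _ _ _).1 ht
    simp only [decode_enc] at hs''
    exact ⟨s'', rfl, hround i n s s' s'' q m (by omega) hs hs' hs''⟩

/-- Reachability admits arbitrary messages, so the invariant has to survive every message and not
only those of an honest challenger. In return the programs, and the bounds on queries, are needed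
only under the invariant. -/
theorem isPPT [Enc Query] [EncInj σ] (T : TypedAdversary σ Init Query Reply) (Valid : ℕ → Query →
    Prop)
    (r : Polynomial ℕ) (Inv : ℕ → ℕ → ℕ → σ → Prop)
    (h0 : ∀ κ m, ∀ s ∈ (T.start κ m).support, Inv κ 0 (encSize m) s)
    (hpass : ∀ κ i n s s', i < r.eval κ → Inv κ i n s → (none, s') ∈ (T.ask κ s).support →
      Inv κ (i + 1) n s')
    (hround : ∀ κ i n s s' s'' q m, i < r.eval κ → Inv κ i n s →
      (some q, s') ∈ (T.ask κ s).support → s'' ∈ (T.tell κ s' m).support →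
      Inv κ (i + 1) (n + encSize m) s'')
    (hvalid : ∃ p : Polynomial ℕ, ∀ κ i n s q s', i < r.eval κ → Inv κ i n s →
      (some q, s') ∈ (T.ask κ s).support → Valid κ q ∧ encSize q ≤ p.eval κ)
    (hstart : PolySamp (fun z : ℕ × Init => z.1 + encSize z.2) (fun z => (Unary.mk z.1, z.2))
      fun z => T.start z.1 z.2)
    (hask : PolySamp (fun z : {z : ℕ × ℕ × ℕ × σ // z.2.1 < r.eval z.1 ∧
        Inv z.1 z.2.1 z.2.2.1 z.2.2.2} => z.1.1 + z.1.2.2.1)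
      (fun z => (Unary.mk z.1.1, z.1.2.2.2)) fun z => T.ask z.1.1 z.1.2.2.2)
    (htell : PolySamp (fun z : {z : ℕ × ℕ × ℕ × σ × Query × σ × Reply // z.2.1 < r.eval z.1 ∧
        Inv z.1 z.2.1 z.2.2.1 z.2.2.2.1 ∧
        (some z.2.2.2.2.1, z.2.2.2.2.2.1) ∈ (T.ask z.1 z.2.2.2.1).support} =>
        z.1.1 + z.1.2.2.1 + encSize z.1.2.2.2.2.2.2)
      (fun z => (Unary.mk z.1.1, z.1.2.2.2.2.2.1, z.1.2.2.2.2.2.2))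
      fun z => T.tell z.1.1 z.1.2.2.2.2.2.1 z.1.2.2.2.2.2.2)
    (hguess : PolySamp (fun z : {z : ℕ × ℕ × σ // Inv z.1 (r.eval z.1) z.2.1 z.2.2} =>
        z.1.1 + z.1.2.1)
      (fun z => (Unary.mk z.1.1, z.1.2.2)) fun z => T.guess z.1.1 z.1.2.2) :
    T.toAdversary.IsPPT Valid r := by
  obtain ⟨p₀, hp₀⟩ := hvalid
  obtain ⟨P₁, p₁, h₁⟩ := hstart
  obtain ⟨P₂, p₂, h₂⟩ := hask
  obtain ⟨P₃, p₃, h₃⟩ := htell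
  obtain ⟨P₄, p₄, h₄⟩ := hguess
  refine ⟨P₁, P₂, P₃, P₄, p₀ + p₁ + p₂ + p₃ + p₄, fun κ => ⟨fun m => ?_, ?_, ?_⟩⟩
  · refine Runs.mono (t := p₁.eval (κ + encSize m)) ?_ (by
      simp only [Polynomial.eval_add]; omega)
    have h := h₁ (κ, m)
    simp only [toAdversary, PMF.map_comp]
    exact h
  · intro i n d hi hr
    obtain ⟨s, rfl, hs⟩ := exists_of_reach (Inv κ) (h0 κ) (hpass κ) (hround κ) hr hi.le
    constructor
    · refine Runs.mono (t := p₂.eval (κ + n)) ?_ (by simp only [Polynomial.eval_add]; omega)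
      have h := h₂ ⟨(κ, i, n, s), hi, hs⟩
      simp only [toAdversary, PMF.map_comp, decode_enc]
      exact h
    · intro q d' hq
      obtain ⟨⟨q', s'⟩, hs', he⟩ := (PMF.mem_support_map_iff _ _ _).1 hq
      rw [decode_enc] at hs'
      obtain ⟨rfl, rfl⟩ := Prod.mk.inj he
      obtain ⟨hv, hsz⟩ := hp₀ κ i n s q s' hi hs hs'
      refine ⟨hv, hsz.trans (by simp only [Polynomial.eval_add]; omega), fun m => ?_⟩
      refine Runs.mono (t := p₃.eval (κ + n + encSize m)) ?_
        (by simp only [Polynomial.eval_add]; omega)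
      have h := h₃ ⟨(κ, i, n, s, q, s', m), hi, hs, hs'⟩
      simp only [toAdversary, PMF.map_comp, decode_enc]
      exact h
  · intro n d hr
    obtain ⟨s, rfl, hs⟩ := exists_of_reach (Inv κ) (h0 κ) (hpass κ) (hround κ) hr le_rfl
    refine Runs.mono (t := p₄.eval (κ + n)) ?_ (by simp only [Polynomial.eval_add]; omega)
    have h := h₄ ⟨(κ, n, s), hs⟩
    simp only [toAdversary, decode_enc]
    exact h

end TypedAdversary

namespace Adversary

variable {Init Query Reply : Type} [Enc Init] [Enc Query] [Enc Reply]
  {A : Adversary Init Query Reply} {Valid : ℕ → Query → Prop} {r : Polynomial ℕ}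

theorem IsPPT.start (h : A.IsPPT Valid r) :
    PolySamp (fun z : ℕ × Init => z.1 + encSize z.2) (fun z => (Unary.mk z.1, z.2))
      fun z => A.start z.1 z.2 := by
  obtain ⟨P₁, P₂, P₃, P₄, p, h⟩ := h
  exact ⟨P₁, p, fun z => (h z.1).1 z.2⟩

theorem IsPPT.ask (h : A.IsPPT Valid r) :
    PolySamp (fun z : {z : ℕ × ℕ × ℕ × Data // z.2.1 < r.eval z.1 ∧
        A.Reach z.1 z.2.1 z.2.2.1 z.2.2.2} => z.1.1 + z.1.2.2.1)
      (fun z => (Unary.mk z.1.1, z.1.2.2.2)) fun z => A.ask z.1.1 z.1.2.2.2 := by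
  obtain ⟨P₁, P₂, P₃, P₄, p, h⟩ := h
  exact ⟨P₂, p, fun z => ((h z.1.1).2.1 _ _ _ z.2.1 z.2.2).1⟩

theorem IsPPT.tell (h : A.IsPPT Valid r) :
    PolySamp (fun z : {z : ℕ × ℕ × ℕ × Data × Query × Data × Reply // z.2.1 < r.eval z.1 ∧
        A.Reach z.1 z.2.1 z.2.2.1 z.2.2.2.1 ∧
        (some z.2.2.2.2.1, z.2.2.2.2.2.1) ∈ (A.ask z.1 z.2.2.2.1).support} =>
        z.1.1 + z.1.2.2.1 + encSize z.1.2.2.2.2.2.2)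
      (fun z => (Unary.mk z.1.1, z.1.2.2.2.2.2.1, z.1.2.2.2.2.2.2))
      fun z => A.tell z.1.1 z.1.2.2.2.2.2.1 z.1.2.2.2.2.2.2 := by
  obtain ⟨P₁, P₂, P₃, P₄, p, h⟩ := h
  exact ⟨P₃, p, fun z => (((h z.1.1).2.1 _ _ _ z.2.1 z.2.2.1).2 _ _ z.2.2.2).2.2 _⟩

theorem IsPPT.guess (h : A.IsPPT Valid r) :
    PolySamp (fun z : {z : ℕ × ℕ × Data // A.Reach z.1 (r.eval z.1) z.2.1 z.2.2} => z.1.1 + z.1.2.1)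
      (fun z => (Unary.mk z.1.1, z.1.2.2)) fun z => A.guess z.1.1 z.1.2.2 := by
  obtain ⟨P₁, P₂, P₃, P₄, p, h⟩ := h
  exact ⟨P₄, p, fun z => (h z.1.1).2.2 _ _ z.2⟩

theorem IsPPT.valid (h : A.IsPPT Valid r) : ∃ p : Polynomial ℕ, ∀ κ i n s q s', i < r.eval κ →
    A.Reach κ i n s → (some q, s') ∈ (A.ask κ s).support → Valid κ q ∧ encSize q ≤ p.eval κ := by
  obtain ⟨P₁, P₂, P₃, P₄, p, h⟩ := h
  exact ⟨p, fun κ i n s q s' hi hr hq =>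
    ⟨(((h κ).2.1 i n s hi hr).2 q s' hq).1, (((h κ).2.1 i n s hi hr).2 q s' hq).2.1⟩⟩

end Adversary

/-! ### The guessing game -/

namespace PDScheme

/-- The output of the adversary when the challenge bit is `b`. -/
noncomputable def world (D : PDScheme) (A : Coercer) (r : Polynomial ℕ) (b : Bool) (κ : ℕ) :
    PMF Bool :=
  (D.initial κ).bind fun c => (A.start κ (c.1.kpub, wOnly c.2)).bind fun a =>
    A.play κ (D.respond κ b) (r.eval κ) c.1 a

theorem game_eq (D : PDScheme) (A : Coercer) (r : Polynomial ℕ) (κ : ℕ) : D.game A r κ =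
    (PMF.uniformOfFintype Bool).bind fun b => (D.world A r b κ).map fun g => g == b := by
  simp only [game, world, PMF.map_bind]
  rw [PMF.bind_comm]
  refine congrArg _ (funext fun c => ?_)
  rw [PMF.bind_comm]
  rfl

end PDScheme

theorem prob_uniform_bind (f : Bool → PMF Bool) (E : Bool → Prop) :
    prob ((PMF.uniformOfFintype Bool).bind f) E = (prob (f true) E + prob (f false) E) / 2 := by
  rw [prob, PMF.toOuterMeasure_bind_apply, tsum_bool]
  simp only [PMF.uniformOfFintype_apply, Fintype.card_bool]
  rw [ENNReal.toReal_add, ENNReal.toReal_mul, ENNReal.toReal_mul]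
  · simp [prob]; ring
  · exact ENNReal.mul_ne_top (by simp) (prob_ne_top _ _)
  · exact ENNReal.mul_ne_top (by simp) (prob_ne_top _ _)

theorem prob_eq_false (μ : PMF Bool) : prob μ (· = false) = 1 - prob μ (· = true) := by
  have h := μ.tsum_coe
  rw [tsum_bool] at h
  have e : ∀ b : Bool, prob μ (· = b) = (μ b).toReal := by
    intro b
    rw [prob, show {x : Bool | x = b} = {b} from rfl, PMF.toOuterMeasure_apply_singleton]
  rw [e, e, eq_sub_iff_add_eq, ← ENNReal.toReal_add (μ.apply_ne_top _) (μ.apply_ne_top _), h,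
    ENNReal.toReal_one]

/-- If `p₁` and `p₀` are the probabilities of output 1 in the two worlds, the guess is right with
probability `(p₁ + (1 - p₀)) / 2`. -/
theorem PDScheme.abs_prob_game (D : PDScheme) (A : Coercer) (r : Polynomial ℕ) (κ : ℕ) :
    |prob (D.game A r κ) (· = true) - 1 / 2| =
      |prob (D.world A r true κ) (· = true) - prob (D.world A r false κ) (· = true)| / 2 := by
  rw [game_eq, prob_uniform_bind, prob_map, prob_map]
  have h1 : (fun a : Bool => (a == true) = true) = (· = true) := by funext a; simp
  have h2 : (fun a : Bool => (a == false) = true) = (· = false) := by funext a; simp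
  rw [h1, h2, prob_eq_false, ← abs_two, ← abs_div, abs_two]
  congr 1
  ring

namespace Hive

variable {Γ : ORAM} {κ : ℕ}

/-! ### Valid queries -/

theorem slotsOf_of_vol {v : Volume} {pat : Pattern} (h : ∀ r ∈ pat, r.vol = v) :
    slotsOf v pat = pat.map Request.op := by
  rw [slotsOf, List.filter_eq_self.2 fun r hr => by simp [h r hr]]

theorem slotsOf_of_vol_ne {v w : Volume} (hvw : w ≠ v) {pat : Pattern}
    (h : ∀ r ∈ pat, r.vol = w) : slotsOf v pat = [] := by
  rw [slotsOf, List.filter_eq_nil_iff.2 fun r hr => by simp [h r hr, hvw], List.map_nil]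

theorem opsOf_of_vol_ne {v w : Volume} (hvw : w ≠ v) {pat : Pattern}
    (h : ∀ r ∈ pat, r.vol = w) : opsOf v pat = [] := by
  rw [opsOf, slotsOf_of_vol_ne hvw h]; rfl

theorem writeCount_append (y y' : List Op) :
    writeCount (y ++ y') = writeCount y + writeCount y' := List.countP_append ..

/-- A public data request comes with exactly one hidden `Write`, whether real or dummy, and a public
dummy with none. The hypothesis excludes the only exception, a hidden `Write` next to a dummy. -/
theorem writeCount_slot (len : ℕ) {p h : Option Op}
    (hr : ∀ o, h = some o → o.isWrite = true → p.isSome = true) :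
    writeCount (slot len p none) = writeCount (slot len p h) := by
  rcases h with _ | ⟨a⟩ | ⟨a, d⟩
  · rfl
  · simp only [slot, writeCount, List.countP_cons, Op.isWrite]; simp
  · have := hr _ rfl rfl
    simp [slot, dummyAccess, this, writeCount, Op.isWrite]

theorem writeCount_schedule (len : ℕ) {P Q : Pattern} (h : List.Forall₂
    (fun p h : Request => ∀ o, h.op = some o → o.isWrite = true → p.op.isSome = true) P Q) :
    writeCount (schedule len (P.map Request.op) []) =
      writeCount (schedule len (P.map Request.op) (Q.map Request.op)) := by
  induction h with
  | nil => rfl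
  | cons h _ ih =>
    simp only [List.map_cons, schedule, writeCount_append, ih, writeCount_slot len h]

theorem hidOps_pub {q : Pattern × Pattern × Pattern} (hq : (hive Γ).ValidQuery κ q) :
    hidOps Γ κ q.1 = schedule (Γ.blockLen κ) (q.1.map Request.op) [] := by
  have h1 : ∀ r ∈ q.1, r.vol = .pub := fun r hr => hq.pub_only r (List.mem_append_left _ hr)
  rw [hidOps, slotsOf_of_vol h1, slotsOf_of_vol_ne (by decide) h1]

theorem hidOps_hid {q : Pattern × Pattern × Pattern} (hq : (hive Γ).ValidQuery κ q) :
    hidOps Γ κ (q.1 ++ q.2.2) =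
      schedule (Γ.blockLen κ) (q.1.map Request.op) (q.2.2.map Request.op) := by
  have h1 : ∀ r ∈ q.1, r.vol = .pub := fun r hr => hq.pub_only r (List.mem_append_left _ hr)
  rw [hidOps, slotsOf_append, slotsOf_append, slotsOf_of_vol h1, slotsOf_of_vol hq.hid_only,
    slotsOf_of_vol_ne (by decide) h1, slotsOf_of_vol_ne (by decide) hq.hid_only, List.append_nil,
    List.nil_append]

theorem validQuery_hidOps {q : Pattern × Pattern × Pattern} (hq : (hive Γ).ValidQuery κ q) :
    Γ.ValidQuery κ (hidOps Γ κ q.1, hidOps Γ κ (q.1 ++ q.2.2)) := by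
  have hl := hq.legit
  simp only [List.mem_append] at hl
  refine ⟨legit_hidOps fun r hr => hl r (.inl (.inl hr)), legit_hidOps fun r hr => ?_, ?_⟩
  · rcases List.mem_append.1 hr with hr | hr
    · exact hl r (.inl (.inl hr))
    · exact hl r (.inr hr)
  · simp only [hidOps_pub hq, hidOps_hid hq]
    exact writeCount_schedule _ hq.rule₁

/-- The public instance is treated alike for both values of the challenge bit, so the distinguisher
can operate it without knowing the bit. -/
theorem opsOf_query {q : Pattern × Pattern × Pattern} (hq : (hive Γ).ValidQuery κ q) (b : Bool) :
    opsOf .pub (q.1 ++ if b then q.2.2 else q.2.1) = opsOf .pub q.1 := by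
  have h2 : q.2.1 = [] := hq.rule₂
  cases b
  · simp [h2]
  · rw [if_pos rfl, opsOf_append, opsOf_of_vol_ne (by decide) hq.hid_only, List.append_nil]

theorem hidOps_query {q : Pattern × Pattern × Pattern} (hq : (hive Γ).ValidQuery κ q) (b : Bool) :
    hidOps Γ κ (q.1 ++ if b then q.2.2 else q.2.1) =
      if b then hidOps Γ κ (q.1 ++ q.2.2) else hidOps Γ κ q.1 := by
  have h2 : q.2.1 = [] := hq.rule₂
  cases b <;> simp [h2]

/-! ### Simulating the public volume -/

/-- Set up the public instance, next to a hidden instance whose initialization writes `m`: private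
state, device and physical `Write`s. -/
noncomputable def simStart (Γ : ORAM) (κ : ℕ) (m : Trace) : PMF (Data × Device × Trace) :=
  (Γ.setup κ).bind fun p => PMF.pure (p.1, Device.exec [] (tag false p.2 ++ tag true m),
    tag false (wOnly p.2) ++ tag true m)

/-- Execute requests on the public instance, while the hidden instance writes `m`. -/
noncomputable def simTell (Γ : ORAM) (κ : ℕ) (sp : Data) (dev : Device) (y : List Op) (m : Trace) :
    PMF (Data × Device × Trace) :=
  (Γ.exec κ sp (half false dev) y).bind fun p =>
    PMF.pure (p.1, dev.exec (tag false p.2.2.1 ++ tag true m),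
      tag false (wOnly p.2.2.1) ++ tag true m)

/-- The state of the distinguisher: the state of the coercer, the public instance, the device, and
the public requests to be executed. -/
abbrev SimState := Data × Data × Device × List Op

/-- The distinguisher that simulates the public volume for a coercer, and plays against the hidden
instance. -/
noncomputable def distinguisher (Γ : ORAM) (A : PDScheme.Coercer) :
    TypedAdversary SimState Trace (List Op × List Op) Trace where
  start κ m := (simStart Γ κ m).bind fun u =>
    (A.start κ (u.1, u.2.2)).bind fun a => PMF.pure (a, u.1, u.2.1, [])
  ask κ s := (A.ask κ s.1).bind fun x =>
    match x.1 with
    | none => PMF.pure (none, x.2, s.2.1, s.2.2.1, [])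
    | some q => PMF.pure (some (hidOps Γ κ q.1, hidOps Γ κ (q.1 ++ q.2.2)), x.2, s.2.1, s.2.2.1,
        opsOf .pub q.1)
  tell κ s m := (simTell Γ κ s.2.1 s.2.2.1 s.2.2.2 m).bind fun u =>
    (A.tell κ s.1 (u.2.1, u.2.2)).bind fun a => PMF.pure (a, u.1, u.2.1, [])
  guess κ s := A.guess κ s.1

theorem distinguisher_ask (A : PDScheme.Coercer) (s : SimState) :
    (distinguisher Γ A).ask κ s = (A.ask κ s.1).bind fun x =>
      match x.1 with
      | none => PMF.pure (none, x.2, s.2.1, s.2.2.1, [])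
      | some q => PMF.pure (some (hidOps Γ κ q.1, hidOps Γ κ (q.1 ++ q.2.2)), x.2, s.2.1, s.2.2.1,
          opsOf .pub q.1) := rfl

theorem distinguisher_tell (A : PDScheme.Coercer) (s : SimState) (m : Trace) :
    (distinguisher Γ A).tell κ s m = (simTell Γ κ s.2.1 s.2.2.1 s.2.2.2 m).bind fun u =>
      (A.tell κ s.1 (u.2.1, u.2.2)).bind fun a => PMF.pure (a, u.1, u.2.1, []) := rfl

theorem exec_tag_wOnly (dev : Device) (tp th : Trace) :
    dev.exec (tag false tp ++ tag true (wOnly th)) = dev.exec (tag false tp ++ tag true th) := by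
  rw [← wOnly_tag, Device.exec_append, exec_wOnly, ← Device.exec_append]

/-- The simulation is exact round by round: the challenger holds the state of the hidden instance
and its half of the device, the distinguisher everything else. The keys are arbitrary because HIVE's
operations ignore them. Reachability of the coercer's state is carried along to know that its
queries are valid. -/
theorem play_distinguisher {A : PDScheme.Coercer} {r : Polynomial ℕ}
    (hA : A.IsPPT (hive Γ).ValidQuery r) (b : Bool) (k : ℕ) :
    ∀ (i n : ℕ) (a : Data), i + k = r.eval κ → A.Reach κ i n a →
      ∀ (kp kh sp sh : Data) (dev : Device) (y : List Op),
      (distinguisher Γ A).play κ (Γ.respond κ b) k (sh, half true dev) (a, sp, dev, y) =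
        A.play κ ((hive Γ).respond κ b) k ⟨kp, kh, Data.cons sp sh, dev⟩ a := by
  obtain ⟨p, hp⟩ := hA.valid
  induction k with
  | zero => intro i n a _ _ kp kh sp sh dev y; rfl
  | succ k ih =>
    intro i n a hi hr kp kh sp sh dev y
    rw [TypedAdversary.play, Adversary.play, distinguisher_ask, PMF.bind_bind]
    refine PMF.bind_congr_support fun x hx => ?_
    obtain ⟨_ | q, a'⟩ := x
    · simp only [PMF.pure_bind]
      exact ih (i + 1) n a' (by omega) (.pass i n a a' hr hx) kp kh sp sh dev []
    · have hq := (hp κ i n a q a' (by omega) hr hx).1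
      simp only [PMF.pure_bind, distinguisher_tell, ORAM.respond, PDScheme.respond, step_eq,
          simTell,
        PMF.bind_bind,
        opsOf_query hq, hidOps_query hq, Data.left, Data.right]
      -- HIVE runs the public instance first, whereas the distinguisher runs it after the challenger
      -- has answered; the two samplings are independent.
      rw [PMF.bind_comm]
      refine PMF.bind_congr_support fun u hu => PMF.bind_congr_support fun v hv => ?_
      simp only [exec_tag_wOnly]
      simp only [← wOnly_tag, ← wOnly_append]
      refine PMF.bind_congr_support fun a'' ha'' => ?_
      have h1 := ih (i + 1) _ a'' (by omega) (.round i n a a' a'' q _ hr hx ha'') kp kh u.1 v.1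
        (dev.exec (tag false u.2.2.1 ++ tag true v.2.2.1)) []
      rw [half_true_exec, ← ORAM.dev_of_mem_exec hv] at h1
      exact h1

theorem world_distinguisher {A : PDScheme.Coercer} {r : Polynomial ℕ}
    (hA : A.IsPPT (hive Γ).ValidQuery r) (b : Bool) (κ : ℕ) :
    Γ.world (distinguisher Γ A).toAdversary r b κ = (hive Γ).world A r b κ := by
  rw [ORAM.world, PDScheme.world, initial_eq]
  simp only [PMF.bind_bind, PMF.pure_bind]
  -- The distinguisher sets up the public instance itself, after the challenger's setup, and so owns
  -- the public key that it hands to the coercer.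
  rw [PMF.bind_comm (Γ.setup κ) (Γ.setup κ)]
  refine PMF.bind_congr_support fun th hth => ?_
  change ((PMF.map Enc.enc ((distinguisher Γ A).start κ (wOnly th.2))).bind _) = _
  rw [PMF.bind_map]
  rw [show (distinguisher Γ A).start κ (wOnly th.2) = (simStart Γ κ (wOnly th.2)).bind fun u =>
    (A.start κ (u.1, u.2.2)).bind fun a => PMF.pure (a, u.1, u.2.1, []) from rfl]
  simp only [simStart, PMF.bind_bind, PMF.pure_bind, exec_tag_wOnly]
  simp only [← wOnly_tag, ← wOnly_append]
  refine PMF.bind_congr_support fun tp htp => PMF.bind_congr_support fun a ha => ?_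
  have h1 := play_distinguisher hA b (r.eval κ) 0 _ a (zero_add _) (.start _ a ha) tp.1 th.1
    tp.1 th.1 (Device.exec [] (tag false tp.2 ++ tag true th.2)) []
  rw [half_true_exec] at h1
  rw [← h1]
  exact TypedAdversary.toAdversary_play _ _ _ _ _ _

/-! ### The simulating distinguisher is polynomial time -/

theorem polySamp_simStart (h : Γ.Efficient) :
    PolySamp (fun z : ℕ × Trace => z.1 + encSize z.2) (fun z => (Unary.mk z.1, z.2))
      fun z => simStart Γ z.1 z.2 := by
  have hin := PolyComp.input (sz := fun z : ℕ × Trace => z.1 + encSize z.2)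
    (x := fun z => (Unary.mk z.1, z.2)) ((PolyBdd.self.mul (.const 3)).mono fun z => by
      have := encSize_pos z.2
      simp only [encSize_pair, encSize_unary]; omega)
  have hs := ((h.2.2.1.polySamp.reindex fun z : ℕ × Trace => z.1).resize
    (sz' := fun z : ℕ × Trace => z.1 + encSize z.2)
    (PolyBdd.self.mono fun z => Nat.le_add_right _ _)).comp hin.fst
  refine PolySamp.bind hs ?_
  have hin' := hs.bindInput
  exact hin'.snd.fst.pair (((PolyComp.const hin'.input_bdd _).devExec
    ((hin'.snd.snd.tag false).append (hin'.fst.snd.tag true))).pair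
      ((hin'.snd.snd.wOnly.tag false).append (hin'.fst.snd.tag true)))

/-- The situations in which the public volume has to be simulated. -/
def SimIndex (Γ : ORAM) (p : Polynomial ℕ) : Type :=
  {z : ℕ × ℕ × List Op × List Op × Data × Device × Trace //
    Γ.LegitSeq z.1 (z.2.2.1 ++ z.2.2.2.1) ∧ encSize (z.2.2.1 ++ z.2.2.2.1) ≤ p.eval z.1 ∧
    Γ.Reachable z.1 z.2.2.1 z.2.2.2.2.1 (half false z.2.2.2.2.2.1) ∧ Tagged z.2.2.2.2.2.1 ∧
    encSize (half true z.2.2.2.2.2.1) ≤ z.2.1 + 1}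

/-- The public half is bounded through reachability by the total length of the public requests,
which is polynomial in `κ` alone. The hidden half was written by the messages received, so its size
is charged to them. -/
theorem polySamp_simTell (h : Γ.Efficient) (p : Polynomial ℕ) :
    PolySamp (fun z : SimIndex Γ p => z.1.1 + z.1.2.1 + encSize z.1.2.2.2.2.2.2)
      (fun z => (Unary.mk z.1.1, z.1.2.2.2.2.1, z.1.2.2.2.2.2.1, z.1.2.2.2.1, z.1.2.2.2.2.2.2))
      fun z => simTell Γ z.1.1 z.1.2.2.2.2.1 z.1.2.2.2.2.2.1 z.1.2.2.2.1 z.1.2.2.2.2.2.2 := by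
  set sz := fun z : SimIndex Γ p => z.1.1 + z.1.2.1 + encSize z.1.2.2.2.2.2.2 with hsz
  have hκ : PolyBdd sz fun z => z.1.1 := PolyBdd.self.mono fun z => by simp only [hsz]; omega
  obtain ⟨q, hq⟩ := h.reachable_bdd
  have hin := PolyComp.input (sz := sz) (x := fun z => (Unary.mk z.1.1, z.1.2.2.2.2.1,
      z.1.2.2.2.2.2.1, z.1.2.2.2.1, z.1.2.2.2.2.2.2)) <| by
    refine PolyBdd.mono (((PolyBdd.self.mul (.const 6)).add (hκ.eval p)).add
      ((((hκ.add (hκ.eval p)).eval q).mul (.const 4)).add (.const 20))) ?_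
    rintro ⟨⟨κ, n, y, y', sp, dev, m⟩, hl, hy, hr, ht, hh⟩
    simp only at hl hy hr ht hh
    have h1 := hq κ y sp _ (ORAM.legitSeq_append.1 hl).1 hr
    have h2 := ht.encSize_le
    have h3 := encSize_append y y'
    have h4 := encSize_pos y
    have h5 := encSize_pos y'
    have h6 := q.eval_nat_mono (show κ + encSize y ≤ κ + p.eval κ by omega)
    simp only [encSize_pair, encSize_unary, hsz]
    omega
  let e : SimIndex Γ p → Γ.ExecIndex := fun z => ⟨(z.1.1, z.1.2.2.1, z.1.2.2.2.1, z.1.2.2.2.2.1,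
    half false z.1.2.2.2.2.2.1), z.2.1, z.2.2.2.1⟩
  have hx : PolySamp sz _ _ := (h.exec.reindex e).resize ((hκ.add (hκ.eval p)).mono fun z =>
    Nat.add_le_add_left z.2.2.1 _)
  have hx' := hx.comp (hin.fst.pair (hin.snd.fst.pair ((hin.snd.snd.fst.half false).pair
    hin.snd.snd.snd.fst)))
  refine PolySamp.bind hx' ?_
  have hin' := hx'.bindInput
  have hm := hin'.fst.snd.snd.snd.snd.tag true
  have ht := hin'.snd.snd.snd.fst
  exact hin'.snd.fst.pair ((hin'.fst.snd.snd.fst.devExec ((ht.tag false).append hm)).pair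
    ((ht.wOnly.tag false).append hm))

theorem mem_ask {A : PDScheme.Coercer} {s s' : SimState} {q : List Op × List Op}
    (h : (some q, s') ∈ ((distinguisher Γ A).ask κ s).support) :
    ∃ q₀ a, (some q₀, a) ∈ (A.ask κ s.1).support ∧
      q = (hidOps Γ κ q₀.1, hidOps Γ κ (q₀.1 ++ q₀.2.2)) ∧
      s' = (a, s.2.1, s.2.2.1, opsOf .pub q₀.1) := by
  simp only [distinguisher, PMF.mem_support_bind_iff] at h
  obtain ⟨⟨_ | q₀, a⟩, hx, h⟩ := h
  · simp at h
  · simp only [PMF.mem_support_pure_iff, Prod.mk.injEq, Option.some.injEq] at h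
    exact ⟨q₀, a, hx, h.1, by rw [← Prod.eta s', h.2]⟩

theorem mem_ask_none {A : PDScheme.Coercer} {s s' : SimState}
    (h : (none, s') ∈ ((distinguisher Γ A).ask κ s).support) :
    ∃ a, (none, a) ∈ (A.ask κ s.1).support ∧ s' = (a, s.2.1, s.2.2.1, []) := by
  simp only [distinguisher, PMF.mem_support_bind_iff] at h
  obtain ⟨⟨_ | q₀, a⟩, hx, h⟩ := h
  · simp only [PMF.mem_support_pure_iff, Prod.mk.injEq, true_and] at h
    exact ⟨a, hx, by rw [← Prod.eta s', h]⟩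
  · simp at h

/-- What is known about the state of the distinguisher after `i` rounds in which it has received
messages of length `n`. -/
structure SimInv (Γ : ORAM) (A : PDScheme.Coercer) (p Q : Polynomial ℕ) (κ i n : ℕ)
    (s : SimState) (nA : ℕ) (y : List Op) : Prop where
  reach : A.Reach κ i nA s.1
  size : nA ≤ (i + 1) * Q.eval (κ + n)
  legit : Γ.LegitSeq κ y
  bound : encSize y ≤ i * p.eval κ + 1
  pub : Γ.Reachable κ y s.2.1 (half false s.2.2.1)
  tagged : Tagged s.2.2.1
  hid : encSize (half true s.2.2.1) ≤ n + 1
  pend : s.2.2.2 = []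

/-- The situations in which the distinguisher is told a reply. -/
abbrev TellIndex (Γ : ORAM) (A : PDScheme.Coercer) (r p Q : Polynomial ℕ) : Type :=
  {z : ℕ × ℕ × ℕ × SimState × (List Op × List Op) × SimState × Trace // z.2.1 < r.eval z.1 ∧
    (∃ nA y, SimInv Γ A p Q z.1 z.2.1 z.2.2.1 z.2.2.2.1 nA y) ∧
    (some z.2.2.2.2.1, z.2.2.2.2.2.1) ∈ ((distinguisher Γ A).ask z.1 z.2.2.2.1).support}

/-- The same, together with what the distinguisher passes on to the coercer. -/
abbrev TellOutIndex (Γ : ORAM) (A : PDScheme.Coercer) (r p Q : Polynomial ℕ) : Type :=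
  {w : TellIndex Γ A r p Q × (Data × Device × Trace) //
    w.2 ∈ (simTell Γ w.1.1.1 w.1.1.2.2.2.2.2.1.2.1 w.1.1.2.2.2.2.2.1.2.2.1
      w.1.1.2.2.2.2.2.1.2.2.2 w.1.1.2.2.2.2.2.2).support}

/-- The coercer's time is measured by the length `nA` of the messages it gets, the distinguisher's
by the length `n` of its own. Each message to the coercer is an output of the simulation, hence of
length at most `Q (κ + n)`, and there are at most `r κ` rounds besides the start, so `nA` is
polynomial in `κ + n`. -/
theorem isPPT_distinguisher (h : Γ.Efficient) {A : PDScheme.Coercer} {r : Polynomial ℕ}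
    (hA : A.IsPPT (hive Γ).ValidQuery r) :
    (distinguisher Γ A).toAdversary.IsPPT Γ.ValidQuery r := by
  obtain ⟨p₀, hp₀⟩ := hA.valid
  -- the lengths of the requests derived from a query
  have hqin := PolyComp.input (sz := fun z : {z : ℕ × (Pattern × Pattern × Pattern) //
    encSize z.2 ≤ p₀.eval z.1} => z.1.1) (x := fun z => (Unary.mk z.1.1, z.1.2))
    (((PolyBdd.self.mul (.const 2)).add ((PolyBdd.self.eval p₀).add (.const 2))).mono fun z => by
      have := z.2
      simp only [encSize_pair, encSize_unary]; omega)
  obtain ⟨p, hp⟩ := (hqin.snd.fst.opsOf .pub).bdd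
  obtain ⟨p₁, hp₁⟩ := ((polyComp_hidOps h hqin.fst .self hqin.snd.fst).pair
    (polyComp_hidOps h hqin.fst .self (hqin.snd.fst.append hqin.snd.snd.snd))).bdd
  have hstart := polySamp_simStart h
  -- A query contributes public requests of length at most `p`; `r * p` accounts for all rounds and
  -- 1 for the empty list at the start, while the further summand `p` is slack.
  have htell := polySamp_simTell h (r * p + p + 1)
  obtain ⟨Q₁, hQ₁⟩ := hstart.output_bdd
  obtain ⟨Q₂, hQ₂⟩ := htell.output_bdd
  set Q := Q₁ + Q₂ with hQ
  have hex : ∀ {κ i n : ℕ} {s : SimState} {nA : ℕ} {y : List Op} {q₀ : Pattern × Pattern × Pattern}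
      {a : Data}, i < r.eval κ → SimInv Γ A p Q κ i n s nA y →
      (some q₀, a) ∈ (A.ask κ s.1).support →
      Γ.LegitSeq κ (y ++ opsOf .pub q₀.1) ∧
        encSize (y ++ opsOf .pub q₀.1) ≤ (i + 1) * p.eval κ + 1 ∧
        (i + 1) * p.eval κ + 1 ≤ (r * p + p + 1).eval κ := by
    intro κ i n s nA y q₀ a hi hs hq
    obtain ⟨hv, hsz⟩ := hp₀ κ i nA s.1 q₀ a hi hs.reach hq
    refine ⟨ORAM.legitSeq_append.2 ⟨hs.legit, legit_opsOf fun x hx => hv.legit x ?_⟩, ?_, ?_⟩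
    · simp only [List.mem_append]; exact .inl (.inl hx)
    · have h1 := encSize_append y (opsOf .pub q₀.1)
      have h2 := hp ⟨(κ, q₀), hsz⟩
      have h3 := hs.bound
      simp only at h2
      rw [add_mul, one_mul]
      omega
    · have : (i + 1) * p.eval κ ≤ r.eval κ * p.eval κ := Nat.mul_le_mul_right _ hi
      simp only [Polynomial.eval_add, Polynomial.eval_mul, Polynomial.eval_one]
      omega
  have hmono : ∀ {κ i n n' nA : ℕ}, nA ≤ (i + 1) * Q.eval (κ + n) → n ≤ n' →
      nA ≤ (i + 1) * Q.eval (κ + n') := fun h1 h2 =>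
    h1.trans (Nat.mul_le_mul_left _ (Q.eval_nat_mono (by omega)))
  have hszA : ∀ {J : Type} {κ i n nA : J → ℕ},
      (∀ z, i z ≤ r.eval (κ z) ∧ nA z ≤ (i z + 1) * Q.eval (κ z + n z)) →
      PolyBdd (fun z => κ z + n z) fun z => κ z + nA z := by
    intro J κ i n nA hz
    refine (PolyBdd.self.add (((PolyBdd.self.eval r).add (.const 1)).mul
      (PolyBdd.self.eval Q))).mono fun z => ?_
    have h1 := r.eval_nat_mono (Nat.le_add_right (κ z) (n z))
    have h2 := Nat.mul_le_mul_right (Q.eval (κ z + n z)) (Nat.add_le_add_right ((hz z).1.trans h1)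
        1)
    have h3 := (hz z).2
    omega
  -- This bounds the state without the coercer's part, which is bounded separately by the coercer's
  -- own running time.
  obtain ⟨qs, hqs⟩ : ∃ qs : Polynomial ℕ, ∀ {κ i n : ℕ} {s : SimState} {nA : ℕ} {y : List Op},
      i ≤ r.eval κ → SimInv Γ A p Q κ i n s nA y → encSize s.2 ≤ qs.eval (κ + n) := by
    obtain ⟨q, hq⟩ := h.reachable_bdd
    refine ⟨5 * q.comp (Polynomial.X + (r * p + 1)) + 4 * Polynomial.X + 10, ?_⟩
    intro κ i n s nA y hi hs
    have h1 := hq κ y s.2.1 _ hs.legit hs.pub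
    have h2 := hs.tagged.encSize_le
    have h3 := hs.hid
    have h4 : encSize s.2 = encSize s.2.1 + (encSize s.2.2.1 + encSize s.2.2.2 + 1) + 1 := rfl
    rw [hs.pend, encSize_nil] at h4
    have h5 := Nat.mul_le_mul hi (le_refl (p.eval κ))
    have h6 := (r * p + 1).eval_nat_mono (Nat.le_add_right κ n)
    simp only [Polynomial.eval_add, Polynomial.eval_mul, Polynomial.eval_one] at h6
    have h7 := q.eval_nat_mono (show κ + encSize y ≤
      κ + n + (r.eval (κ + n) * p.eval (κ + n) + 1) by have := hs.bound; omega)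
    simp only [Polynomial.eval_add, Polynomial.eval_mul, Polynomial.eval_one, Polynomial.eval_comp,
      Polynomial.eval_X, Polynomial.eval_ofNat]
    omega
  refine TypedAdversary.isPPT _ _ r (fun κ i n s => ∃ nA y, SimInv Γ A p Q κ i n s nA y)
    ?_ ?_ ?_ ?_ ?_ ?_ ?_ ?_
  · intro κ m s hs
    have hs' := hs
    simp only [distinguisher, PMF.mem_support_bind_iff, PMF.mem_support_pure_iff] at hs'
    obtain ⟨u, hu, a, ha, rfl⟩ := hs'
    have h1 := hQ₁ (κ, m) u hu
    have h2 : encSize (u.1, u.2.2) ≤ encSize u := by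
      have h3 : encSize u = encSize u.1 + (encSize u.2.1 + encSize u.2.2 + 1) + 1 := rfl
      rw [encSize_pair]; omega
    simp only [simStart, PMF.mem_support_bind_iff, PMF.mem_support_pure_iff] at hu
    obtain ⟨t, ht, rfl⟩ := hu
    refine ⟨_, [], .start _ a ha, ?_, fun o ho => absurd ho List.not_mem_nil, ?_, ?_, ?_, ?_, rfl⟩
    · rw [hQ, Polynomial.eval_add]
      simp only at h1 h2 ⊢
      omega
    · rw [encSize_nil]; omega
    · simp only [half_false_exec]
      exact ORAM.reachable_nil ht
    · exact Tagged.exec (fun e he => absurd he List.not_mem_nil) _ _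
    · simp only [half_true_exec]
      have h3 := encSize_exec_le m (half true [])
      have h4 : encSize (half true []) = 1 := rfl
      omega
  · rintro κ i n s s' hi ⟨nA, y, hs⟩ hs'
    obtain ⟨a, ha, rfl⟩ := mem_ask_none hs'
    refine ⟨nA, y, .pass i nA _ a hs.reach ha, ?_, hs.legit, ?_, hs.pub, hs.tagged, hs.hid, rfl⟩
    · exact hs.size.trans (Nat.mul_le_mul_right _ (by omega))
    · have := hs.bound
      rw [add_mul]; omega
  · rintro κ i n s s' s'' q m hi ⟨nA, y, hs⟩ hs' hs''
    obtain ⟨q₀, a, hq, rfl, rfl⟩ := mem_ask hs'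
    obtain ⟨hl, hb, hb'⟩ := hex hi hs hq
    simp only [distinguisher, PMF.mem_support_bind_iff, PMF.mem_support_pure_iff] at hs''
    obtain ⟨u, hu, a', ha', rfl⟩ := hs''
    have h1 := hQ₂ ⟨(κ, n, y, opsOf .pub q₀.1, s.2.1, s.2.2.1, m), hl, hb.trans hb', hs.pub,
      hs.tagged, hs.hid⟩ u hu
    have h2 : encSize (u.2.1, u.2.2) ≤ encSize u := by
      have h3 : encSize u = encSize u.1 + (encSize u.2.1 + encSize u.2.2 + 1) + 1 := rfl
      rw [encSize_pair]; omega
    simp only [simTell, PMF.mem_support_bind_iff, PMF.mem_support_pure_iff] at hu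
    obtain ⟨t, ht, rfl⟩ := hu
    refine ⟨_, y ++ opsOf .pub q₀.1, .round i nA _ a a' q₀ _ hs.reach hq ha', ?_, hl, hb, ?_, ?_,
      ?_, rfl⟩
    · have h3 := hmono hs.size (Nat.le_add_right n (encSize m))
      have h4 : Q.eval (κ + (n + encSize m)) = Q₁.eval (κ + (n + encSize m)) +
        Q₂.eval (κ + n + encSize m) := by rw [hQ, Polynomial.eval_add, add_assoc κ n]
      rw [add_mul (i + 1) 1, one_mul]
      simp only at h1 h2 ⊢
      omega
    · simp only [half_false_exec]
      rw [← ORAM.dev_of_mem_exec ht]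
      exact hs.pub.exec ht
    · exact hs.tagged.exec _ _
    · simp only [half_true_exec]
      have h3 := encSize_exec_le m (half true s.2.2.1)
      have h4 := hs.hid
      omega
  · refine ⟨p₁, ?_⟩
    rintro κ i n s q s' hi ⟨nA, y, hs⟩ hs'
    obtain ⟨q₀, a, hq, rfl, rfl⟩ := mem_ask hs'
    obtain ⟨hv, hsz⟩ := hp₀ κ i nA s.1 q₀ a hi hs.reach hq
    exact ⟨validQuery_hidOps hv, hp₁ ⟨(κ, q₀), hsz⟩⟩
  · refine PolySamp.bind hstart ?_
    have hin := hstart.bindInput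
    have hst := ((hA.start.reindex fun z : {z : (ℕ × Trace) × (Data × Device × Trace) //
      z.2 ∈ (simStart Γ z.1.1 z.1.2).support} => (z.1.1.1, (z.1.2.1, z.1.2.2.2))).resize
      (sz' := fun z => z.1.1.1 + encSize z.1.1.2) (((PolyBdd.self).add (PolyBdd.self.eval Q₁)).mono
        fun z => by
          have h1 := hQ₁ z.1.1 z.1.2 z.2
          have h3 : encSize z.1.2 = encSize z.1.2.1 + (encSize z.1.2.2.1 + encSize z.1.2.2.2 + 1) +
            1 := rfl
          simp only [encSize_pair] at h1 ⊢
          omega)).comp (hin.fst.fst.pair (hin.snd.fst.pair hin.snd.snd.snd))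
    refine PolySamp.bind hst ?_
    have hin' := hst.bindInput
    exact hin'.snd.pair (hin'.fst.snd.fst.pair (hin'.fst.snd.snd.fst.pair (.nil hin'.input_bdd)))
  -- The length of the coercer's messages and the public history are not stored in the state; they
  -- are chosen from the invariant to index the efficient families.
  · choose nA y hinv using fun z : {z : ℕ × ℕ × ℕ × SimState // z.2.1 < r.eval z.1 ∧
        ∃ nA y, SimInv Γ A p Q z.1 z.2.1 z.2.2.1 z.2.2.2 nA y} => z.2.2
    have hask := ((hA.ask.reindex fun z => ⟨(z.1.1, z.1.2.1, nA z, z.1.2.2.2.1), z.2.1,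
      (hinv z).reach⟩).resize (hszA fun z => ⟨z.2.1.le, (hinv z).size⟩))
    have hin := PolyComp.input (sz := fun z : {z : ℕ × ℕ × ℕ × SimState // z.2.1 < r.eval z.1 ∧
        ∃ nA y, SimInv Γ A p Q z.1 z.2.1 z.2.2.1 z.2.2.2 nA y} => z.1.1 + z.1.2.2.1)
      (x := fun z => (Unary.mk z.1.1, z.1.2.2.2)) ((hask.input_bdd.add ((PolyBdd.self.eval qs).add
        (.const 2))).mono fun z => by
          have h1 := hqs z.2.1.le (hinv z)
          have h2 : encSize z.1.2.2.2 = encSize z.1.2.2.2.1 + encSize z.1.2.2.2.2 + 1 := rfl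
          simp only [encSize_pair] at h2 ⊢
          omega)
    have hask' := hask.comp (hin.fst.pair hin.snd.fst)
    refine PolySamp.bind hask' ?_
    have hin' := hask'.bindInput
    refine PolySamp.optionCases hin'.snd.fst ?_ ?_
    · have hnone := (PolyComp.const (β := Option (List Op × List Op)) hin'.input_bdd none).pair
        (hin'.snd.snd.pair (hin'.fst.snd.snd.fst.pair (hin'.fst.snd.snd.snd.fst.pair
          (PolyComp.nil (β := Op) hin'.input_bdd))))
      refine PolySamp.congr (PolySamp.reindex hnone _) fun z => ?_
      rw [show z.1.1.2.1 = none from z.2]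
    · have hin'' := hin'.snd.fst.someInput
      have hκ : PolyComp _ _ _ := hin''.fst.fst.fst
      have hop := polyComp_hidOps h hκ (PolyBdd.self.mono fun z => Nat.le_add_right _ _)
        hin''.snd.fst
      have hop' := polyComp_hidOps h hκ (PolyBdd.self.mono fun z => Nat.le_add_right _ _)
        (hin''.snd.fst.append hin''.snd.snd.snd)
      have hsome := (hop.pair hop').some.pair (hin''.fst.snd.snd.pair
          (hin''.fst.fst.snd.snd.fst.pair
        (hin''.fst.fst.snd.snd.snd.fst.pair (hin''.snd.fst.opsOf .pub))))
      refine PolySamp.congr hsome fun z => ?_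
      rw [show z.1.1.1.2.1 = some z.1.2 from z.2]
  · choose nA y hinv using fun z : TellIndex Γ A r p Q => z.2.2.1
    choose q₀ a hq₀ hqe hse using fun z : TellIndex Γ A r p Q => mem_ask z.2.2.2
    have hsim := htell.reindex fun z => ⟨(z.1.1, z.1.2.2.1, y z, z.1.2.2.2.2.2.1.2.2.2,
      z.1.2.2.2.2.2.1.2.1, z.1.2.2.2.2.2.1.2.2.1, z.1.2.2.2.2.2.2), by
        rw [hse z]
        obtain ⟨h1, h2, h3⟩ := hex z.2.1 (hinv z) (hq₀ z)
        exact ⟨h1, h2.trans h3, (hinv z).pub, (hinv z).tagged, (hinv z).hid⟩⟩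
    have hask := (hA.ask.reindex fun z => ⟨(z.1.1, z.1.2.1, nA z, z.1.2.2.2.1.1), z.2.1,
      (hinv z).reach⟩).resize (hszA fun z => ⟨z.2.1.le, (hinv z).size⟩)
    -- Between query and reply the coercer's state is an output of its `ask`, which bounds its size.
    obtain ⟨qa, hqa⟩ := hask.output_bdd
    have hin := PolyComp.input (sz := fun z : TellIndex Γ A r p Q =>
          z.1.1 + z.1.2.2.1 + encSize z.1.2.2.2.2.2.2)
      (x := fun z => (Unary.mk z.1.1, z.1.2.2.2.2.2.1, z.1.2.2.2.2.2.2))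
      ((hsim.input_bdd.add ((PolyBdd.self.eval qa).add (.const 2))).mono fun z => by
          have h1 := hqa z _ (hq₀ z)
          have h2 : encSize z.1.2.2.2.2.2.1 = encSize z.1.2.2.2.2.2.1.1 +
            (encSize z.1.2.2.2.2.2.1.2.1 + (encSize z.1.2.2.2.2.2.1.2.2.1 +
              encSize z.1.2.2.2.2.2.1.2.2.2 + 1) + 1) + 1 := rfl
          have h3 := qa.eval_nat_mono
            (Nat.le_add_right (z.1.1 + z.1.2.2.1) (encSize z.1.2.2.2.2.2.2))
          have h4 : z.1.2.2.2.2.2.1.1 = a z := by rw [hse z]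
          rw [← h4] at h1
          simp only [encSize_pair] at h1 h2 ⊢
          omega)
    have hsim' := hsim.comp (hin.fst.pair (hin.snd.fst.snd.fst.pair (hin.snd.fst.snd.snd.fst.pair
      (hin.snd.fst.snd.snd.snd.pair hin.snd.snd))))
    refine PolySamp.bind hsim' ?_
    have hin' := hsim'.bindInput
    obtain ⟨qu, hqu⟩ := hsim'.output_bdd
    have hbd : PolyBdd (fun z : TellIndex Γ A r p Q =>
          z.1.1 + z.1.2.2.1 + encSize z.1.2.2.2.2.2.2) fun z => z.1.1 + nA z :=
      (hszA (κ := fun z => z.1.1) (n := fun z => z.1.2.2.1) fun z =>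
        ⟨z.2.1.le, (hinv z).size⟩).trans (PolyBdd.self.mono fun z => Nat.le_add_right _ _)
    have hu : PolyBdd (fun z : TellOutIndex Γ A r p Q => z.1.1.1.1 + z.1.1.1.2.2.1 +
        encSize z.1.1.1.2.2.2.2.2.2) fun z => encSize z.1.2 := ⟨qu, fun z => hqu z.1.1 z.1.2 z.2⟩
    have htl := (hA.tell.reindex fun z : TellOutIndex Γ A r p Q =>
      ⟨(z.1.1.1.1, z.1.1.1.2.1, nA z.1.1, z.1.1.1.2.2.2.1.1,
      q₀ z.1.1, z.1.1.1.2.2.2.2.2.1.1, (z.1.2.2.1, z.1.2.2.2)), z.1.1.2.1, (hinv z.1.1).reach, by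
        rw [hse z.1.1]; exact hq₀ z.1.1⟩).resize (((hbd.reindex fun z => z.1.1).add hu).mono
          fun z => by
            have h3 : encSize z.1.2 = encSize z.1.2.1 + (encSize z.1.2.2.1 + encSize z.1.2.2.2 +
              1) + 1 := rfl
            simp only [encSize_pair] at h3 ⊢
            omega)
    have htl' := htl.comp (hin'.fst.fst.pair (hin'.fst.snd.fst.fst.pair (hin'.snd.snd.fst.pair
      hin'.snd.snd.snd)))
    refine PolySamp.bind htl' ?_
    have hin'' := htl'.bindInput
    exact hin''.snd.pair (hin''.fst.snd.fst.pair (hin''.fst.snd.snd.fst.pair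
      (.nil hin''.input_bdd)))
  · choose nA y hinv using fun z : {z : ℕ × ℕ × SimState //
        ∃ nA y, SimInv Γ A p Q z.1 (r.eval z.1) z.2.1 z.2.2 nA y} => z.2
    have hg := ((hA.guess.reindex fun z => ⟨(z.1.1, nA z, z.1.2.2.1), (hinv z).reach⟩).resize
      (hszA fun z => ⟨le_rfl, (hinv z).size⟩))
    have hin := PolyComp.input (sz := fun z : {z : ℕ × ℕ × SimState //
        ∃ nA y, SimInv Γ A p Q z.1 (r.eval z.1) z.2.1 z.2.2 nA y} => z.1.1 + z.1.2.1)
      (x := fun z => (Unary.mk z.1.1, z.1.2.2)) ((hg.input_bdd.add ((PolyBdd.self.eval qs).add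
        (.const 2))).mono fun z => by
          have h1 := hqs le_rfl (hinv z)
          have h2 : encSize z.1.2.2 = encSize z.1.2.2.1 + encSize z.1.2.2.2 + 1 := rfl
          simp only [encSize_pair] at h2 ⊢
          omega)
    exact hg.comp (hin.fst.pair hin.snd.fst)

theorem traceSecure (h : Γ.Efficient) (hO : Γ.WriteOnlyOblivious) : (hive Γ).TraceSecure := by
  intro r A hA
  have h1 := hO r _ (isPPT_distinguisher h hA)
  simp only [world_distinguisher hA] at h1
  have h2 := h1.mul_const (1 / 2)
  simp only [PDScheme.abs_prob_game]
  exact h2.congr fun κ => by ring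

end Hive

/-! ### Serving data requests by a PD scheme -/

/-- The pattern that serves the request `o` on the hidden volume. -/
def servePattern (m : ℕ) (P : Pattern) (o : Op) : Pattern :=
  (if o.isWrite then P else [pubDummy]) ++ PDScheme.hiddenGen m o

/-- The triple of patterns that hides the request `o`. -/
def serveQuery (m : ℕ) (P P' : Pattern) (o : Op) : Pattern × Pattern × Pattern :=
  if o.isWrite then (P, P', PDScheme.hiddenGen m o) else ([pubDummy], [], PDScheme.hiddenGen m o)

theorem serveQuery_append (m : ℕ) (P P' : Pattern) (o : Op) :
    (serveQuery m P P' o).1 ++ (serveQuery m P P' o).2.2 = servePattern m P o := by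
  rw [serveQuery, servePattern]
  split_ifs <;> rfl

theorem PolyComp.hiddenGen {I : Type} {sz : I → ℕ} {α : Type} [Enc α] {x : I → α} {m : I → ℕ}
    {o : I → Op} (hm : PolyComp sz x fun i => Unary.mk (m i)) (ho : PolyComp sz x o) :
    PolyComp sz x fun i => PDScheme.hiddenGen (m i) (o i) := by
  have hr : PolyComp sz x fun i => Request.mk .hid (Option.some (o i)) :=
    (PolyComp.const ho.input_bdd Volume.hid).ofCons ho.some fun _ => rfl
  have hd := hm.replicate.tail.listMap (c := fun _ => Data.nil)
    (f := fun (_ : Data) (_ : Bool) => hidDummy) (.const ho.input_bdd _) (PolyComp.const .self _)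
  exact (hr.cons hd).congr fun i => by simp [PDScheme.hiddenGen]

theorem PolyComp.servePattern {I : Type} {sz : I → ℕ} {α : Type} [Enc α] {x : I → α} {m : I → ℕ}
    {P : I → Pattern} {o : I → Op} (hm : PolyComp sz x fun i => Unary.mk (m i))
    (hP : PolyComp sz x P) (ho : PolyComp sz x o) :
    PolyComp sz x fun i => servePattern (m i) (P i) (o i) :=
  (PolyComp.ite ho.opIsWrite hP (.const ho.input_bdd _)).append (hm.hiddenGen ho)

theorem PolyComp.serveQuery {I : Type} {sz : I → ℕ} {α : Type} [Enc α] {x : I → α} {m : I → ℕ}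
    {P P' : I → Pattern} {o : I → Op} (hm : PolyComp sz x fun i => Unary.mk (m i))
    (hP : PolyComp sz x P) (hP' : PolyComp sz x P') (ho : PolyComp sz x o) :
    PolyComp sz x fun i => serveQuery (m i) (P i) (P' i) (o i) :=
  PolyComp.ite ho.opIsWrite (hP.pair (hP'.pair (hm.hiddenGen ho)))
    ((PolyComp.const ho.input_bdd [pubDummy]).pair
      ((PolyComp.const ho.input_bdd ([] : Pattern)).pair (hm.hiddenGen ho)))

/-- The answers to the `Read`s among the requests, from the answers to the patterns that serve
them. -/
def servedAnswers : List Op → List (List Block) → List Block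
  | o :: y, a :: as => if o.isWrite then servedAnswers y as else a.headD [] :: servedAnswers y as
  | _, _ => []

/-- Consistency forces the batch of a `Read` to contain an answer, so the default of `headD` is
never used. -/
theorem consistent_servedAnswers (y : List Op) : ∀ (mem : ℕ → Option Block)
    (anss : List (List Block)), ConsistentSeq mem (y.map fun o => [o]) anss →
    Consistent mem y (servedAnswers y anss) := by
  induction y with
  | nil => intro mem anss _; cases anss <;> rfl
  | cons o y ih =>
    intro mem anss h
    cases anss with
    | nil => exact h.elim
    | cons a anss =>
      obtain ⟨h1, h2⟩ := h
      cases o with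
      | read b =>
        cases a with
        | nil => exact h1.elim
        | cons v a => exact ⟨h1.1, ih _ _ h2⟩
      | write b d => exact ih _ _ h2

/-! ### The derived ORAM: correctness and running time -/

namespace PDScheme

variable {D : PDScheme} {n : ℕ → ℕ} {P₁ P₂ : ℕ → Pattern} {κ : ℕ}

theorem validQuery_serveQuery (hU : D.Universal n P₁ P₂) {o : Op}
    (ho : o.Legit (D.hidCap κ) (D.blockLen κ)) :
    D.ValidQuery κ (serveQuery (n κ) (P₁ κ) (P₂ κ) o) := by
  -- The subtraction in `n - 1` is harmless because `n κ` is at least 1.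
  have hlen : (hiddenGen (n κ) o).length = n κ := by
    have := hU.pos κ
    simp only [hiddenGen, List.length_cons, List.length_replicate]; omega
  have hmem : ∀ r ∈ hiddenGen (n κ) o, r.vol = .hid ∧ D.LegitRequest κ r ∧
      ∀ o', r.op = some o' → o' = o := by
    intro r hr
    rcases List.mem_cons.1 hr with rfl | hr
    · refine ⟨rfl, fun o' ho' => ?_, fun o' ho' => (Option.some.inj ho').symm⟩
      obtain rfl := Option.some.inj ho'
      exact ho
    · obtain rfl := List.eq_of_mem_replicate hr
      exact ⟨rfl, fun o' ho' => (nomatch ho'), fun o' ho' => (nomatch ho')⟩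
  rw [serveQuery]
  split_ifs with hw
  · exact hU.cover κ _ hlen fun r hr => ⟨(hmem r hr).1, (hmem r hr).2.1⟩
  · refine hU.coverReads κ _ hlen fun r hr => ⟨(hmem r hr).1, (hmem r hr).2.1, fun o' ho' => ?_⟩
    rw [(hmem r hr).2.2 o' ho']
    simpa using hw

theorem allowed_servePattern (hU : D.Universal n P₁ P₂) {o : Op}
    (ho : o.Legit (D.hidCap κ) (D.blockLen κ)) :
    D.Allowed κ (servePattern (n κ) (P₁ κ) o) :=
  ⟨_, _, _, validQuery_serveQuery hU ho, .inr (serveQuery_append ..).symm⟩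

theorem opsOf_hid_servePattern (hU : D.Universal n P₁ P₂) {o : Op}
    (ho : o.Legit (D.hidCap κ) (D.blockLen κ)) :
    opsOf .hid (servePattern (n κ) (P₁ κ) o) = [o] := by
  have hv := validQuery_serveQuery (P₂ := P₂) hU ho
  rw [← serveQuery_append _ _ (P₂ κ), Hive.opsOf_append, Hive.opsOf_of_vol_ne (w := .pub) (by
      decide)
    fun r hr => hv.pub_only r (List.mem_append_left _ hr), List.nil_append]
  have : (serveQuery (n κ) (P₁ κ) (P₂ κ) o).2.2 = hiddenGen (n κ) o := by
    rw [serveQuery]; split_ifs <;> rfl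
  rw [this]
  simp [opsOf, slotsOf, hiddenGen, hidDummy]

/-- The configuration as a private state of the ORAM. -/
def Config.pack (c : Config) : Data := Data.cons c.kpub (Data.cons c.khid c.st)

theorem toORAM_setup (D : PDScheme) (n : ℕ → ℕ) (P₁ : ℕ → Pattern) (κ : ℕ) :
    (D.toORAM n P₁).setup κ = (D.initial κ).map fun u => (u.1.pack, u.2) := by
  simp only [toORAM, initial, PMF.map_bind, PMF.pure_map]
  rfl

theorem toORAM_access (D : PDScheme) (n : ℕ → ℕ) (P₁ : ℕ → Pattern) (κ : ℕ) (c : Config) (o : Op) :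
    (D.toORAM n P₁).access κ c.pack c.dev o =
      (D.step κ c (servePattern (n κ) (P₁ κ) o)).map fun u =>
        (u.1.pack, u.2.1, u.2.2.2.headD []) := by
  simp only [toORAM, step, PMF.map_bind, PMF.pure_map]
  rfl

theorem dev_of_mem_step {c : Config} {pat : Pattern} {u : Config × Trace × List Block × List Block}
    (h : u ∈ (D.step κ c pat).support) : u.1.dev = c.dev.exec u.2.1 := by
  simp only [step, PMF.mem_support_bind_iff, PMF.mem_support_pure_iff] at h
  obtain ⟨a, -, rfl⟩ := h
  rfl

theorem dev_of_mem_initial {u : Config × Trace} (h : u ∈ (D.initial κ).support) :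
    u.1.dev = Device.exec [] u.2 := by
  simp only [initial, PMF.mem_support_bind_iff, PMF.mem_support_pure_iff] at h
  obtain ⟨a, -, rfl⟩ := h
  rfl

/-- Up to packing keys and internal state into one private state, serving requests by the ORAM is
executing their patterns in the PD scheme; the law is the same, with the answers filtered. -/
theorem toORAM_exec (y : List Op) : ∀ c : Config,
    ((D.toORAM n P₁).exec κ c.pack c.dev y).map (fun a => (a.1, a.2.1, a.2.2.2)) =
      (D.exec κ c (y.map (servePattern (n κ) (P₁ κ)))).map fun u =>
        (u.1.pack, u.1.dev, servedAnswers y (u.2.map Prod.snd)) := by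
  induction y with
  | nil => intro c; simp [ORAM.exec, exec, PMF.pure_map, servedAnswers]
  | cons o y ih =>
    intro c
    simp only [ORAM.exec, List.map_cons, exec, PMF.map_bind, PMF.pure_map, toORAM_access,
      PMF.bind_map, Function.comp_def]
    refine PMF.bind_congr_support fun u hu => ?_
    have h := congrArg (fun μ => μ.bind fun a => PMF.pure (a.1, a.2.1,
      if o.isWrite then a.2.2 else u.2.2.2.headD [] :: a.2.2)) (ih u.1)
    simp only [PMF.bind_map, Function.comp_def] at h
    rw [← dev_of_mem_step hu]
    exact h

theorem toORAM_run (y : List Op) : (D.toORAM n P₁).run κ y =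
    (D.run κ (y.map (servePattern (n κ) (P₁ κ)))).map fun u =>
      (u.1.pack, u.1.dev, servedAnswers y (u.2.map Prod.snd)) := by
  simp only [ORAM.run, run, toORAM_setup, PMF.bind_map, PMF.map_bind, Function.comp_def]
  refine PMF.bind_congr_support fun u hu => ?_
  rw [← dev_of_mem_initial hu, ← toORAM_exec]
  rfl

theorem Universal.bdd (hU : D.Universal n P₁ P₂) :
    ∃ p : Polynomial ℕ, ∀ κ, encSize (P₁ κ) + encSize (P₂ κ) + n κ ≤ p.eval κ := by
  obtain ⟨p, hp⟩ := hU.computable₁.polyComp.bdd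
  obtain ⟨p', hp'⟩ := hU.computable₂.polyComp.bdd
  obtain ⟨q, hq⟩ := hU.computable_n.polyComp.bdd
  refine ⟨p + p' + q, fun κ => ?_⟩
  have h1 := hp κ
  have h2 := hq κ
  have h3 := hp' κ
  simp only [encSize_unary] at h1 h2 h3
  simp only [Polynomial.eval_add]
  omega

theorem length_servePattern_le (m : ℕ) (P : Pattern) (o : Op) :
    (servePattern m P o).length ≤ P.length + m + 2 := by
  rw [servePattern, hiddenGen]
  split_ifs <;> simp <;> omega

theorem toORAM_correct (hD : D.Correct) (hU : D.Universal n P₁ P₂) : (D.toORAM n P₁).Correct := by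
  intro p
  obtain ⟨q, hq⟩ := hU.bdd
  -- A request becomes one pattern, which counts once and has at most `|P₁| + n + 2` entries.
  obtain ⟨ε, hε, h⟩ := hD (p * (q + 3))
  refine ⟨ε, hε, fun κ y hl hy => ?_⟩
  refine le_trans ?_ (h κ (y.map (servePattern (n κ) (P₁ κ))) ?_ ?_)
  · rw [toORAM_run, prob_map]
    refine prob_mono _ fun u _ hu hc => hu ?_
    refine consistent_servedAnswers y _ _ ?_
    have h2 := hc.2
    rw [List.map_map] at h2
    rwa [List.map_congr_left (f := opsOf .hid ∘ _) (g := fun o => [o]) fun o ho =>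
      opsOf_hid_servePattern hU (hl o ho)] at h2
  · intro x hx
    obtain ⟨o, ho, rfl⟩ := List.mem_map.1 hx
    exact allowed_servePattern hU (hl o ho)
  · have h1 : ∀ y : List Op, (y.map (servePattern (n κ) (P₁ κ))).length +
        (y.map (servePattern (n κ) (P₁ κ))).flatten.length ≤ y.length * (q.eval κ + 3) := by
      intro y
      induction y with
      | nil => simp
      | cons o y ih =>
        have h2 := length_servePattern_le (n κ) (P₁ κ) o
        have h3 := length_lt_encSize (P₁ κ)
        have h4 := hq κ
        simp only [List.map_cons, List.flatten_cons, List.length_append, List.length_cons, add_mul,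
          one_mul] at ih ⊢
        omega
    refine (h1 y).trans ?_
    rw [Polynomial.eval_mul, Polynomial.eval_add, Polynomial.eval_ofNat]
    exact Nat.mul_le_mul_right _ hy

/-- The situations in which an operation must be efficient. -/
def OperIndex (D : PDScheme) : Type :=
  {z : ℕ × List Pattern × Pattern × Config // (∀ x ∈ z.2.1 ++ [z.2.2.1], D.Allowed z.1 x) ∧
    ∃ anss, (z.2.2.2, anss) ∈ (D.run z.1 z.2.1).support}

theorem Efficient.oper (h : D.Efficient) :
    PolySamp (fun z : D.OperIndex => z.1.1 + encSize (z.1.2.1 ++ [z.1.2.2.1]))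
      (fun z => (Unary.mk z.1.1, z.1.2.2.2.kpub, z.1.2.2.2.khid, z.1.2.2.2.st, z.1.2.2.2.dev,
        z.1.2.2.1))
      fun z => D.oper z.1.1 z.1.2.2.2.kpub z.1.2.2.2.khid z.1.2.2.2.st z.1.2.2.2.dev z.1.2.2.1 := by
  obtain ⟨-, -, -, -, P, p, h⟩ := h
  refine ⟨P, p, ?_⟩
  rintro ⟨⟨κ, pats, pat, c⟩, ha, anss, hr⟩
  exact h κ pats pat ha _ hr

/-- A reachable private state of the ORAM is a packed configuration that arises from allowed
patterns. These patterns are computable from the requests in polynomial time, so a bound in their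
length is a bound in the length of the requests. -/
theorem toORAM_efficient_access (h : D.Efficient) (hU : D.Universal n P₁ P₂) :
    PolySamp (fun z : (D.toORAM n P₁).AccessIndex => z.1.1 + encSize (z.1.2.1 ++ [z.1.2.2.1]))
      (fun z => (Unary.mk z.1.1, z.1.2.2.2.1, z.1.2.2.2.2, z.1.2.2.1))
      fun z => (D.toORAM n P₁).access z.1.1 z.1.2.2.2.1 z.1.2.2.2.2 z.1.2.2.1 := by
  set sz := fun z : (D.toORAM n P₁).AccessIndex => z.1.1 + encSize (z.1.2.1 ++ [z.1.2.2.1]) with hsz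
  have hκ : PolyBdd sz fun z => z.1.1 := PolyBdd.self.mono fun z => Nat.le_add_right _ _
  have hreach : ∀ z : (D.toORAM n P₁).AccessIndex, ∃ (c : Config) (anss : _),
      (c, anss) ∈ (D.run z.1.1 (z.1.2.1.map (servePattern (n z.1.1) (P₁ z.1.1)))).support ∧
      z.1.2.2.2.1 = c.pack ∧ z.1.2.2.2.2 = c.dev := by
    rintro ⟨⟨κ, y, o, s, dev⟩, hl, ans, hr⟩
    simp only [toORAM_run, PMF.mem_support_map_iff, Prod.mk.injEq] at hr
    obtain ⟨⟨c, anss⟩, hc, h1, h2, -⟩ := hr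
    exact ⟨c, anss, hc, h1.symm, h2.symm⟩
  choose c anss hc hs hdev using hreach
  have hop := h.oper.reindex fun z : (D.toORAM n P₁).AccessIndex =>
    (⟨(z.1.1, z.1.2.1.map (servePattern (n z.1.1) (P₁ z.1.1)),
      servePattern (n z.1.1) (P₁ z.1.1) z.1.2.2.1, c z), by
        intro x hx
        have hx' : x ∈ (z.1.2.1 ++ [z.1.2.2.1]).map (servePattern (n z.1.1) (P₁ z.1.1)) := by
          rw [List.map_append]; exact hx
        obtain ⟨o, ho, rfl⟩ := List.mem_map.1 hx'
        exact allowed_servePattern hU (z.2.1 o ho), anss z, hc z⟩ : D.OperIndex)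
  have hy := PolyComp.input (sz := sz) (x := fun z => (Unary.mk z.1.1, z.1.2.1 ++ [z.1.2.2.1]))
    ((PolyBdd.self.mul (.const 3)).mono fun z => by
      have := encSize_pos (z.1.2.1 ++ [z.1.2.2.1])
      simp only [encSize_pair, encSize_unary, hsz]; omega)
  have hin₀ : PolyComp encSize (fun z : (Pattern × Unary) × Op => z) _ := .input .self
  have hpats := (hy.snd.listMap (c := fun z => (P₁ z.1.1, Unary.mk (n z.1.1)))
    (f := fun (c : Pattern × Unary) (o : Op) => servePattern c.2.val c.1 o)
    ((hU.computable₁.at hy.fst hκ).pair (hU.computable_n.at hy.fst hκ))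
    (hin₀.fst.snd.servePattern (m := fun z : (Pattern × Unary) × Op => z.1.2.val)
      hin₀.fst.fst hin₀.snd)).bdd
  have hop' := hop.resize (sz' := sz) ((hκ.add hpats).mono fun z => by
    simp only [List.map_append, List.map_singleton]
    exact le_rfl)
  have hin := PolyComp.input (sz := sz) (x := fun z => (Unary.mk z.1.1, z.1.2.2.2.1, z.1.2.2.2.2,
    z.1.2.2.1)) ((hop'.input_bdd.add (PolyBdd.self.add (.const 5))).mono fun z => by
      have h1 : encSize z.1.2.2.2.1 = encSize (c z).kpub + (encSize (c z).khid +
        encSize (c z).st + 1) + 1 := by rw [hs z]; rfl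
      have h2 := encSize_mem (show z.1.2.2.1 ∈ z.1.2.1 ++ [z.1.2.2.1] by simp)
      have h3 := hdev z
      simp only [encSize_pair, hsz] at h1 h2 ⊢
      rw [h3]
      omega)
  have hop'' := hop'.comp (hin.fst.pair ((hin.snd.fst.ofLeft (f := fun z => (c z).kpub) fun z =>
    (congrArg Data.left (hs z)).symm).pair (((hin.snd.fst.ofRight (f := fun z =>
        (z.1.2.2.2.1).right) fun z =>
      rfl).ofLeft (f := fun z => (c z).khid) fun z =>
        (congrArg (fun d : Data => d.right.left) (hs z)).symm).pair
    (((hin.snd.fst.ofRight (f := fun z => (z.1.2.2.2.1).right) fun z =>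
      rfl).ofRight (f := fun z => (c z).st) fun z =>
        (congrArg (fun d : Data => d.right.right) (hs z)).symm).pair
    ((hin.snd.snd.fst.congr (g := fun z => (c z).dev) fun z => hdev z).pair
      ((hU.computable_n.at hin.fst hκ).servePattern (hU.computable₁.at hin.fst hκ)
        hin.snd.snd.snd))))))
  have hin' := hop''.bindInput
  have hkp := hin'.fst.snd.fst.ofLeft (f := fun z => (c z.1.1).kpub) fun z =>
    (congrArg Data.left (hs z.1.1)).symm
  have hkh := (hin'.fst.snd.fst.ofRight (f := fun z => (z.1.1.1.2.2.2.1).right) fun z =>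
      rfl).ofLeft (f := fun z => (c z.1.1).khid) fun z =>
        (congrArg (fun d : Data => d.right.left) (hs z.1.1)).symm
  refine (PolySamp.bind hop'' (g := fun z u => PMF.pure (Data.cons (c z).kpub (Data.cons (c z).khid
    u.1), u.2.1, u.2.2.2.headD [])) ?_).congr fun z => ?_
  · exact (hkp.ofCons (hkh.ofCons hin'.snd.fst (f := fun z => Data.cons (c z.1.1).khid z.1.2.1)
      fun _ => rfl) fun _ => rfl).pair (hin'.snd.snd.fst.pair (hin'.snd.snd.snd.snd.headD rfl))
  · have hz := congrArg₂ (fun s dev => (D.toORAM n P₁).access z.1.1 s dev z.1.2.2.1) (hs z) (hdev z)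
    exact hz.symm

theorem toORAM_efficient (h : D.Efficient) (hU : D.Universal n P₁ P₂) :
    (D.toORAM n P₁).Efficient := by
  refine ⟨h.2.1, h.2.2.1, ?_, ?_⟩
  · have hs := h.2.2.2.1.polySamp
    refine (PolySamp.bind hs ?_).samplable
    have hin := hs.bindInput
    exact (hin.snd.fst.ofCons (hin.snd.snd.fst.ofCons hin.snd.snd.snd.fst
      (f := fun z => Data.cons z.1.2.2.1 z.1.2.2.2.1) fun _ => rfl) fun _ => rfl).pair
        hin.snd.snd.snd.snd
  · obtain ⟨P, p, hP⟩ := toORAM_efficient_access h hU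
    exact ⟨P, p, fun κ y o hl u hu => hP ⟨(κ, y, o, u.1, u.2.1), hl, u.2.2, hu⟩⟩

end PDScheme

/-! ### Comparing challengers -/

namespace Adversary

variable {Init Query Reply : Type} {κ : ℕ}

theorem play_map {S S' : Type} (A : Adversary Init Query Reply)
    {respond : S → Query → PMF (S × Reply)} {respond' : S' → Query → PMF (S' × Reply)} (φ : S → S')
    (h : ∀ c q, respond' (φ c) q = (respond c q).map fun u => (φ u.1, u.2)) (k : ℕ) :
    ∀ (c : S) (a : Data), A.play κ respond' k (φ c) a = A.play κ respond k c a := by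
  induction k with
  | zero => intro c a; rfl
  | succ k ih =>
    intro c a
    rw [play, play]
    refine congrArg _ (funext fun x => ?_)
    obtain ⟨_ | q, a'⟩ := x
    · exact ih c a'
    · simp only [h, PMF.bind_map, Function.comp_def, ih]

/-- A polynomial-time adversary submits only valid queries, so the challengers may differ on invalid
queries and outside the invariant. -/
theorem play_congr {S : Type} [Enc Init] [Enc Query] [Enc Reply] {A : Adversary Init Query Reply}
    {Valid : ℕ → Query → Prop} {r : Polynomial ℕ} (hA : A.IsPPT Valid r)
    {respond respond' : S → Query → PMF (S × Reply)} (Inv : S → Prop)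
    (h : ∀ c q, Inv c → Valid κ q → respond c q = respond' c q ∧
      ∀ u ∈ (respond c q).support, Inv u.1) (k : ℕ) :
    ∀ (c : S) (i n : ℕ) (a : Data), Inv c → i + k = r.eval κ → A.Reach κ i n a →
      A.play κ respond k c a = A.play κ respond' k c a := by
  obtain ⟨p, hp⟩ := hA.valid
  induction k with
  | zero => intro c i n a _ _ _; rfl
  | succ k ih =>
    intro c i n a hc hi hr
    rw [play, play]
    refine PMF.bind_congr_support fun x hx => ?_
    obtain ⟨_ | q, a'⟩ := x
    · exact ih c (i + 1) n a' hc (by omega) (.pass i n a a' hr hx)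
    · obtain ⟨h1, h2⟩ := h c q hc (hp κ i n a q a' (by omega) hr hx).1
      simp only [← h1]
      refine PMF.bind_congr_support fun u hu => PMF.bind_congr_support fun a'' ha'' => ?_
      exact ih u.1 (i + 1) _ a'' (h2 u hu) (by omega) (.round i n a a' a'' q _ hr hx ha'')

end Adversary

namespace PDScheme

variable {D : PDScheme} {n : ℕ → ℕ} {P₁ P₂ : ℕ → Pattern} {κ : ℕ}

/-! ### Submitting requests one by one -/

/-- Submit the triples that hide the given requests, one after the other, and collect the
traces. -/
noncomputable def submit {S : Type} (n : ℕ → ℕ) (P₁ P₂ : ℕ → Pattern) (κ : ℕ)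
    (respond : S → Pattern × Pattern × Pattern → PMF (S × (Device × Trace))) :
    S → List Op → PMF (S × Trace)
  | c, [] => PMF.pure (c, [])
  | c, o :: y => (respond c (serveQuery (n κ) (P₁ κ) (P₂ κ) o)).bind fun u =>
      (submit n P₁ P₂ κ respond u.1 y).bind fun v => PMF.pure (v.1, u.2.2 ++ v.2)

theorem respond_true (c : Config) (o : Op) :
    D.respond κ true c (serveQuery (n κ) (P₁ κ) (P₂ κ) o) =
      (D.step κ c (servePattern (n κ) (P₁ κ) o)).map fun u => (u.1, u.1.dev, wOnly u.2.1) := by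
  rw [respond, if_pos rfl, serveQuery_append]
  rfl

/-- With challenge bit 1 every triple executes exactly the pattern by which the ORAM serves the
request, so the collected `Write`s are those of the ORAM. -/
theorem toORAM_exec_submit (y : List Op) : ∀ c : Config,
    ((D.toORAM n P₁).exec κ c.pack c.dev y).map (fun a => ((a.1, a.2.1), wOnly a.2.2.1)) =
      (submit n P₁ P₂ κ (D.respond κ true) c y).map fun v => ((v.1.pack, v.1.dev), v.2) := by
  induction y with
  | nil => intro c; simp [ORAM.exec, submit, PMF.pure_map, wOnly]
  | cons o y ih =>
    intro c
    simp only [ORAM.exec, submit, respond_true, toORAM_access, PMF.map_bind, PMF.pure_map,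
      PMF.bind_map, Function.comp_def]
    refine PMF.bind_congr_support fun u hu => ?_
    have h := congrArg (fun μ => μ.bind fun a => PMF.pure (a.1, wOnly u.2.1 ++ a.2)) (ih u.1)
    simp only [PMF.bind_map, Function.comp_def, ← wOnly_append] at h
    rw [← dev_of_mem_step hu]
    exact h

/-- The configurations that arise from executing allowed patterns. -/
def Reachable (D : PDScheme) (κ : ℕ) (c : Config) : Prop :=
  ∃ pats, (∀ x ∈ pats, D.Allowed κ x) ∧ ∃ anss, (c, anss) ∈ (D.run κ pats).support

theorem mem_exec_snoc {pat : Pattern} {u : Config × Trace × List Block × List Block}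
    (pats : List Pattern) : ∀ {c c' : Config} {anss : List (List Block × List Block)},
    (c', anss) ∈ (D.exec κ c pats).support → u ∈ (D.step κ c' pat).support →
      (u.1, anss ++ [u.2.2]) ∈ (D.exec κ c (pats ++ [pat])).support := by
  induction pats with
  | nil =>
    intro c c' anss h hu
    simp only [exec, PMF.mem_support_pure_iff, Prod.mk.injEq] at h
    obtain ⟨rfl, rfl⟩ := h
    simp only [List.nil_append, exec, PMF.mem_support_bind_iff, PMF.mem_support_pure_iff]
    exact ⟨u, hu, _, rfl, rfl⟩
  | cons p pats ih =>
    intro c c' anss h hu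
    simp only [List.cons_append, exec, PMF.mem_support_bind_iff, PMF.mem_support_pure_iff,
      Prod.mk.injEq] at h ⊢
    obtain ⟨v, hv, w, hw, rfl, rfl⟩ := h
    exact ⟨v, hv, _, ih hw hu, rfl, rfl⟩

theorem Reachable.step {c : Config} (h : D.Reachable κ c) {pat : Pattern} (hp : D.Allowed κ pat)
    {u : Config × Trace × List Block × List Block} (hu : u ∈ (D.step κ c pat).support) :
    D.Reachable κ u.1 := by
  obtain ⟨pats, ha, anss, hr⟩ := h
  refine ⟨pats ++ [pat], fun x hx => ?_, anss ++ [u.2.2], ?_⟩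
  · rcases List.mem_append.1 hx with hx | hx
    · exact ha x hx
    · rwa [List.mem_singleton.1 hx]
  · simp only [run, PMF.mem_support_bind_iff] at hr ⊢
    obtain ⟨v, hv, hr⟩ := hr
    exact ⟨v, hv, mem_exec_snoc pats hr hu⟩

theorem reachable_initial {u : Config × Trace} (h : u ∈ (D.initial κ).support) :
    D.Reachable κ u.1 := by
  refine ⟨[], fun x hx => absurd hx List.not_mem_nil, [], ?_⟩
  simp only [run, PMF.mem_support_bind_iff]
  exact ⟨u, h, by simp [exec]⟩

theorem Reachable.respond {c : Config} (h : D.Reachable κ c) {q : Pattern × Pattern × Pattern}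
    (hq : D.ValidQuery κ q) {b : Bool} {u : Config × Device × Trace}
    (hu : u ∈ (D.respond κ b c q).support) : D.Reachable κ u.1 := by
  simp only [PDScheme.respond, PMF.mem_support_bind_iff, PMF.mem_support_pure_iff] at hu
  obtain ⟨v, hv, rfl⟩ := hu
  refine h.step ⟨q.1, q.2.1, q.2.2, hq, ?_⟩ hv
  cases b
  · exact .inl rfl
  · exact .inr rfl

theorem Reachable.submit (hU : D.Universal n P₁ P₂) {b : Bool} (y : List Op) :
    ∀ {c : Config}, D.Reachable κ c → (D.toORAM n P₁).LegitSeq κ y → ∀ {v : Config × Trace},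
      v ∈ (submit n P₁ P₂ κ (D.respond κ b) c y).support → D.Reachable κ v.1 := by
  induction y with
  | nil =>
    intro c h _ v hv
    simp only [PDScheme.submit, PMF.mem_support_pure_iff] at hv
    rwa [hv]
  | cons o y ih =>
    intro c h hl v hv
    simp only [PDScheme.submit, PMF.mem_support_bind_iff, PMF.mem_support_pure_iff] at hv
    obtain ⟨u, hu, w, hw, rfl⟩ := hv
    exact ih (v := w) (h.respond (validQuery_serveQuery hU (hl o List.mem_cons_self)) hu)
      (fun o' ho' => hl o' (List.mem_cons_of_mem _ ho')) hw

/-- With challenge bit 0 a `Read` leaves no mark: neither the internal state nor the device nor the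
visible trace changes. Reachability is needed because the dummy is harmless only after allowed
patterns. -/
theorem respond_dummy (hN : D.DummyNoop) {c : Config} (h : D.Reachable κ c) (Ph : Pattern) :
    D.respond κ false c ([pubDummy], [], Ph) = PMF.pure (c, c.dev, []) := by
  obtain ⟨pats, ha, anss, hr⟩ := h
  simp only [respond, step, PMF.bind_bind, PMF.pure_bind]
  refine PMF.bind_eq_of_support fun o ho => ?_
  obtain ⟨h1, h2⟩ := hN κ pats ha _ hr o ho
  have h3 : c.dev.exec o.2.1 = c.dev := by rw [← exec_wOnly, h2]; rfl
  simp only at h1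
  rw [h1, h2, h3]

/-- Execute the public patterns that hide a given number of `Write`s. -/
noncomputable def coverWrites (D : PDScheme) (P₁ P₂ : ℕ → Pattern) (κ : ℕ) :
    ℕ → Config → PMF (Config × Trace)
  | 0, c => PMF.pure (c, [])
  | k + 1, c => (D.step κ c (P₁ κ ++ P₂ κ)).bind fun u =>
      (coverWrites D P₁ P₂ κ k u.1).bind fun v => PMF.pure (v.1, wOnly u.2.1 ++ v.2)

/-- `Read`s vanish, and every `Write` runs the same public patterns whatever its address and
content. Only their number remains. -/
theorem submit_false (hN : D.DummyNoop) (hU : D.Universal n P₁ P₂) (y : List Op) :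
    ∀ {c : Config}, D.Reachable κ c → (D.toORAM n P₁).LegitSeq κ y →
      submit n P₁ P₂ κ (D.respond κ false) c y = D.coverWrites P₁ P₂ κ (writeCount y) c := by
  induction y with
  | nil => intro c _ _; rfl
  | cons o y ih =>
    intro c h hl
    have ih' := fun {u : Config × Device × Trace} hu => ih (c := u.1)
      (h.respond (validQuery_serveQuery hU (hl o List.mem_cons_self)) (b := false) (u := u) hu)
      fun o' ho' => hl o' (List.mem_cons_of_mem _ ho')
    cases o with
    | read a =>
      have h1 : serveQuery (n κ) (P₁ κ) (P₂ κ) (.read a) =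
        ([pubDummy], [], hiddenGen (n κ) (.read a)) := rfl
      rw [submit, PMF.bind_congr_support fun u hu => by rw [ih' hu], h1, respond_dummy hN h,
        PMF.pure_bind]
      simp only [List.nil_append]
      exact PMF.bind_pure _
    | write a d =>
      have h1 : serveQuery (n κ) (P₁ κ) (P₂ κ) (.write a d) =
        (P₁ κ, P₂ κ, hiddenGen (n κ) (.write a d)) := rfl
      have h2 : writeCount (.write a d :: y) = writeCount y + 1 :=
        List.countP_cons_of_pos rfl
      rw [submit, PMF.bind_congr_support fun u hu => by rw [ih' hu], h1, h2, coverWrites, respond,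
        PMF.bind_bind]
      simp only [PMF.pure_bind]
      rfl

end PDScheme

namespace PDScheme

variable {D : PDScheme} {n : ℕ → ℕ} {P₁ P₂ : ℕ → Pattern} {κ : ℕ} {A : ORAM.Distinguisher}
  {r p : Polynomial ℕ} {j : Bool}

/-! ### A coercer from a distinguisher -/

/-- The state of the coercer: the state of the distinguisher, the requests still to be submitted,
the trace collected for the distinguisher, whether the distinguisher waits for a reply, and the
number of its remaining rounds (in unary). -/
abbrev SubmitState := Data × List Op × Trace × Bool × List Bool

/-- The coercer that runs a distinguisher for `r κ` rounds, and hides the requests of its sequences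
number `j`. -/
noncomputable def coercer (n : ℕ → ℕ) (P₁ P₂ : ℕ → Pattern) (A : ORAM.Distinguisher)
    (r : Polynomial ℕ) (j : Bool) :
    TypedAdversary SubmitState (Data × Trace) (Pattern × Pattern × Pattern) (Device × Trace) where
  start κ m := (A.start κ m.2).bind fun a =>
    PMF.pure (a, [], [], false, List.replicate (r.eval κ) false)
  ask κ s := match s with
    | (a, o :: y, acc, w, rem) =>
        PMF.pure (some (serveQuery (n κ) (P₁ κ) (P₂ κ) o), a, y, acc, w, rem)
    | (a, [], acc, true, rem) =>
        (A.tell κ a acc).bind fun a' => PMF.pure (none, a', [], [], false, rem)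
    | (a, [], acc, false, []) => PMF.pure (none, a, [], acc, false, [])
    | (a, [], _, false, _ :: rem) => (A.ask κ a).bind fun x =>
        match x.1 with
        | none => PMF.pure (none, x.2, [], [], false, rem)
        | some q => PMF.pure (none, x.2, if j then q.2 else q.1, [], true, rem)
  tell _ s m := PMF.pure (s.1, s.2.1, s.2.2.1 ++ m.2, s.2.2.2)
  guess κ s := A.guess κ s.1

theorem coercer_ask_cons (a : Data) (o : Op) (y : List Op) (acc : Trace) (w : Bool)
    (rem : List Bool) : (coercer n P₁ P₂ A r j).ask κ (a, o :: y, acc, w, rem) =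
      PMF.pure (some (serveQuery (n κ) (P₁ κ) (P₂ κ) o), a, y, acc, w, rem) := rfl

theorem coercer_ask_waiting (a : Data) (acc : Trace) (rem : List Bool) :
    (coercer n P₁ P₂ A r j).ask κ (a, [], acc, true, rem) =
      (A.tell κ a acc).bind fun a' => PMF.pure (none, a', [], [], false, rem) := rfl

theorem coercer_ask_done (a : Data) (acc : Trace) :
    (coercer n P₁ P₂ A r j).ask κ (a, [], acc, false, []) =
      PMF.pure (none, a, [], acc, false, []) := rfl

theorem coercer_ask_idle (a : Data) (acc : Trace) (b : Bool) (rem : List Bool) :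
    (coercer n P₁ P₂ A r j).ask κ (a, [], acc, false, b :: rem) =
      (A.ask κ a).bind fun x =>
        match x.1 with
        | none => PMF.pure (none, x.2, [], [], false, rem)
        | some q => PMF.pure (none, x.2, if j then q.2 else q.1, [], true, rem) := rfl

theorem coercer_tell (s : SubmitState) (m : Device × Trace) :
    (coercer n P₁ P₂ A r j).tell κ s m =
      PMF.pure (s.1, s.2.1, s.2.2.1 ++ m.2, s.2.2.2) := rfl

/-- The queries of the distinguisher have length at most `p κ`. -/
def QueryBound (A : ORAM.Distinguisher) (r p : Polynomial ℕ) : Prop :=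
  ∀ κ i n s q s', i < r.eval κ → A.Reach κ i n s →
    (some q, s') ∈ (A.ask κ s).support → encSize q ≤ p.eval κ

section Play

variable {S : Type} {respond : S → Pattern × Pattern × Pattern → PMF (S × (Device × Trace))}

theorem play_coercer_done (k : ℕ) : ∀ (c : S) (a : Data) (acc : Trace),
    (coercer n P₁ P₂ A r j).play κ respond k c (a, [], acc, false, []) = A.guess κ a := by
  induction k with
  | zero => intro c a acc; rfl
  | succ k ih =>
    intro c a acc
    rw [TypedAdversary.play, coercer_ask_done, PMF.pure_bind]
    exact ih c a acc

/-- Each request takes one round; one more round passes the collected trace on to the distinguisher.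
-/
theorem play_coercer_submit (a : Data) (rem : List Bool) (k : ℕ) (y : List Op) :
    ∀ (c : S) (acc : Trace),
    (coercer n P₁ P₂ A r j).play κ respond (y.length + 1 + k) c (a, y, acc, true, rem) =
      (submit n P₁ P₂ κ respond c y).bind fun v => (A.tell κ a (acc ++ v.2)).bind fun a' =>
        (coercer n P₁ P₂ A r j).play κ respond k v.1 (a', [], [], false, rem) := by
  induction y with
  | nil =>
    intro c acc
    rw [List.length_nil, zero_add, add_comm, TypedAdversary.play, coercer_ask_waiting, submit,
      PMF.pure_bind, PMF.bind_bind]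
    simp only [PMF.pure_bind, List.append_nil]
  | cons o y ih =>
    intro c acc
    rw [show (o :: y).length + 1 + k = (y.length + 1 + k) + 1 by rw [List.length_cons]; omega,
      TypedAdversary.play, coercer_ask_cons, PMF.pure_bind, submit, PMF.bind_bind]
    simp only [coercer_tell, PMF.pure_bind, ih, PMF.bind_bind, List.append_assoc]

/-- One round of the distinguisher costs the coercer one round for its query, fewer than `p` rounds
for its requests and one round for the reply, so `p + 2` rounds suffice. Surplus rounds are passed
idly at the end. -/
theorem play_coercer (hp : QueryBound A r p) (m : ℕ) :
    ∀ (k i nA : ℕ) (c : S) (a : Data) (acc : Trace), m * (p.eval κ + 2) ≤ k → i + m = r.eval κ →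
      A.Reach κ i nA a →
      (coercer n P₁ P₂ A r j).play κ respond k c (a, [], acc, false, List.replicate m false) =
        A.play κ (fun c q => submit n P₁ P₂ κ respond c (if j then q.2 else q.1)) m c a := by
  induction m with
  | zero => intro k i nA c a acc _ _ _; exact play_coercer_done k c a acc
  | succ m ih =>
    intro k i nA c a acc hk hi hr
    rw [add_mul, one_mul] at hk
    obtain ⟨k, rfl⟩ : ∃ k', k = k' + 1 := ⟨k - 1, by omega⟩
    rw [List.replicate_succ, TypedAdversary.play, coercer_ask_idle, PMF.bind_bind, Adversary.play]
    refine PMF.bind_congr_support fun x hx => ?_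
    obtain ⟨_ | q, a'⟩ := x
    · simp only [PMF.pure_bind]
      exact ih k (i + 1) nA c a' [] (by omega) (by omega) (.pass i nA a a' hr hx)
    · simp only [PMF.pure_bind]
      have h1 := hp κ i nA a q a' (by omega) hr hx
      have h2 : (if j then q.2 else q.1).length < p.eval κ := by
        have e1 : encSize q = encSize q.1 + encSize q.2 + 1 := rfl
        have e2 := length_lt_encSize q.1
        have e3 := length_lt_encSize q.2
        split_ifs <;> omega
      obtain ⟨k', rfl⟩ : ∃ k', k = (if j then q.2 else q.1).length + 1 + k' :=
        ⟨k - ((if j then q.2 else q.1).length + 1), by omega⟩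
      rw [play_coercer_submit]
      simp only [List.nil_append]
      refine congrArg _ (funext fun v => PMF.bind_congr_support fun a'' ha'' => ?_)
      exact ih k' (i + 1) _ v.1 a'' [] (by omega) (by omega) (.round i nA a a' a'' q _ hr hx ha'')

end Play

theorem world_coercer (D : PDScheme) (hp : QueryBound A r p) (b : Bool) :
    D.world (coercer n P₁ P₂ A r j).toAdversary (r * (p + 2)) b κ =
      (D.initial κ).bind fun c => (A.start κ (wOnly c.2)).bind fun a =>
        A.play κ (fun c q => submit n P₁ P₂ κ (D.respond κ b) c (if j then q.2 else q.1))
          (r.eval κ) c.1 a := by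
  rw [world]
  refine congrArg _ (funext fun c => ?_)
  change ((PMF.map Enc.enc ((coercer n P₁ P₂ A r j).start κ (c.1.kpub, wOnly c.2))).bind _) = _
  rw [PMF.bind_map, show (coercer n P₁ P₂ A r j).start κ (c.1.kpub, wOnly c.2) =
    (A.start κ (wOnly c.2)).bind fun a =>
      PMF.pure (a, [], [], false, List.replicate (r.eval κ) false) from rfl, PMF.bind_bind]
  refine PMF.bind_congr_support fun a ha => ?_
  rw [PMF.pure_bind, Function.comp_apply, TypedAdversary.toAdversary_play]
  refine play_coercer hp _ _ 0 _ _ _ _ ?_ (zero_add _) (.start _ a ha)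
  simp

/-- For `b = 1` the distinguisher inside the coercer sees the genuine ORAM executing its `j`-th
sequences. -/
theorem toORAM_world (hp : QueryBound A r p) :
    (D.toORAM n P₁).world A r j κ =
      D.world (coercer n P₁ P₂ A r j).toAdversary (r * (p + 2)) true κ := by
  rw [world_coercer D hp, ORAM.world, toORAM_setup, PMF.bind_map]
  refine PMF.bind_congr_support fun u hu => ?_
  simp only [Function.comp_apply, ← dev_of_mem_initial hu]
  refine congrArg _ (funext fun a => ?_)
  refine A.play_map (fun c : Config => (c.pack, c.dev)) (fun c q => ?_) _ u.1 a
  rw [← toORAM_exec_submit]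
  rfl

/-- The two sequences of a valid query have the same number of `Write`s, and for `b = 0` nothing
else matters. This common world links the two coercers. -/
theorem world_coercer_false (hN : D.DummyNoop) (hU : D.Universal n P₁ P₂)
    (hA : A.IsPPT (D.toORAM n P₁).ValidQuery r)
    (hp : QueryBound A r p) :
    D.world (coercer n P₁ P₂ A r true).toAdversary (r * (p + 2)) false κ =
      D.world (coercer n P₁ P₂ A r false).toAdversary (r * (p + 2)) false κ := by
  rw [world_coercer D hp, world_coercer D hp]
  refine PMF.bind_congr_support fun u hu => PMF.bind_congr_support fun a ha => ?_
  refine Adversary.play_congr hA (D.Reachable κ) (fun c q hc hq => ?_) _ u.1 0 _ a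
    (reachable_initial hu) (zero_add _) (.start _ a ha)
  obtain ⟨h1, h2, h3⟩ := hq
  refine ⟨?_, fun v hv => hc.submit hU _ h2 hv⟩
  change submit n P₁ P₂ κ _ c q.2 = submit n P₁ P₂ κ _ c q.1
  rw [submit_false hN hU _ hc h2, submit_false hN hU _ hc h1, h3]

end PDScheme

/-! ### The invariant of the coercer -/

namespace PDScheme

variable {D : PDScheme} {n : ℕ → ℕ} {P₁ P₂ : ℕ → Pattern} {κ : ℕ} {A : ORAM.Distinguisher}
  {r p : Polynomial ℕ} {j : Bool} {Valid : ℕ → List Op × List Op → Prop}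

/-- What is known about the state of the coercer after `i` rounds in which it has received messages
of length `l`: the distinguisher has completed `k` rounds with messages of length `nA`, and `m`
rounds remain. -/
structure SubmitInv (A : ORAM.Distinguisher) (r p : Polynomial ℕ) (j : Bool) (κ i l : ℕ)
    (s : SubmitState) (nA k m : ℕ) : Prop where
  remaining : s.2.2.2.2 = List.replicate m false
  size : nA + encSize s.2.2.1 ≤ l + i
  potential : i + s.2.1.length + (if s.2.2.2.1 then 1 else 0) + m * (p.eval κ + 2) ≤
    (r * (p + 2)).eval κ
  idle : s.2.2.2.1 = false → s.2.1 = [] ∧ k + m = r.eval κ ∧ A.Reach κ k nA s.1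
  pending : s.2.2.2.1 = true → k + m + 1 = r.eval κ ∧ ∃ a₀ q, A.Reach κ k nA a₀ ∧
    (some q, s.1) ∈ (A.ask κ a₀).support ∧ s.2.1 <:+ (if j then q.2 else q.1)

theorem mem_coercer_ask_some {s s' : SubmitState} {q : Pattern × Pattern × Pattern}
    (h : (some q, s') ∈ ((coercer n P₁ P₂ A r j).ask κ s).support) :
    ∃ o, s.2.1 = o :: s'.2.1 ∧ q = serveQuery (n κ) (P₁ κ) (P₂ κ) o ∧
      s' = (s.1, s'.2.1, s.2.2) := by
  obtain ⟨a, _ | ⟨o, y⟩, acc, w, rem⟩ := s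
  · exfalso
    cases w with
    | true =>
      simp only [coercer_ask_waiting, PMF.mem_support_bind_iff, PMF.mem_support_pure_iff] at h
      obtain ⟨_, -, h⟩ := h
      simp at h
    | false =>
      cases rem with
      | nil => simp [coercer_ask_done] at h
      | cons b rem =>
        simp only [coercer_ask_idle, PMF.mem_support_bind_iff] at h
        obtain ⟨⟨_ | q, a'⟩, -, h⟩ := h <;> simp at h
  · simp only [coercer_ask_cons, PMF.mem_support_pure_iff, Prod.mk.injEq, Option.some.injEq] at h
    obtain ⟨rfl, rfl⟩ := h
    exact ⟨o, rfl, rfl, rfl⟩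

/-- The potential adds the elapsed rounds and the rounds still owed: pending requests, an
outstanding reply, and `p + 2` for each remaining round of the distinguisher. A pass pays for the
round that it uses. -/
theorem SubmitInv.pass (hp : QueryBound A r p) {i l : ℕ} {s s' : SubmitState}
    (hi : i < (r * (p + 2)).eval κ)
    (h : ∃ nA k m, SubmitInv A r p j κ i l s nA k m)
    (hs : (none, s') ∈ ((coercer n P₁ P₂ A r j).ask κ s).support) :
    ∃ nA k m, SubmitInv A r p j κ (i + 1) l s' nA k m := by
  obtain ⟨nA, k, m, h⟩ := h
  obtain ⟨a, _ | ⟨o, y⟩, acc, w, rem⟩ := s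
  · have hrem := h.remaining
    have hsize := h.size
    have hpot := h.potential
    simp only at hrem hsize hpot
    have hacc := encSize_pos acc
    cases w with
    | true =>
      simp only [coercer_ask_waiting, PMF.mem_support_bind_iff, PMF.mem_support_pure_iff,
        Prod.mk.injEq, true_and] at hs
      obtain ⟨a', ha', rfl⟩ := hs
      obtain ⟨hk, a₀, q, hr, hq, -⟩ := h.pending rfl
      -- The accumulated trace becomes a message to the distinguisher; the fresh empty accumulator
      -- has size 1, which the advance of `i` pays.
      refine ⟨nA + encSize acc, k + 1, m, hrem, ?_, ?_, fun _ => ⟨rfl, by omega,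
        .round k nA a₀ a a' q acc hr hq ha'⟩, fun h => (nomatch h)⟩
      · simp only [encSize_nil]; omega
      · simp only [List.length_nil, if_true] at hpot ⊢
        simp only [Bool.false_eq_true, if_false]
        omega
    | false =>
      obtain ⟨-, hk, hr⟩ := h.idle rfl
      cases m with
      | zero =>
        obtain rfl : rem = [] := hrem
        simp only [coercer_ask_done, PMF.mem_support_pure_iff, Prod.mk.injEq, true_and] at hs
        subst hs
        -- In a surplus round nothing is owed, and the potential stays bounded because the round is
        -- one of those allowed, by `hi`.
        refine ⟨nA, k, 0, rfl, ?_, ?_, fun _ => ⟨rfl, hk, hr⟩, fun h => (nomatch h)⟩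
        · simp only; omega
        · simp only [List.length_nil, Bool.false_eq_true, if_false]
          omega
      | succ m =>
        rw [List.replicate_succ] at hrem
        subst hrem
        simp only [List.length_nil, Bool.false_eq_true, if_false, add_mul, one_mul] at hpot
        simp only [coercer_ask_idle, PMF.mem_support_bind_iff] at hs
        obtain ⟨⟨_ | q, a'⟩, hx, hs⟩ := hs
        · simp only [PMF.mem_support_pure_iff, Prod.mk.injEq, true_and] at hs
          subst hs
          refine ⟨nA, k + 1, m, rfl, ?_, ?_, fun _ => ⟨rfl, by omega, .pass k nA a a' hr hx⟩,
            fun h => (nomatch h)⟩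
          · simp only [encSize_nil]; omega
          · simp only [List.length_nil, Bool.false_eq_true, if_false]; omega
        · simp only [PMF.mem_support_pure_iff, Prod.mk.injEq, true_and] at hs
          subst hs
          have h1 := hp κ k nA a q a' (by omega) hr hx
          have h2 : (if j then q.2 else q.1).length < p.eval κ := by
            have e1 : encSize q = encSize q.1 + encSize q.2 + 1 := rfl
            have e2 := length_lt_encSize q.1
            have e3 := length_lt_encSize q.2
            split_ifs <;> omega
          refine ⟨nA, k, m, rfl, ?_, ?_, fun h => (nomatch h), fun _ => ⟨by omega, a, q, hr, hx,
            List.suffix_refl _⟩⟩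
          · simp only [encSize_nil]; omega
          · simp only [if_true]; omega
  · simp [coercer_ask_cons] at hs

theorem SubmitInv.round {i l : ℕ} {s s' s'' : SubmitState} {q : Pattern × Pattern × Pattern}
    {t : Device × Trace} (h : ∃ nA k m, SubmitInv A r p j κ i l s nA k m)
    (hs : (some q, s') ∈ ((coercer n P₁ P₂ A r j).ask κ s).support)
    (hs' : s'' ∈ ((coercer n P₁ P₂ A r j).tell κ s' t).support) :
    ∃ nA k m, SubmitInv A r p j κ (i + 1) (l + encSize t) s'' nA k m := by
  obtain ⟨nA, k, m, h⟩ := h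
  obtain ⟨o, ho, -, he⟩ := mem_coercer_ask_some hs
  rw [coercer_tell, PMF.mem_support_pure_iff] at hs'
  obtain ⟨a, y, acc, w, rem⟩ := s
  obtain ⟨a', y', rest⟩ := s'
  simp only [Prod.mk.injEq, true_and] at he ho
  obtain ⟨rfl, rfl⟩ := he
  subst ho hs'
  refine ⟨nA, k, m, h.remaining, ?_, ?_, fun hw => ?_, fun hw => ?_⟩
  · have h1 := h.size
    have h2 : encSize t = encSize t.1 + encSize t.2 + 1 := rfl
    have h3 := encSize_append acc t.2
    simp only at h1 ⊢
    omega
  · have h1 := h.potential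
    simp only [List.length_cons] at h1 ⊢
    omega
  · exact absurd (h.idle hw).1 (by simp)
  · obtain ⟨hk, a₀, q', hr, hq', hsuf⟩ := h.pending hw
    exact ⟨hk, a₀, q', hr, hq', (List.suffix_cons _ _).trans hsuf⟩

/-- The situations in which the coercer has to act. -/
abbrev AskIndex (A : ORAM.Distinguisher) (r p : Polynomial ℕ) (j : Bool) : Type :=
  {z : ℕ × ℕ × ℕ × SubmitState // z.2.1 < (r * (p + 2)).eval z.1 ∧
    ∃ nA k m, SubmitInv A r p j z.1 z.2.1 z.2.2.1 z.2.2.2 nA k m}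

/-- The distinguisher's state is an input of its `ask` or `guess` when it is idle and an output of
its `ask` when it waits, so its own running time bounds it. Pending requests are a suffix of a
query, and the accumulator is charged to the messages received. -/
theorem SubmitInv.encSize_le (hA : A.IsPPT Valid r) (hp : QueryBound A r p) :
    ∃ Q : Polynomial ℕ, ∀ {κ i l : ℕ} {s : SubmitState} {nA k m : ℕ}, i ≤ (r * (p + 2)).eval κ →
      SubmitInv A r p j κ i l s nA k m → encSize s ≤ Q.eval (κ + l) := by
  obtain ⟨q₁, hq₁⟩ := hA.ask.input_bdd
  obtain ⟨q₂, hq₂⟩ := hA.ask.output_bdd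
  obtain ⟨q₃, hq₃⟩ := hA.guess.input_bdd
  set R := r * (p + 2) with hR
  refine ⟨(q₁ + q₂ + q₃).comp (Polynomial.X + R) + p + (Polynomial.X + R) + 2 * r + 10, ?_⟩
  intro κ i l s nA k m hi h
  have hRm := R.eval_nat_mono (Nat.le_add_right κ l)
  have hpm := p.eval_nat_mono (Nat.le_add_right κ l)
  have hrm := r.eval_nat_mono (Nat.le_add_right κ l)
  have hsz := h.size
  have hacc := encSize_pos s.2.2.1
  have hκA : κ + nA ≤ κ + l + R.eval (κ + l) := by omega
  have e₁ := q₁.eval_nat_mono hκA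
  have e₂ := q₂.eval_nat_mono hκA
  have e₃ := q₃.eval_nat_mono hκA
  have hs : encSize s = encSize s.1 + (encSize s.2.1 + (encSize s.2.2.1 +
    (encSize s.2.2.2.1 + encSize s.2.2.2.2 + 1) + 1) + 1) + 1 := rfl
  have hw := encSize_bool_le s.2.2.2.1
  have hm : encSize s.2.2.2.2 = 2 * m + 1 := by rw [h.remaining]; exact encSize_unary m
  have hmr : m ≤ r.eval κ ∧ encSize s.1 ≤ q₁.eval (κ + l + R.eval (κ + l)) +
      q₂.eval (κ + l + R.eval (κ + l)) + q₃.eval (κ + l + R.eval (κ + l)) ∧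
      encSize s.2.1 ≤ p.eval κ + 1 := by
    cases hws : s.2.2.2.1 with
    | false =>
      obtain ⟨h1, h2, h3⟩ := h.idle hws
      refine ⟨by omega, ?_, by rw [h1, encSize_nil]; omega⟩
      cases m with
      | zero =>
        have h4 := hq₃ ⟨(κ, nA, s.1), by rw [show r.eval κ = k by omega]; exact h3⟩
        simp only [encSize_pair] at h4
        omega
      | succ m =>
        have h4 := hq₁ ⟨(κ, k, nA, s.1), by simp only; omega, h3⟩
        simp only [encSize_pair] at h4
        omega
    | true =>
      obtain ⟨h1, a₀, q, h2, h3, h4⟩ := h.pending hws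
      have h5 := hq₂ ⟨(κ, k, nA, a₀), by simp only; omega, h2⟩ _ h3
      have h6 := hp κ k nA a₀ q _ (by omega) h2 h3
      have h7 : encSize q = encSize q.1 + encSize q.2 + 1 := rfl
      simp only [encSize_pair] at h5
      refine ⟨by omega, by omega, ?_⟩
      obtain ⟨y, hy⟩ := h4
      have h8 := encSize_append y s.2.1
      rw [hy] at h8
      have h9 := encSize_pos y
      split_ifs at h8 <;> omega
  simp only [Polynomial.eval_add, Polynomial.eval_mul, Polynomial.eval_comp, Polynomial.eval_X,
    Polynomial.eval_ofNat]
  omega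

end PDScheme

theorem enc_list_eq_nil {α : Type} [Enc α] {l : List α} : Enc.enc l = Data.nil ↔ l = [] := by
  cases l
  · exact ⟨fun _ => rfl, fun _ => rfl⟩
  · exact ⟨fun h => (nomatch h), fun h => (nomatch h)⟩

/-! ### The coercer is polynomial time -/

namespace PDScheme

variable {D : PDScheme} {n : ℕ → ℕ} {P₁ P₂ : ℕ → Pattern} {κ : ℕ} {A : ORAM.Distinguisher}
  {r p : Polynomial ℕ} {j : Bool} {Valid : ℕ → List Op × List Op → Prop}

/-- The security parameter and the length of the messages received. -/
def AskIndex.size (z : AskIndex A r p j) : ℕ := z.1.1 + z.1.2.2.1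

theorem AskIndex.polyBdd_param : PolyBdd (fun z : AskIndex A r p j => z.size) fun z => z.1.1 :=
  PolyBdd.self.mono fun _ => Nat.le_add_right _ _

/-- The number of rounds played is itself polynomial in `κ`, so the extra term in the size invariant
does no harm. -/
theorem AskIndex.polyBdd_of_le {J : Type} {e : J → AskIndex A r p j} {nA : J → ℕ}
    (h : ∀ z, nA z ≤ (e z).1.2.2.1 + (e z).1.2.1) :
    PolyBdd (fun z => (e z).size) fun z => (e z).1.1 + nA z := by
  refine (PolyBdd.self.add ((AskIndex.polyBdd_param.reindex e).eval (r * (p + 2)))).mono fun z => ?_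
  have h1 := h z
  have h2 := (e z).2.1
  simp only [AskIndex.size]
  omega

theorem polyComp_askInput (hA : A.IsPPT Valid r) (hp : QueryBound A r p) :
    PolyComp (fun z : AskIndex A r p j => z.size) (fun z => (Unary.mk z.1.1, z.1.2.2.2))
      fun z => (Unary.mk z.1.1, z.1.2.2.2) := by
  obtain ⟨Q, hQ⟩ := SubmitInv.encSize_le (j := j) hA hp
  refine .input (((PolyBdd.self.mul (.const 2)).add ((PolyBdd.self.eval Q).add (.const 2))).mono
    fun z => ?_)
  obtain ⟨nA, k, m, h⟩ := z.2.2
  have h1 := hQ z.2.1.le h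
  simp only [encSize_pair, encSize_unary, AskIndex.size] at h1 ⊢
  omega

/-- The coercer acts in four ways, each treated on its own index set; nested tests on the pending
requests, the waiting flag and the counter put them together in `polySamp_ask`. -/
theorem polySamp_ask_cons (hA : A.IsPPT Valid r) (hp : QueryBound A r p)
    (hU : D.Universal n P₁ P₂) :
    PolySamp (fun z : {z : AskIndex A r p j // z.1.2.2.2.2.1 ≠ []} => z.1.size)
      (fun z => (Unary.mk z.1.1.1, z.1.1.2.2.2))
      fun z => (coercer n P₁ P₂ A r j).ask z.1.1.1 z.1.1.2.2.2 := by
  have hin := (polyComp_askInput hA hp).reindex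
    fun z : {z : AskIndex A r p j // z.1.2.2.2.2.1 ≠ []} => z.1
  have hκ := (AskIndex.polyBdd_param (A := A) (r := r) (p := p) (j := j)).reindex
    fun z : {z : AskIndex A r p j // z.1.2.2.2.2.1 ≠ []} => z.1
  have ho := hin.snd.snd.fst.head (f := fun z => z.1.1.2.2.2.2.1.head z.2) fun z =>
    ⟨_, (List.cons_head_tail z.2).symm⟩
  have hq := (hU.computable_n.at hin.fst hκ).serveQuery (hU.computable₁.at hin.fst hκ)
    (hU.computable₂.at hin.fst hκ) ho
  refine PolySamp.congr (hq.some.pair (hin.snd.fst.pair (hin.snd.snd.fst.tail.pair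
    hin.snd.snd.snd))) ?_
  rintro ⟨⟨⟨κ, i, l, a, _ | ⟨o, y⟩, acc, w, rem⟩, h⟩, hne⟩
  · exact absurd rfl hne
  · rfl

theorem polySamp_ask_waiting (hA : A.IsPPT Valid r) (hp : QueryBound A r p) :
    PolySamp (fun z : {z : AskIndex A r p j // z.1.2.2.2.2.1 = [] ∧ z.1.2.2.2.2.2.2.1 = true} =>
        z.1.size)
      (fun z => (Unary.mk z.1.1.1, z.1.1.2.2.2))
      fun z => (coercer n P₁ P₂ A r j).ask z.1.1.1 z.1.1.2.2.2 := by
  have hin := (polyComp_askInput hA hp).reindex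
    fun z : {z : AskIndex A r p j // z.1.2.2.2.2.1 = [] ∧ z.1.2.2.2.2.2.2.1 = true} => z.1
  choose nA k m hinv using fun z : {z : AskIndex A r p j //
    z.1.2.2.2.2.1 = [] ∧ z.1.2.2.2.2.2.2.1 = true} => z.1.2.2
  choose hk a₀ q hr hq _ using fun z => (hinv z).pending z.2.2
  have ht := ((hA.tell.reindex fun z => ⟨(z.1.1.1, k z, nA z, a₀ z, q z, z.1.1.2.2.2.1,
    z.1.1.2.2.2.2.2.1), by have := hk z; simp only; omega, hr z, hq z⟩).resize
      ((AskIndex.polyBdd_of_le (e := fun z => z.1) fun z => (hinv z).size).mono fun z => by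
        simp only; omega)).comp (hin.fst.pair (hin.snd.fst.pair hin.snd.snd.snd.fst))
  have hin' := ht.bindInput
  refine (PolySamp.bind ht (g := fun z a' => PMF.pure (none, a', [], [], false,
    z.1.1.2.2.2.2.2.2.2)) ?_).congr ?_
  · exact (PolyComp.const hin'.input_bdd none).pair (hin'.snd.pair ((PolyComp.nil
      hin'.input_bdd).pair ((PolyComp.nil hin'.input_bdd).pair ((PolyComp.const hin'.input_bdd
        false).pair hin'.fst.snd.snd.snd.snd.snd))))
  · rintro ⟨⟨⟨κ, i, l, a, y, acc, w, rem⟩, h⟩, hy, hw⟩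
    simp only at hy hw
    subst hy hw
    rfl

theorem polySamp_ask_done (hA : A.IsPPT Valid r) (hp : QueryBound A r p) :
    PolySamp (fun z : {z : AskIndex A r p j // z.1.2.2.2.2.1 = [] ∧ z.1.2.2.2.2.2.2.1 = false ∧
        z.1.2.2.2.2.2.2.2 = []} => z.1.size)
      (fun z => (Unary.mk z.1.1.1, z.1.1.2.2.2))
      fun z => (coercer n P₁ P₂ A r j).ask z.1.1.1 z.1.1.2.2.2 := by
  have hin := (polyComp_askInput hA hp).reindex fun z : {z : AskIndex A r p j //
    z.1.2.2.2.2.1 = [] ∧ z.1.2.2.2.2.2.2.1 = false ∧ z.1.2.2.2.2.2.2.2 = []} => z.1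
  refine PolySamp.congr ((PolyComp.const hin.input_bdd none).pair hin.snd) ?_
  rintro ⟨⟨⟨κ, i, l, a, y, acc, w, rem⟩, h⟩, hy, hw, hrem⟩
  simp only at hy hw hrem
  subst hy hw hrem
  rfl

theorem polySamp_ask_idle (hA : A.IsPPT Valid r) (hp : QueryBound A r p) :
    PolySamp (fun z : {z : AskIndex A r p j // z.1.2.2.2.2.1 = [] ∧ z.1.2.2.2.2.2.2.1 = false ∧
        z.1.2.2.2.2.2.2.2 ≠ []} => z.1.size)
      (fun z => (Unary.mk z.1.1.1, z.1.1.2.2.2))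
      fun z => (coercer n P₁ P₂ A r j).ask z.1.1.1 z.1.1.2.2.2 := by
  have hin := (polyComp_askInput hA hp).reindex fun z : {z : AskIndex A r p j //
    z.1.2.2.2.2.1 = [] ∧ z.1.2.2.2.2.2.2.1 = false ∧ z.1.2.2.2.2.2.2.2 ≠ []} => z.1
  choose nA k m hinv using fun z : {z : AskIndex A r p j //
    z.1.2.2.2.2.1 = [] ∧ z.1.2.2.2.2.2.2.1 = false ∧ z.1.2.2.2.2.2.2.2 ≠ []} => z.1.2.2
  have hk : ∀ z, k z < r.eval z.1.1.1 := by
    intro z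
    have h1 := ((hinv z).idle z.2.2.1).2.1
    have h2 : m z ≠ 0 := by
      intro h3
      have h4 := (hinv z).remaining
      rw [h3] at h4
      exact z.2.2.2 h4
    omega
  have ha := ((hA.ask.reindex fun z => ⟨(z.1.1.1, k z, nA z, z.1.1.2.2.2.1), hk z,
    ((hinv z).idle z.2.2.1).2.2⟩).resize (AskIndex.polyBdd_of_le (e := fun z => z.1) fun z =>
      (Nat.le_add_right _ _).trans (hinv z).size)).comp (hin.fst.pair hin.snd.fst)
  have hin' := ha.bindInput
  refine (PolySamp.bind ha (g := fun z x => match x.1 with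
    | none => PMF.pure (none, x.2, [], [], false, z.1.1.2.2.2.2.2.2.2.tail)
    | some q => PMF.pure (none, x.2, if j then q.2 else q.1, [], true,
        z.1.1.2.2.2.2.2.2.2.tail)) ?_).congr ?_
  · refine PolySamp.optionCases hin'.snd.fst ?_ ?_
    · have h := (PolyComp.const hin'.input_bdd (none : Option (Pattern × Pattern × Pattern))).pair
        (hin'.snd.snd.pair ((PolyComp.nil (β := Op) hin'.input_bdd).pair
          ((PolyComp.nil (β := Access) hin'.input_bdd).pair ((PolyComp.const hin'.input_bdd
            false).pair hin'.fst.snd.snd.snd.snd.snd.tail))))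
      refine PolySamp.congr (PolySamp.reindex h _) fun z => ?_
      rw [show z.1.1.2.1 = none from z.2]
    · have hin'' := hin'.snd.fst.someInput
      have hy : PolyComp _ _ _ := PolyComp.ite (.const hin''.input_bdd j) hin''.snd.snd
          hin''.snd.fst
      have h := (PolyComp.const hin''.input_bdd (none : Option (Pattern × Pattern × Pattern))).pair
        (hin''.fst.snd.snd.pair (hy.pair
          ((PolyComp.nil (β := Access) hin''.input_bdd).pair ((PolyComp.const hin''.input_bdd
            true).pair hin''.fst.fst.snd.snd.snd.snd.snd.tail))))
      refine PolySamp.congr h fun z => ?_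
      rw [show z.1.1.1.2.1 = some z.1.2 from z.2]
  · rintro ⟨⟨⟨κ, i, l, a, y, acc, w, _ | ⟨b, rem⟩⟩, h⟩, hy, hw, hrem⟩
    · exact absurd rfl hrem
    · simp only at hy hw
      subst hy hw
      rfl

theorem polySamp_ask_free (hA : A.IsPPT Valid r) (hp : QueryBound A r p) :
    PolySamp (fun z : {z : AskIndex A r p j // z.1.2.2.2.2.1 = [] ∧ z.1.2.2.2.2.2.2.1 = false} =>
        z.1.size)
      (fun z => (Unary.mk z.1.1.1, z.1.1.2.2.2))
      fun z => (coercer n P₁ P₂ A r j).ask z.1.1.1 z.1.1.2.2.2 := by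
  have hin := (polyComp_askInput hA hp).reindex
    fun z : {z : AskIndex A r p j // z.1.2.2.2.2.1 = [] ∧ z.1.2.2.2.2.2.2.1 = false} => z.1
  have hrem := hin.snd.snd.snd.snd.snd
  have h₁ := (polySamp_ask_done (n := n) (P₁ := P₁) (P₂ := P₂) hA hp).reindex
    fun z : {z : {z : AskIndex A r p j // z.1.2.2.2.2.1 = [] ∧ z.1.2.2.2.2.2.2.1 = false} //
      Enc.enc z.1.1.2.2.2.2.2.2.2 = Data.nil} =>
        ⟨z.1.1, z.1.2.1, z.1.2.2, enc_list_eq_nil.1 z.2⟩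
  have h₂ := (polySamp_ask_idle (n := n) (P₁ := P₁) (P₂ := P₂) hA hp).reindex
    fun z : {z : {z : AskIndex A r p j // z.1.2.2.2.2.1 = [] ∧ z.1.2.2.2.2.2.2.1 = false} //
      Enc.enc z.1.1.2.2.2.2.2.2.2 ≠ Data.nil} =>
        ⟨z.1.1, z.1.2.1, z.1.2.2, fun h => z.2 (enc_list_eq_nil.2 h)⟩
  exact PolySamp.cond hrem h₁ h₂

theorem polySamp_ask_nil (hA : A.IsPPT Valid r) (hp : QueryBound A r p) :
    PolySamp (fun z : {z : AskIndex A r p j // z.1.2.2.2.2.1 = []} => z.1.size)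
      (fun z => (Unary.mk z.1.1.1, z.1.1.2.2.2))
      fun z => (coercer n P₁ P₂ A r j).ask z.1.1.1 z.1.1.2.2.2 := by
  have hin := (polyComp_askInput hA hp).reindex
    fun z : {z : AskIndex A r p j // z.1.2.2.2.2.1 = []} => z.1
  have hw := hin.snd.snd.snd.snd.fst
  have h₁ := (polySamp_ask_free (n := n) (P₁ := P₁) (P₂ := P₂) hA hp).reindex
    fun z : {z : {z : AskIndex A r p j // z.1.2.2.2.2.1 = []} //
      Enc.enc z.1.1.2.2.2.2.2.2.1 = Data.nil} => ⟨z.1.1, z.1.2, enc_bool_eq_nil.1 z.2⟩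
  have h₂ := (polySamp_ask_waiting (n := n) (P₁ := P₁) (P₂ := P₂) hA hp).reindex
    fun z : {z : {z : AskIndex A r p j // z.1.2.2.2.2.1 = []} //
      Enc.enc z.1.1.2.2.2.2.2.2.1 ≠ Data.nil} => ⟨z.1.1, z.1.2, enc_bool_ne_nil.1 z.2⟩
  exact PolySamp.cond hw h₁ h₂

theorem polySamp_ask (hA : A.IsPPT Valid r) (hp : QueryBound A r p) (hU : D.Universal n P₁ P₂) :
    PolySamp (fun z : AskIndex A r p j => z.size) (fun z => (Unary.mk z.1.1, z.1.2.2.2))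
      fun z => (coercer n P₁ P₂ A r j).ask z.1.1 z.1.2.2.2 := by
  have hin := polyComp_askInput (j := j) hA hp
  have hy := hin.snd.snd.fst
  have h₁ := (polySamp_ask_nil (n := n) (P₁ := P₁) (P₂ := P₂) hA hp).reindex
    fun z : {z : AskIndex A r p j // Enc.enc z.1.2.2.2.2.1 = Data.nil} =>
      ⟨z.1, enc_list_eq_nil.1 z.2⟩
  have h₂ := (polySamp_ask_cons hA hp hU).reindex
    fun z : {z : AskIndex A r p j // Enc.enc z.1.2.2.2.2.1 ≠ Data.nil} =>
      ⟨z.1, fun h => z.2 (enc_list_eq_nil.2 h)⟩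
  exact PolySamp.cond hy h₁ h₂

/-- Every submitted request belongs to a valid query of the distinguisher, so it is legitimate and
short, and the universal patterns turn it into a valid triple of polynomial length. -/
theorem isPPT_coercer (hA : A.IsPPT (D.toORAM n P₁).ValidQuery r) (hp : QueryBound A r p)
    (hU : D.Universal n P₁ P₂) (j : Bool) :
    (coercer n P₁ P₂ A r j).toAdversary.IsPPT D.ValidQuery (r * (p + 2)) := by
  obtain ⟨Q, hQ⟩ := SubmitInv.encSize_le (j := j) hA hp
  refine TypedAdversary.isPPT _ _ _
    (fun κ i l s => ∃ nA k m, SubmitInv A r p j κ i l s nA k m) ?_ ?_ ?_ ?_ ?_ ?_ ?_ ?_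
  · intro κ m s hs
    simp only [coercer, PMF.mem_support_bind_iff, PMF.mem_support_pure_iff] at hs
    obtain ⟨a, ha, rfl⟩ := hs
    refine ⟨encSize m.2, 0, r.eval κ, rfl, ?_, ?_, fun _ => ⟨rfl, zero_add _, .start _ a ha⟩,
      fun h => (nomatch h)⟩
    · have h1 : encSize m = encSize m.1 + encSize m.2 + 1 := rfl
      simp only [encSize_nil]; omega
    · simp
  · intro κ i l s s' hi h hs
    exact SubmitInv.pass hp hi h hs
  · intro κ i l s s' s'' q m hi h hs hs'
    exact SubmitInv.round h hs hs'
  · have hin := PolyComp.input (sz := fun z : {z : ℕ × Op // encSize z.2 ≤ p.eval z.1} => z.1.1)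
      (x := fun z => (Unary.mk z.1.1, z.1.2))
      (((PolyBdd.self.mul (.const 2)).add ((PolyBdd.self.eval p).add (.const 2))).mono fun z => by
        have := z.2
        simp only [encSize_pair, encSize_unary]; omega)
    obtain ⟨u, hu⟩ := ((hU.computable_n.at hin.fst .self).serveQuery
      (hU.computable₁.at hin.fst .self) (hU.computable₂.at hin.fst .self) hin.snd).bdd
    refine ⟨u, ?_⟩
    rintro κ i l s q s' hi ⟨nA, k, m, h⟩ hs
    obtain ⟨o, ho, rfl, -⟩ := mem_coercer_ask_some hs
    have hw : s.2.2.2.1 = true := by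
      cases hw : s.2.2.2.1 with
      | true => rfl
      | false =>
        have := (h.idle hw).1
        rw [ho] at this
        simp at this
    obtain ⟨h1, a₀, q₀, h2, h3, h4⟩ := h.pending hw
    obtain ⟨v, hv⟩ := hA.valid
    have h5 := (hv κ k nA a₀ q₀ _ (by omega) h2 h3).1
    have h6 := hp κ k nA a₀ q₀ _ (by omega) h2 h3
    have h7 : o ∈ if j then q₀.2 else q₀.1 := h4.subset (by rw [ho]; exact List.mem_cons_self)
    have h8 : encSize q₀ = encSize q₀.1 + encSize q₀.2 + 1 := rfl
    have h9 : o.Legit (D.hidCap κ) (D.blockLen κ) ∧ encSize o ≤ p.eval κ := by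
      split_ifs at h7
      · have := encSize_mem h7
        exact ⟨h5.2.1 o h7, by omega⟩
      · have := encSize_mem h7
        exact ⟨h5.1 o h7, by omega⟩
    exact ⟨validQuery_serveQuery hU h9.1, hu ⟨(κ, o), h9.2⟩⟩
  · have hin := PolyComp.input (sz := fun z : ℕ × Data × Trace => z.1 + encSize z.2)
      (x := fun z => (Unary.mk z.1, z.2)) ((PolyBdd.self.mul (.const 3)).mono fun z => by
        have := encSize_pos z.2
        simp only [encSize_pair, encSize_unary] at this ⊢; omega)
    have hs := ((hA.start.reindex fun z : ℕ × Data × Trace => (z.1, z.2.2)).resize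
      (sz' := fun z : ℕ × Data × Trace => z.1 + encSize z.2) (PolyBdd.self.mono fun z => by
        have : encSize z.2 = encSize z.2.1 + encSize z.2.2 + 1 := rfl
        simp only; omega)).comp (hin.fst.pair hin.snd.snd)
    refine PolySamp.bind hs ?_
    have hin' := hs.bindInput
    exact hin'.snd.pair ((PolyComp.nil hin'.input_bdd).pair ((PolyComp.nil hin'.input_bdd).pair
      ((PolyComp.const hin'.input_bdd false).pair (hin'.fst.fst.replicate_eval r))))
  · exact polySamp_ask hA hp hU
  · have hin := PolyComp.input (sz := fun z : {z : ℕ × ℕ × ℕ × SubmitState ×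
        (Pattern × Pattern × Pattern) × SubmitState × Device × Trace //
        z.2.1 < (r * (p + 2)).eval z.1 ∧
        (∃ nA k m, SubmitInv A r p j z.1 z.2.1 z.2.2.1 z.2.2.2.1 nA k m) ∧
        (some z.2.2.2.2.1, z.2.2.2.2.2.1) ∈
          ((coercer n P₁ P₂ A r j).ask z.1 z.2.2.2.1).support} =>
          z.1.1 + z.1.2.2.1 + encSize z.1.2.2.2.2.2.2)
      (x := fun z => (Unary.mk z.1.1, z.1.2.2.2.2.2.1, z.1.2.2.2.2.2.2))
      (((PolyBdd.self.mul (.const 3)).add ((PolyBdd.self.eval Q).add (.const 3))).mono fun z => by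
        obtain ⟨nA, k, m, h⟩ := z.2.2.1
        have h1 := hQ z.2.1.le h
        obtain ⟨o, ho, -, he⟩ := mem_coercer_ask_some z.2.2.2
        have h2 : encSize z.1.2.2.2.2.2.1 ≤ encSize z.1.2.2.2.1 := by
          rw [he]
          have h3 : encSize z.1.2.2.2.1 = encSize z.1.2.2.2.1.1 + (encSize z.1.2.2.2.1.2.1 +
            encSize z.1.2.2.2.1.2.2 + 1) + 1 := rfl
          rw [h3, ho, encSize_pair, encSize_pair, encSize_cons]
          omega
        have h4 := Q.eval_nat_mono
          (Nat.le_add_right (z.1.1 + z.1.2.2.1) (encSize z.1.2.2.2.2.2.2))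
        simp only [encSize_pair, encSize_unary] at h1 h2 ⊢
        omega)
    exact hin.snd.fst.fst.pair (hin.snd.fst.snd.fst.pair
      ((hin.snd.fst.snd.snd.fst.append hin.snd.snd.snd).pair hin.snd.fst.snd.snd.snd))
  · choose nA k m hinv using fun z : {z : ℕ × ℕ × SubmitState // ∃ nA k m,
      SubmitInv A r p j z.1 ((r * (p + 2)).eval z.1) z.2.1 z.2.2 nA k m} => z.2
    have hreach : ∀ z, A.Reach z.1.1 (r.eval z.1.1) (nA z) z.1.2.2.1 := by
      intro z
      have h1 := (hinv z).potential
      cases hw : z.1.2.2.2.2.2.1 with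
      | true => rw [hw, if_pos rfl] at h1; omega
      | false =>
        obtain ⟨-, h2, h3⟩ := (hinv z).idle hw
        have h4 : m z = 0 := by
          by_contra h4
          have := Nat.mul_pos (Nat.pos_of_ne_zero h4) (show 0 < p.eval z.1.1 + 2 by omega)
          omega
        rw [h4, add_zero] at h2
        rwa [h2] at h3
    have hg := (hA.guess.reindex fun z => ⟨(z.1.1, nA z, z.1.2.2.1), hreach z⟩).resize
      (sz' := fun z => z.1.1 + z.1.2.1)
      ((PolyBdd.self.add (PolyBdd.self.eval (r * (p + 2)))).mono fun z => by
        have h1 := (hinv z).size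
        have h2 := (r * (p + 2)).eval_nat_mono (Nat.le_add_right z.1.1 z.1.2.1)
        simp only
        omega)
    have hin := PolyComp.input (sz := fun z : {z : ℕ × ℕ × SubmitState // ∃ nA k m,
        SubmitInv A r p j z.1 ((r * (p + 2)).eval z.1) z.2.1 z.2.2 nA k m} => z.1.1 + z.1.2.1)
      (x := fun z => (Unary.mk z.1.1, z.1.2.2)) (((PolyBdd.self.mul (.const 2)).add
        ((PolyBdd.self.eval Q).add (.const 2))).mono fun z => by
          have h1 := hQ le_rfl (hinv z)
          simp only [encSize_pair, encSize_unary] at h1 ⊢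
          omega)
    exact hg.comp (hin.fst.pair hin.snd.fst)

/-- Triangle inequality through the common world with bit 0. The factor 2 undoes the halving in
`abs_prob_game`. -/
theorem toORAM_writeOnlyOblivious (hN : D.DummyNoop) (hS : D.TraceSecure)
    (hU : D.Universal n P₁ P₂) : (D.toORAM n P₁).WriteOnlyOblivious := by
  intro r A hA
  obtain ⟨p, hp⟩ := hA.valid
  have hp' : QueryBound A r p := fun κ i n s q s' hi hr hq => (hp κ i n s q s' hi hr hq).2
  have h := fun j => hS _ _ (isPPT_coercer hA hp' hU j)
  simp only [abs_prob_game] at h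
  refine (((h true).add (h false)).const_mul 2).trans_abs_le fun κ => ?_
  simp only [toORAM_world (P₂ := P₂) hp', Pi.add_apply]
  have e := world_coercer_false (κ := κ) hN hU hA hp'
  rw [← e, abs_abs]
  refine le_trans ?_ (le_abs_self _)
  rw [← add_div, mul_div_cancel₀ _ two_ne_zero]
  refine (abs_sub_le _ (prob (D.world (coercer n P₁ P₂ A r true).toAdversary (r * (p + 2)) false κ)
    (· = true)) _).trans_eq ?_
  rw [abs_sub_comm (prob (D.world _ _ false κ) _)]

end PDScheme

theorem mainTheorem1 :
    (∀ Γ : ORAM, Γ.IsWriteOnlyORAM →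
      (hive Γ).IsTraceOrientedPD ∧
        ∃ (n : ℕ → ℕ) (P₁ P₂ : ℕ → Pattern), (hive Γ).Universal n P₁ P₂) ∧
    (∀ D : PDScheme, D.IsTraceOrientedPD →
      ∀ (n : ℕ → ℕ) (P₁ P₂ : ℕ → Pattern), D.Universal n P₁ P₂ →
        (D.toORAM n P₁).IsWriteOnlyORAM) := by
  refine ⟨fun Γ ⟨h₁, h₂, h₃⟩ => ⟨⟨Hive.efficient h₁, Hive.correct h₂, Hive.dummyNoop Γ,
    Hive.traceSecure h₁ h₃⟩, Hive.universal Γ h₁⟩, ?_⟩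
  rintro D ⟨h₁, h₂, h₃, h₄⟩ n P₁ P₂ hU
  exact ⟨PDScheme.toORAM_efficient h₁ hU, PDScheme.toORAM_correct h₂ hU,
    PDScheme.toORAM_writeOnlyOblivious h₃ h₄ hU⟩
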